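/- Let $n\ge 1$, $0\le\varrho\le1$, $0\le\delta<1$ and put $m=-\frac n2(1-\varrho)$. Let $(C_{\alpha,\beta})$ be a family of real constants indexed by pairs of multi-indices $\alpha,\beta\in\mathbb{N}_0^n$. Then there is a constant $C<\infty$, depending only on $n$, $\varrho$, $\delta$ and $(C_{\alpha,\beta})$, with the following property. Let $a\in C^\infty(\mathbb{R}^n\times\mathbb{R}^n)$ be any complex-valued symbol in the Hörmander class $S^{m}_{\varrho,\delta}$ with these constants, that is, $$|\partial_x^\beta\partial_\xi^\alpha a(x,\xi)|\le C_{\alpha,\beta}\,(1+|\xi|^2)^{\frac12(m-\varrho|\alpha|+\delta|\beta|)}\qquad\text{for all multi-indices }\alpha,\beta\text{ and all }x,\xi\in\mathbb{R}^n,$$ and let $$T_au(x)=\frac1{(2\pi)^n}\int_{\mathbb{R}^n}e^{i\langle x,\xi\rangle}a(x,\xi)\,\hat u(\xi)\,d\xi,\qquad \hat u(\xi)=\int_{\mathbb{R}^n}e^{-i\langle y,\xi\rangle}u(y)\,dy .$$ Then for every Schwartz function $u:\mathbb{R}^n\to\mathbb{C}$ and every $x\in\mathbb{R}^n$, $$(T_au)^\sharp(x)\le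 C\,\big(M(|u|^2)(x)\big)^{1/2},$$ where $$f^\sharp(x)=\sup_{Q\ni x}\inf_{c\in\mathbb{C}}\frac1{|Q|}\int_Q|f(y)-c|\,dy,\qquad Mf(x)=\sup_{Q\ni x}\frac1{|Q|}\int_Q|f(y)|\,dy,$$ and the suprema run over all cubes $Q\subset\mathbb{R}^n$ that contain $x$ and have sides parallel to the coordinate axes. -/

import Mathlib

open MeasureTheory
open scoped ENNReal NNReal ContDiff SchwartzMap

noncomputable section

/-- `ℝⁿ` with its Euclidean structure. -/
abbrev Rn (n : ℕ) : Type := EuclideanSpace ℝ (Fin n)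

/-- The Japanese bracket `⟨ξ⟩ = (1 + |ξ|²)^{1/2}`. -/
def bracket {n : ℕ} (ξ : Rn n) : ℝ := Real.sqrt (1 + ‖ξ‖ ^ 2)

/-- The order `|α| = α₁ + ⋯ + αₙ` of a multi-index. -/
def multiOrder {n : ℕ} (α : Fin n → ℕ) : ℕ := ∑ i, α i

/-- The derivative of `f` in the fixed direction `v`. -/
def dirDeriv {V : Type*} [NormedAddCommGroup V] [NormedSpace ℝ V] (v : V) (f : V → ℂ) : V → ℂ :=
  fun p => fderiv ℝ f p v

/-- The iterated derivative `D_{v₁}^{α₁} ⋯ D_{vₙ}^{αₙ} f` along directions `v₁, …, vₙ`. -/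
def multiDeriv {n : ℕ} {V : Type*} [NormedAddCommGroup V] [NormedSpace ℝ V]
    (v : Fin n → V) (α : Fin n → ℕ) (f : V → ℂ) : V → ℂ :=
  (List.finRange n).foldr (fun i g => (dirDeriv (v i))^[α i] g) f

/-- `∂_x^β` acting on functions of `(x, ξ) ∈ ℝⁿ × ℝⁿ`. -/
def derivX {n : ℕ} (β : Fin n → ℕ) (a : Rn n × Rn n → ℂ) : Rn n × Rn n → ℂ :=
  multiDeriv (fun i => ((EuclideanSpace.single i (1 : ℝ) : Rn n), (0 : Rn n))) β a

/-- `∂_ξ^α` acting on functions of `(x, ξ) ∈ ℝⁿ × ℝⁿ`. -/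
def derivXi {n : ℕ} (α : Fin n → ℕ) (a : Rn n × Rn n → ℂ) : Rn n × Rn n → ℂ :=
  multiDeriv (fun i => ((0 : Rn n), (EuclideanSpace.single i (1 : ℝ) : Rn n))) α a

/-- `a` belongs to the Hörmander class `S^m_{ϱ,δ}`, with the constants `A α β`: it is smooth and
`|∂_x^β ∂_ξ^α a(x,ξ)| ≤ A α β ⟨ξ⟩^{m - ϱ|α| + δ|β|}` for all multi-indices `α`, `β`. A function
lies in `S^m_{ϱ,δ}` exactly when this holds for some `A`. -/
structure IsSymbol {n : ℕ} (m ρ δ : ℝ) (A : (Fin n → ℕ) → (Fin n → ℕ) → ℝ)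
    (a : Rn n × Rn n → ℂ) : Prop where
  smooth : ContDiff ℝ ∞ a
  bound : ∀ (α β : Fin n → ℕ) (x ξ : Rn n),
    ‖derivX β (derivXi α a) (x, ξ)‖ ≤
      A α β * bracket ξ ^ (m - ρ * (multiOrder α : ℝ) + δ * (multiOrder β : ℝ))

/-- The Fourier transform `û(ξ) = ∫ e^{-i⟨y,ξ⟩} u(y) dy`. -/
def fourierHat {n : ℕ} (u : Rn n → ℂ) (ξ : Rn n) : ℂ :=
  ∫ y : Rn n, Complex.exp (-(Complex.I * ((inner ℝ y ξ : ℝ) : ℂ))) * u y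

/-- The pseudo-differential operator
`T_a u(x) = (2π)^{-n} ∫ e^{i⟨x,ξ⟩} a(x,ξ) û(ξ) dξ`. -/
def pseudoDiff {n : ℕ} (a : Rn n × Rn n → ℂ) (u : Rn n → ℂ) (x : Rn n) : ℂ :=
  (1 / (2 * (Real.pi : ℂ)) ^ n) *
    ∫ ξ : Rn n, Complex.exp (Complex.I * ((inner ℝ x ξ : ℝ) : ℂ)) * a (x, ξ) * fourierHat u ξ

/-- The cube with centre `z` and side length `l`, with sides parallel to the axes. -/
def cube {n : ℕ} (z : Rn n) (l : ℝ) : Set (Rn n) := {y | ∀ i, |y i - z i| ≤ l / 2}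

/-- The average of a nonnegative function over a set. -/
def avg {n : ℕ} (Q : Set (Rn n)) (g : Rn n → ℝ≥0∞) : ℝ≥0∞ := (volume Q)⁻¹ * ∫⁻ y in Q, g y

/-- The sharp function
`f^♯(x) = sup_{Q ∋ x} inf_{c ∈ ℂ} |Q|⁻¹ ∫_Q |f(y) - c| dy`, with values in `[0, ∞]`. -/
def sharpFun {n : ℕ} (f : Rn n → ℂ) (x : Rn n) : ℝ≥0∞ :=
  ⨆ (z : Rn n) (l : ℝ) (_ : 0 < l) (_ : x ∈ cube z l),
    ⨅ c : ℂ, avg (cube z l) (fun y => ‖f y - c‖ₑ)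

/-- The Hardy-Littlewood maximal function
`M f(x) = sup_{Q ∋ x} |Q|⁻¹ ∫_Q |f(y)| dy`, with values in `[0, ∞]`. -/
def maximalFun {n : ℕ} (f : Rn n → ℝ) (x : Rn n) : ℝ≥0∞ :=
  ⨆ (z : Rn n) (l : ℝ) (_ : 0 < l) (_ : x ∈ cube z l), avg (cube z l) (fun y => ‖f y‖ₑ)

end

/-! Fix a cube `Q` of side `l` containing `x₀`, and let `M` be the value of the maximal function of
`|u|²` at `x₀`. It suffices to find a constant `c₀` for which the mean of `|T_a u - c₀|` over `Q` is
at most a constant times `M^{1/2}`. The symbol is split into dyadic pieces `a_j` living at `|ξ| ~ Λ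
= 2^j`. Weighted Plancherel shows that the kernel of a piece with bound `B` and derivative scale `μ
= Λ^{-ρ}` satisfies `|T_j u(x)|² ≲ B² Λⁿ ∫ |u(y)|² (1 + |x - y|/μ)^{-(2n+2)} dy`
(`exists_enorm_freqOp_sq_le`). Averaged over `Q`, this is at most `B² Λⁿ μⁿ M`. The critical order
is the one for which `B² Λⁿ μⁿ` is bounded (`critical_order_identity`), so each piece is bounded
with nothing to spare, and the proof consists in finding a summable gain.

Low frequencies, `lΛ ≤ 1`: `c₀` is the value at the centre of the low-frequency part. The difference
of a piece at `x` and at the centre is again a piece, with modulated symbol, and it gains the factor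
`lΛ` (`exists_low_frequency_bound`).

High frequencies, `ρ < 1`: `δ` may be enlarged to `ρ ≤ δ < 1`. On cubes of side `s = min(l,
Λ^{-(1+δ)/2})` the symbol is frozen in `x`, with relative error `sΛ^δ ≤ Λ^{-(1-δ)/2}`. The frozen
operator is a Fourier multiplier, bounded on `L²`, and acts essentially at distance `μ`. Localising
`u` to radius `R ~ μ (sΛ)^{1/2}` and averaging over the small cubes gains a power of `sΛ`, which is
at least the smaller of `lΛ` and `Λ^{(1-δ)/2}` (`exists_lintegral_freeze_le`,
`exists_high_piece_bound`).

High frequencies, `ρ = 1`: near `Q` single pieces have no gain, and the `L²` boundedness of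
order-zero operators of type `(1, δ)` is used for the whole sum (`exists_lintegral_sum_freqOp_le`).
Away from `Q` the kernels decay and the pieces are summed. The `L²` bound expands each kernel at
unit scale into products of a coefficient oscillating at frequency at most `2^{δj}` and a translate
of a frequency-localised part of `u`; integration by parts shows such products to be almost
orthogonal (`enorm_pairing_le`, `lintegral_sum_sq_le`).

Finally, Fatou's lemma passes from the dyadic partial sums to the operator
(`exists_setLIntegral_sub_le`). -/

/-! ### Volume, diameter and inclusions of axis-parallel cubes -/

section Cubes

variable {n : ℕ}

lemma cube_eq_preimage (z : Rn n) (l : ℝ) :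
    cube z l = WithLp.ofLp ⁻¹' (Set.univ.pi fun i => Set.Icc (z i - l / 2) (z i + l / 2)) := by
  ext y
  simp only [cube, Set.mem_ofPred_eq, Set.mem_preimage, Set.mem_pi, Set.mem_univ, true_imp_iff,
    Set.mem_Icc, abs_le]
  refine forall_congr' fun i => ?_
  constructor <;> rintro ⟨h1, h2⟩ <;> constructor <;> linarith

lemma measurableSet_cube (z : Rn n) (l : ℝ) : MeasurableSet (cube z l) := by
  rw [cube_eq_preimage]
  exact (PiLp.volume_preserving_ofLp (Fin n)).measurable
    (MeasurableSet.univ_pi fun i => measurableSet_Icc)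

lemma volume_cube (z : Rn n) {l : ℝ} (hl : 0 ≤ l) : volume (cube z l) = ENNReal.ofReal (l ^ n) := by
  rw [cube_eq_preimage, (PiLp.volume_preserving_ofLp (Fin n)).measure_preimage
    (MeasurableSet.univ_pi fun i => measurableSet_Icc).nullMeasurableSet, volume_pi_pi]
  have : ∀ i, z.ofLp i + l / 2 - (z.ofLp i - l / 2) = l := fun i => by ring
  simp only [Real.volume_Icc, this, Finset.prod_const, Finset.card_univ, Fintype.card_fin]
  rw [ENNReal.ofReal_pow hl]

lemma closedBall_subset_cube (z : Rn n) (r : ℝ) : Metric.closedBall z r ⊆ cube z (2 * r) := by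
  intro y hy i
  rw [mem_closedBall_iff_norm] at hy
  have := PiLp.norm_apply_le (y - z) i
  simp only [PiLp.sub_apply, Real.norm_eq_abs] at this
  linarith

lemma norm_le_of_abs_le {x : Rn n} {r : ℝ} (hr : 0 ≤ r) (h : ∀ i, |x i| ≤ r) :
    ‖x‖ ≤ n * r := by
  have h1 : ‖x‖ ^ 2 ≤ (n * r) ^ 2 := by
    rw [EuclideanSpace.real_norm_sq_eq]
    calc ∑ i, x i ^ 2 ≤ ∑ _i : Fin n, r ^ 2 :=
          Finset.sum_le_sum fun i _ => sq_le_sq' (by linarith [neg_abs_le (x i), h i])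
            ((le_abs_self _).trans (h i))
      _ = n * r ^ 2 := by simp
      _ ≤ (n * r) ^ 2 := by
          rcases Nat.eq_zero_or_pos n with rfl | hn
          · simp
          · have : (1 : ℝ) ≤ n := by exact_mod_cast hn
            nlinarith [sq_nonneg r, mul_nonneg (sub_nonneg.2 this) (sq_nonneg r)]
  exact le_of_sq_le_sq h1 (by positivity)

lemma norm_sub_le_of_mem_cube {z x y : Rn n} {l : ℝ} (hl : 0 ≤ l) (hx : x ∈ cube z l)
    (hy : y ∈ cube z l) : ‖x - y‖ ≤ n * l := by
  refine norm_le_of_abs_le hl fun i => ?_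
  have h1 := abs_le.1 (hx i)
  have h2 := abs_le.1 (hy i)
  rw [PiLp.sub_apply, abs_le]
  constructor <;> linarith

lemma self_mem_cube (z : Rn n) {l : ℝ} (hl : 0 ≤ l) : z ∈ cube z l := by
  intro i; simp; linarith

lemma cube_subset_cube (z : Rn n) {l l' : ℝ} (h : l ≤ l') : cube z l ⊆ cube z l' :=
  fun _ hy i => (hy i).trans (by linarith)

end Cubes

/-! ### Polynomially decaying weights against cube averages -/

section Weights

/-- The weight `(1 + |y| / R)^{-k}`. -/
noncomputable def decayWeight {n : ℕ} (k : ℕ) (R : ℝ) (y : Rn n) : ℝ≥0∞ :=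
  ENNReal.ofReal ((1 + ‖y‖ / R) ^ k)⁻¹

variable {n : ℕ}

lemma measurable_decayWeight (k : ℕ) (R : ℝ) :
    Measurable (decayWeight k R : Rn n → ℝ≥0∞) := by
  unfold decayWeight
  fun_prop

lemma measurable_decayWeight_sub_right (k : ℕ) (R : ℝ) (x : Rn n) :
    Measurable fun y : Rn n => decayWeight k R (y - x) :=
  (measurable_decayWeight _ _).comp (measurable_id.sub_const x)

/-- `M` bounds the averages of `g` over all cubes containing `x₀`. -/
def CubeAvgLE {n : ℕ} (g : Rn n → ℝ≥0∞) (x₀ : Rn n) (M : ℝ≥0∞) : Prop :=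
  ∀ (z : Rn n) (l : ℝ), 0 < l → x₀ ∈ cube z l → ∫⁻ y in cube z l, g y ≤ ENNReal.ofReal (l ^ n) * M

lemma exists_dyadic_ge {t : ℝ} (ht : 0 ≤ t) : ∃ i : ℕ, t ≤ 2 ^ i ∧ (2 : ℝ) ^ i ≤ 2 * (1 + t) := by
  classical
  have hex : ∃ i : ℕ, t ≤ (2 : ℝ) ^ i := pow_unbounded_of_one_lt t one_lt_two |>.imp fun _ => le_of_lt
  refine ⟨Nat.find hex, Nat.find_spec hex, ?_⟩
  rcases h : Nat.find hex with _ | k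
  · simp; linarith
  · have := Nat.find_min hex (m := k) (by omega)
    rw [pow_succ]; linarith

/-- One term suffices: for the least `i` with `‖y‖ / L ≤ 2 ^ i` one also has `2 ^ i ≤ 2 (1 + ‖y‖ /
L)`. -/
lemma decayWeight_le_tsum {L : ℝ} (hL : 0 < L) (y : Rn n) (k : ℕ) :
    decayWeight k L y ≤ ∑' i : ℕ, ENNReal.ofReal (2 ^ k * (2 ^ i)⁻¹ ^ k) *
      (Metric.closedBall (0 : Rn n) (2 ^ i * L)).indicator 1 y := by
  obtain ⟨i, hi1, hi2⟩ := exists_dyadic_ge (t := ‖y‖ / L) (by positivity)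
  refine le_trans ?_ (ENNReal.le_tsum i)
  have hmem : y ∈ Metric.closedBall (0 : Rn n) (2 ^ i * L) := by
    rw [mem_closedBall_zero_iff]; exact (div_le_iff₀ hL).1 hi1
  rw [Set.indicator_of_mem hmem, Pi.one_apply, mul_one, decayWeight]
  refine ENNReal.ofReal_le_ofReal ?_
  rw [← mul_pow, ← inv_pow]
  refine pow_le_pow_left₀ (by positivity) ?_ k
  rw [inv_le_iff_one_le_mul₀ (by positivity), mul_assoc, mul_left_comm, ← div_eq_inv_mul,
    le_div_iff₀ (by positivity)]
  linarith

/-- The ball of radius `2^i L` costs `2^{in}` and the weight there is about `2^{-i(n+1)}`. The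
exponent `n + 1` therefore leaves a geometric series. -/
lemma lintegral_mul_decayWeight_le {g : Rn n → ℝ≥0∞} (hg : Measurable g) {x₀ : Rn n} {M : ℝ≥0∞}
    (hM : CubeAvgLE g x₀ M) {L : ℝ} (hL : 0 < L) :
    ∫⁻ y, g y * decayWeight (n + 1) L (y - x₀) ≤ ENNReal.ofReal (4 ^ (n + 1) * L ^ n) * M := by
  calc ∫⁻ y, g y * decayWeight (n + 1) L (y - x₀)
      ≤ ∫⁻ y, ∑' i : ℕ, ENNReal.ofReal (2 ^ (n + 1) * (2 ^ i)⁻¹ ^ (n + 1)) *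
          (Metric.closedBall x₀ (2 ^ i * L)).indicator g y := by
        refine lintegral_mono fun y => ?_
        refine (mul_le_mul_right (decayWeight_le_tsum hL (y - x₀) (n + 1)) (g y)).trans_eq ?_
        rw [← ENNReal.tsum_mul_left]
        refine tsum_congr fun i => ?_
        by_cases h : y ∈ Metric.closedBall x₀ (2 ^ i * L)
        · have h' : y - x₀ ∈ Metric.closedBall (0 : Rn n) (2 ^ i * L) := by
            rw [mem_closedBall_zero_iff]; rwa [mem_closedBall_iff_norm] at h
          rw [Set.indicator_of_mem h, Set.indicator_of_mem h', Pi.one_apply, mul_one, mul_comm]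
        · have h' : y - x₀ ∉ Metric.closedBall (0 : Rn n) (2 ^ i * L) := by
            rw [mem_closedBall_zero_iff]; rwa [mem_closedBall_iff_norm] at h
          rw [Set.indicator_of_notMem h, Set.indicator_of_notMem h', mul_zero, mul_zero]
    _ = ∑' i : ℕ, ENNReal.ofReal (2 ^ (n + 1) * (2 ^ i)⁻¹ ^ (n + 1)) *
          ∫⁻ y in Metric.closedBall x₀ (2 ^ i * L), g y := by
        rw [lintegral_tsum fun i => ((hg.indicator
          Metric.isClosed_closedBall.measurableSet).const_mul _).aemeasurable]
        refine tsum_congr fun i => ?_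
        rw [lintegral_const_mul _ (hg.indicator Metric.isClosed_closedBall.measurableSet),
          lintegral_indicator Metric.isClosed_closedBall.measurableSet]
    _ ≤ ∑' i : ℕ, ENNReal.ofReal (2 ^ (n + 1) * (2 ^ i)⁻¹ ^ (n + 1)) *
          (ENNReal.ofReal ((2 * (2 ^ i * L)) ^ n) * M) := by
        refine ENNReal.tsum_le_tsum fun i => mul_le_mul_right ?_ _
        exact (lintegral_mono_set (closedBall_subset_cube _ _)).trans
          (hM x₀ _ (by positivity) (self_mem_cube _ (by positivity)))
    _ = ∑' i : ℕ, (ENNReal.ofReal ((2 : ℝ)⁻¹ ^ i * (2 ^ (n + 1) * 2 ^ n * L ^ n)) * M) := by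
        refine tsum_congr fun i => ?_
        rw [← mul_assoc, ← ENNReal.ofReal_mul (by positivity)]
        congr 2
        have : (0 : ℝ) < 2 ^ i := by positivity
        rw [inv_pow, inv_pow, mul_pow, mul_pow, pow_succ ((2 : ℝ) ^ i)]
        field_simp
    _ = ENNReal.ofReal (4 ^ (n + 1) * L ^ n) * M := by
        rw [ENNReal.tsum_mul_right]
        congr 1
        rw [← ENNReal.ofReal_tsum_of_nonneg (fun i => by positivity)
          ((summable_geometric_of_lt_one (by norm_num) (by norm_num)).mul_right _), tsum_mul_right,
          tsum_geometric_of_lt_one (by norm_num) (by norm_num)]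
        congr 1
        have : (4 : ℝ) ^ (n + 1) = 2 ^ (n + 1) * 2 ^ (n + 1) := by rw [← mul_pow]; norm_num
        rw [this, pow_succ (2 : ℝ) n]; ring

lemma lintegral_decayWeight_le {R : ℝ} (hR : 0 < R) (x₀ : Rn n) :
    ∫⁻ y : Rn n, decayWeight (n + 1) R (y - x₀) ≤ ENNReal.ofReal (4 ^ (n + 1) * R ^ n) := by
  have := lintegral_mul_decayWeight_le (g := fun _ : Rn n => 1) measurable_const (x₀ := x₀) (M := 1)
    (fun z l hl _ => by simp [volume_cube z hl.le]) hR
  simpa using this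

lemma decayWeight_sub_comm (k : ℕ) (R : ℝ) (x y : Rn n) :
    decayWeight k R (x - y) = decayWeight k R (y - x) := by
  rw [decayWeight, decayWeight, norm_sub_rev]

lemma decayWeight_le_of_le {k : ℕ} {R R' c : ℝ} {y y' : Rn n} (hR : 0 < R) (hR' : 0 < R')
    (h : 1 + ‖y'‖ / R' ≤ c * (1 + ‖y‖ / R)) :
    decayWeight k R y ≤ ENNReal.ofReal (c ^ k) * decayWeight k R' y' := by
  have h1 : 0 < 1 + ‖y'‖ / R' := by positivity
  have h2 : 0 < 1 + ‖y‖ / R := by positivity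
  have hc : 0 < c := by
    by_contra hc
    have := mul_nonneg (neg_nonneg.2 (not_lt.1 hc)) h2.le
    nlinarith
  rw [decayWeight, decayWeight, ← ENNReal.ofReal_mul (by positivity)]
  refine ENNReal.ofReal_le_ofReal ?_
  rw [← inv_pow, ← inv_pow, ← mul_pow]
  refine pow_le_pow_left₀ (by positivity) ?_ k
  rw [inv_le_iff_one_le_mul₀ h2, mul_comm c, mul_assoc, ← div_eq_inv_mul, le_div_iff₀ h1]
  linarith

lemma decayWeight_add (j k : ℕ) {R : ℝ} (hR : 0 < R) (y : Rn n) :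
    decayWeight (j + k) R y = decayWeight j R y * decayWeight k R y := by
  rw [decayWeight, decayWeight, decayWeight, ← ENNReal.ofReal_mul (by positivity), pow_add, mul_inv]

lemma decayWeight_le_one (k : ℕ) {R : ℝ} (hR : 0 < R) (y : Rn n) : decayWeight k R y ≤ 1 := by
  rw [decayWeight, ← ENNReal.ofReal_one]
  refine ENNReal.ofReal_le_ofReal (inv_le_one_of_one_le₀ (one_le_pow₀ ?_))
  have : 0 ≤ ‖y‖ / R := by positivity
  linarith

/-- This allows the centre of a weight to be moved from a point of a cube to `x₀`, if the scale is
raised to at least the side of the cube. -/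
lemma one_add_norm_div_le {x y x₀ : Rn n} {R L c : ℝ} (hR : 0 < R) (hRL : R ≤ L)
    (hx : ‖x - x₀‖ ≤ c * L) : 1 + ‖y - x₀‖ / L ≤ (c + 1) * (1 + ‖y - x‖ / R) := by
  have hL : 0 < L := hR.trans_le hRL
  have hc : 0 ≤ c := by
    by_contra h
    have := (norm_nonneg _).trans hx
    nlinarith
  have h1 : ‖y - x₀‖ ≤ ‖y - x‖ + ‖x - x₀‖ := norm_sub_le_norm_sub_add_norm_sub _ _ _
  have h2 : ‖y - x₀‖ / L ≤ ‖y - x‖ / R + c := by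
    calc ‖y - x₀‖ / L ≤ (‖y - x‖ + c * L) / L := by gcongr; linarith
      _ = ‖y - x‖ / L + c := by field_simp
      _ ≤ ‖y - x‖ / R + c := by gcongr
  have h3 : 0 ≤ c * (‖y - x‖ / R) := by positivity
  linarith

/-- The integral over a cube `Q` of a weighted average of `g` at scale `R` is controlled by the
averages of `g` over the cubes that contain a point of `Q`. -/
lemma lintegral_cube_lintegral_decayWeight_le {g : Rn n → ℝ≥0∞} (hg : Measurable g) {x₀ : Rn n}
    {M : ℝ≥0∞} (hM : CubeAvgLE g x₀ M) {z : Rn n} {l : ℝ} (hl : 0 < l) (hx₀ : x₀ ∈ cube z l)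
    {R : ℝ} (hR : 0 < R) :
    ∫⁻ x in cube z l, ∫⁻ y, g y * decayWeight (2 * n + 2) R (y - x) ≤
      ENNReal.ofReal (16 ^ (n + 1) * (n + 1) ^ (2 * n + 2) * l ^ n * R ^ n) * M := by
  -- After Fubini, what is needed is a bound for the weight integrated over the cube by a single
  -- weight centred at `x₀`, at scale `L = max l R`.
  have key : ∃ A L : ℝ, 0 ≤ A ∧ 0 < L ∧
      4 ^ (n + 1) * A * L ^ n ≤ 16 ^ (n + 1) * (n + 1) ^ (2 * n + 2) * l ^ n * R ^ n ∧
      ∀ y : Rn n, ∫⁻ x in cube z l, decayWeight (2 * n + 2) R (y - x) ≤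
        ENNReal.ofReal A * decayWeight (n + 1) L (y - x₀) := by
    have hn1 : (1 : ℝ) ≤ (n : ℝ) + 1 := by have : (0 : ℝ) ≤ n := n.cast_nonneg; linarith
    have e16 : (16 : ℝ) ^ (n + 1) = 4 ^ (n + 1) * 4 ^ (n + 1) := by rw [← mul_pow]; norm_num
    have h4 : (1 : ℝ) ≤ 4 ^ (n + 1) := one_le_pow₀ (by norm_num)
    have hnn : ((n : ℝ) + 1) ^ (n + 1) ≤ (n + 1) ^ (2 * n + 2) :=
      pow_le_pow_right₀ hn1 (by omega)
    have two : 2 * n + 2 = (n + 1) + (n + 1) := by ring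
    -- The exponent `2n + 2` is two copies of `n + 1`. For `l ≤ R` one copy is discarded and the
    -- other is nearly constant on the cube, which contributes `l ^ n`. For `l > R` one copy is
    -- recentred at `x₀` and the other is integrated, which contributes `R ^ n`. In both cases `A L
    -- ^ n` is of size `l ^ n R ^ n`.
    rcases le_or_gt l R with h | h
    · refine ⟨l ^ n * (n + 1) ^ (n + 1), R, by positivity, hR, ?_, fun y => ?_⟩
      · rw [e16]
        calc (4 : ℝ) ^ (n + 1) * (l ^ n * (n + 1) ^ (n + 1)) * R ^ n
            = 4 ^ (n + 1) * 1 * (n + 1) ^ (n + 1) * l ^ n * R ^ n := by ring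
          _ ≤ _ := by gcongr
      · calc ∫⁻ x in cube z l, decayWeight (2 * n + 2) R (y - x)
            ≤ ∫⁻ x in cube z l, ENNReal.ofReal ((n + 1) ^ (n + 1)) *
                decayWeight (n + 1) R (y - x₀) := by
              refine setLIntegral_mono measurable_const fun x hx => ?_
              rw [two, decayWeight_add _ _ hR]
              refine (mul_le_of_le_one_left' (decayWeight_le_one _ hR _)).trans ?_
              refine decayWeight_le_of_le hR hR (one_add_norm_div_le hR le_rfl ?_)
              refine (norm_sub_le_of_mem_cube hl.le hx hx₀).trans (by gcongr)
          _ = _ := by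
              rw [lintegral_const, Measure.restrict_apply_univ, volume_cube z hl.le,
                ENNReal.ofReal_mul (by positivity)]
              ring
    · refine ⟨4 ^ (n + 1) * R ^ n * (n + 1) ^ (n + 1), l, by positivity, hl, ?_, fun y => ?_⟩
      · rw [e16]
        calc (4 : ℝ) ^ (n + 1) * (4 ^ (n + 1) * R ^ n * (n + 1) ^ (n + 1)) * l ^ n
            = 4 ^ (n + 1) * 4 ^ (n + 1) * (n + 1) ^ (n + 1) * l ^ n * R ^ n := by ring
          _ ≤ _ := by gcongr
      · calc ∫⁻ x in cube z l, decayWeight (2 * n + 2) R (y - x)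
            ≤ ∫⁻ x in cube z l, decayWeight (n + 1) R (x - y) *
                (ENNReal.ofReal ((n + 1) ^ (n + 1)) * decayWeight (n + 1) l (y - x₀)) := by
              refine setLIntegral_mono ?_ fun x hx => ?_
              · exact ((measurable_decayWeight _ _).comp (measurable_id.sub_const y)).mul_const _
              rw [two, decayWeight_add _ _ hR, decayWeight_sub_comm _ _ x y]
              gcongr
              exact decayWeight_le_of_le hR hl (one_add_norm_div_le hR h.le
                (norm_sub_le_of_mem_cube hl.le hx hx₀))
          _ ≤ ∫⁻ x, decayWeight (n + 1) R (x - y) *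
                (ENNReal.ofReal ((n + 1) ^ (n + 1)) * decayWeight (n + 1) l (y - x₀)) :=
              setLIntegral_le_lintegral _ _
          _ ≤ _ := by
              rw [lintegral_mul_const _ (measurable_decayWeight_sub_right _ _ y), ← mul_assoc]
              gcongr
              refine (mul_le_mul_left (lintegral_decayWeight_le hR y) _).trans_eq ?_
              rw [← ENNReal.ofReal_mul (by positivity)]
  obtain ⟨A, L, hA, hL, hAL, hle⟩ := key
  have hmeas : Measurable (Function.uncurry fun (x y : Rn n) =>
      g y * decayWeight (2 * n + 2) R (y - x)) :=
    (hg.comp measurable_snd).mul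
      ((measurable_decayWeight _ _).comp (measurable_snd.sub measurable_fst))
  rw [lintegral_lintegral_swap hmeas.aemeasurable]
  calc ∫⁻ y, ∫⁻ x in cube z l, g y * decayWeight (2 * n + 2) R (y - x)
      = ∫⁻ y, g y * ∫⁻ x in cube z l, decayWeight (2 * n + 2) R (y - x) := by
        refine lintegral_congr fun y => ?_
        rw [lintegral_const_mul]
        exact (measurable_decayWeight _ _).comp (measurable_const.sub measurable_id)
    _ ≤ ∫⁻ y, ENNReal.ofReal A * (g y * decayWeight (n + 1) L (y - x₀)) := by
        refine lintegral_mono fun y => ?_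
        refine (mul_le_mul_right (hle y) (g y)).trans_eq (by ring)
    _ = ENNReal.ofReal A * ∫⁻ y, g y * decayWeight (n + 1) L (y - x₀) := by
        rw [lintegral_const_mul]
        exact hg.mul ((measurable_decayWeight _ _).comp (measurable_id.sub_const _))
    _ ≤ ENNReal.ofReal A * (ENNReal.ofReal (4 ^ (n + 1) * L ^ n) * M) := by
        gcongr; exact lintegral_mul_decayWeight_le hg hM hL
    _ ≤ _ := by
        rw [← mul_assoc, ← ENNReal.ofReal_mul hA]
        refine mul_le_mul_left (ENNReal.ofReal_le_ofReal (le_trans (le_of_eq ?_) hAL)) _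
        ring

end Weights

/-! ### Fourier multipliers: kernels, weighted Plancherel, pointwise bounds -/

section FrequencyOperators

open FourierTransform LineDeriv

variable {n : ℕ}

/-- The Fourier multiplier with symbol `f`, in the normalisation of `𝓕`. -/
noncomputable def freqOp (f : Rn n → ℂ) (u : 𝓢(Rn n, ℂ)) (x : Rn n) : ℂ :=
  𝓕⁻ (fun v => f v * 𝓕 (u : Rn n → ℂ) v) x

/-- Smooth symbols supported in the ball of radius `2Λ` whose `k`-th pure derivatives, for
`k = 0, n + 1`, are bounded by `B μ ^ k`. -/
structure IsPiece (Λ μ B : ℝ) (f : Rn n → ℂ) : Prop where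
  smooth : ContDiff ℝ ∞ f
  eq_zero : ∀ ξ, 2 * Λ < ‖ξ‖ → f ξ = 0
  norm_le : ∀ ξ, ‖f ξ‖ ≤ B
  deriv_le : ∀ i ξ, ‖(dirDeriv (EuclideanSpace.single i (1 : ℝ)))^[n + 1] f ξ‖ ≤ B * μ ^ (n + 1)

lemma freqOp_eq_integral (f : Rn n → ℂ) (u : 𝓢(Rn n, ℂ)) (x : Rn n) :
    freqOp f u x = ∫ v, Complex.exp (↑(2 * Real.pi * inner ℝ v x) * Complex.I) *
      (f v * 𝓕 (u : Rn n → ℂ) v) := by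
  simp only [freqOp, Real.fourierInv_eq', smul_eq_mul]

/-- The multiplication formula `∫ ĝ u = ∫ g û` for `g(v) = e^{2πi⟨v,x⟩} f(v)`, whose transform is
that of `f` translated by `x`. -/
lemma freqOp_eq_kernel {f : Rn n → ℂ} (hf : Integrable f) (u : 𝓢(Rn n, ℂ)) (x : Rn n) :
    freqOp f u x = ∫ y, 𝓕 f (y - x) * u y := by
  set g : Rn n → ℂ := fun v => Complex.exp (↑(2 * Real.pi * inner ℝ v x) * Complex.I) * f v
  have hc : Continuous fun v : Rn n =>
      Complex.exp (↑(2 * Real.pi * inner ℝ v x) * Complex.I) := by fun_prop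
  have hg : Integrable g := by
    refine hf.bdd_mul (c := 1) hc.aestronglyMeasurable (Filter.Eventually.of_forall fun v => ?_)
    rw [Complex.norm_exp_ofReal_mul_I]
  have h := VectorFourier.integral_fourierIntegral_smul_eq_flip (L := innerₗ (Rn n))
    (f := g) (g := (u : Rn n → ℂ)) Real.continuous_fourierChar continuous_inner hg (u.integrable (μ := volume))
  rw [freqOp_eq_integral]
  simp only [flip_innerₗ, smul_eq_mul] at h
  have h1 : ∀ y, VectorFourier.fourierIntegral Real.fourierChar volume (innerₗ (Rn n)) g y =
      𝓕 f (y - x) := by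
    intro y
    change 𝓕 g y = _
    rw [Real.fourier_eq', Real.fourier_eq']
    refine integral_congr_ae (Filter.Eventually.of_forall fun v => ?_)
    simp only [g, smul_eq_mul]
    rw [← mul_assoc, ← Complex.exp_add, inner_sub_right]
    congr 2
    push_cast
    ring
  simp only [h1] at h
  rw [h]
  refine integral_congr_ae (Filter.Eventually.of_forall fun v => ?_)
  simp only [g]
  change _ = _ * 𝓕 (u : Rn n → ℂ) v
  ring

lemma lintegral_enorm_sq_fourier (g : 𝓢(Rn n, ℂ)) :
    ∫⁻ ξ, ‖𝓕 (g : Rn n → ℂ) ξ‖ₑ ^ 2 = ∫⁻ x, ‖g x‖ₑ ^ 2 := by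
  have aux : ∀ h : 𝓢(Rn n, ℂ), ∫⁻ x, ‖h x‖ₑ ^ 2 = ENNReal.ofReal (∫ x, ‖h x‖ ^ 2) := by
    intro h
    rw [ofReal_integral_eq_lintegral_ofReal]
    · refine lintegral_congr fun x => ?_
      rw [ENNReal.ofReal_pow (norm_nonneg _), ofReal_norm]
    · exact (h.memLp 2).integrable_norm_pow (by norm_num)
    · exact Filter.Eventually.of_forall fun x => by positivity
  have := SchwartzMap.integral_norm_sq_fourier g
  rw [aux g, ← this, ← aux]
  rfl

/-- The derivative is delivered as a Schwartz function so that Plancherel applies to it. -/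
lemma fourier_iterate_dirDeriv (F : 𝓢(Rn n, ℂ)) (v : Rn n) (k : ℕ) :
    ∃ G : 𝓢(Rn n, ℂ), (G : Rn n → ℂ) = (dirDeriv v)^[k] F ∧
      ∀ y, 𝓕 (G : Rn n → ℂ) y = (2 * Real.pi * Complex.I * inner ℝ y v) ^ k *
        𝓕 (F : Rn n → ℂ) y := by
  induction k with
  | zero => exact ⟨F, rfl, fun y => by simp⟩
  | succ k ih =>
    obtain ⟨G, hG, hF⟩ := ih
    refine ⟨∂_{v} G, ?_, fun y => ?_⟩
    · rw [Function.iterate_succ_apply', ← hG]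
      ext y
      rw [SchwartzMap.lineDerivOp_apply_eq_fderiv]
      rfl
    · have h1 : (inner ℝ · v : Rn n → ℝ).HasTemperateGrowth := by fun_prop
      have h2 := congrArg (fun H : 𝓢(Rn n, ℂ) => H y) (SchwartzMap.fourier_lineDerivOp_eq G v)
      simp only [smul_apply, SchwartzMap.smulLeftCLM_apply_apply h1] at h2
      change 𝓕 ((∂_{v} G : 𝓢(Rn n, ℂ)) : Rn n → ℂ) y = _ at h2
      rw [h2]
      change (2 * Real.pi * Complex.I : ℂ) • inner ℝ y v • 𝓕 (G : Rn n → ℂ) y = _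
      rw [hF, pow_succ, Complex.real_smul, smul_eq_mul]
      ring

namespace IsPiece

variable {Λ μ B : ℝ} {f : Rn n → ℂ}

lemma hasCompactSupport (h : IsPiece Λ μ B f) : HasCompactSupport f := by
  refine HasCompactSupport.intro (isCompact_closedBall (0 : Rn n) (2 * Λ)) fun ξ hξ => h.eq_zero ξ ?_
  rwa [mem_closedBall_zero_iff, not_le] at hξ

lemma nonneg (h : IsPiece Λ μ B f) : 0 ≤ B := (norm_nonneg _).trans (h.norm_le 0)

/-- A piece as a Schwartz function. -/
noncomputable def toSchwartz (h : IsPiece Λ μ B f) : 𝓢(Rn n, ℂ) :=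
  h.hasCompactSupport.toSchwartzMap h.smooth

@[simp] lemma coe_toSchwartz (h : IsPiece Λ μ B f) : (h.toSchwartz : Rn n → ℂ) = f := rfl

lemma integrable (h : IsPiece Λ μ B f) : Integrable f :=
  h.toSchwartz.integrable

end IsPiece

lemma iterate_dirDeriv_eq_zero {f : Rn n → ℂ} {r : ℝ} (h : ∀ ξ, r < ‖ξ‖ → f ξ = 0) (v : Rn n)
    (k : ℕ) : ∀ ξ, r < ‖ξ‖ → (dirDeriv v)^[k] f ξ = 0 := by
  induction k with
  | zero => simpa using h
  | succ k ih =>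
    intro ξ hξ
    rw [Function.iterate_succ_apply', dirDeriv]
    have : (dirDeriv v)^[k] f =ᶠ[nhds ξ] fun _ => 0 := by
      filter_upwards [(isOpen_lt continuous_const continuous_norm).mem_nhds hξ] with y hy
      exact ih y hy
    rw [this.fderiv_eq]
    simp

/-- Because of this, pure derivatives of order `n + 1` in the coordinate directions control the
kernel and no mixed ones are needed. The summand `1` covers the empty sum for `n = k = 0`. -/
lemma exists_norm_pow_le (n k : ℕ) : ∃ c : ℝ, 0 ≤ c ∧ ∀ y : Rn n,
    ‖y‖ ^ k ≤ c * (1 + ∑ i, |y i| ^ k) := by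
  refine ⟨(n : ℝ) ^ k, by positivity, fun y => ?_⟩
  rcases Nat.eq_zero_or_pos n with rfl | hn
  · have : y = 0 := Subsingleton.elim _ _
    rcases Nat.eq_zero_or_pos k with rfl | hk
    · simp
    · subst this; simp [hk.ne']
  · have : Nonempty (Fin n) := ⟨⟨0, hn⟩⟩
    obtain ⟨i, hi⟩ := Finite.exists_max fun i => |y i|
    have h1 := norm_le_of_abs_le (abs_nonneg _) hi
    calc ‖y‖ ^ k ≤ (n * |y i|) ^ k := by gcongr
      _ = n ^ k * |y i| ^ k := mul_pow _ _ _
      _ ≤ n ^ k * (1 + ∑ i, |y i| ^ k) := by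
          gcongr
          have := Finset.single_le_sum (f := fun i => |y i| ^ k) (fun _ _ => by positivity)
            (Finset.mem_univ i)
          simp only at this
          linarith

lemma lintegral_enorm_sq_le_of_support {f : Rn n → ℂ} {r B : ℝ} (hr : 0 ≤ r) (hB : 0 ≤ B)
    (h0 : ∀ ξ, r < ‖ξ‖ → f ξ = 0) (hb : ∀ ξ, ‖f ξ‖ ≤ B) :
    ∫⁻ ξ, ‖f ξ‖ₑ ^ 2 ≤ ENNReal.ofReal (B ^ 2 * (2 * r) ^ n) := by
  calc ∫⁻ ξ, ‖f ξ‖ₑ ^ 2 ≤ ∫⁻ ξ, (cube 0 (2 * r)).indicator (fun _ => ENNReal.ofReal (B ^ 2)) ξ := by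
        refine lintegral_mono fun ξ => ?_
        by_cases hξ : ξ ∈ cube 0 (2 * r)
        · rw [Set.indicator_of_mem hξ, ENNReal.ofReal_pow hB, ← ofReal_norm]
          gcongr
          exact hb ξ
        · have : f ξ = 0 := by
            refine h0 ξ ?_
            by_contra h
            exact hξ (closedBall_subset_cube 0 r (mem_closedBall_zero_iff.2 (not_lt.1 h)))
          simp [this]
    _ = _ := by
        rw [lintegral_indicator (measurableSet_cube _ _), setLIntegral_const,
          volume_cube _ (by positivity), ← ENNReal.ofReal_mul (by positivity)]

/-- Weighted Plancherel estimate for the kernel of a piece. -/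
lemma exists_lintegral_kernel_le (n : ℕ) : ∃ C : ℝ, 0 ≤ C ∧
    ∀ (Λ μ B : ℝ) (f : Rn n → ℂ), 0 < Λ → 0 < μ → IsPiece Λ μ B f →
      ∫⁻ y, ‖𝓕 f y‖ₑ ^ 2 * ENNReal.ofReal ((1 + ‖y‖ / μ) ^ (2 * n + 2)) ≤
        ENNReal.ofReal (C * B ^ 2 * Λ ^ n) := by
  obtain ⟨c, hc, hcn⟩ := exists_norm_pow_le n (2 * n + 2)
  -- The support lies in a cube of side `4Λ`, whence `4 ^ n`; `1 + n` counts `f` and its `n` pure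
  -- derivatives; the rest comes from expanding the weight.
  refine ⟨2 ^ (2 * n + 2) * (1 + c) * (1 + n) * 4 ^ n, by positivity, fun Λ μ B f hΛ hμ hf => ?_⟩
  have hB := hf.nonneg
  set e : Fin n → Rn n := fun i => EuclideanSpace.single i 1
  choose G hG hGF using fun i => fourier_iterate_dirDeriv hf.toSchwartz (e i) (n + 1)
  -- The weight is at most a constant times `1 + ∑ (|y i| / μ)^(2n+2)`, and `y_i^(n+1)` on the
  -- Fourier side is a derivative of order `n + 1` on `f`. Powers of `2π ≥ 1` are dropped.
  have hpt : ∀ y, ‖𝓕 f y‖ₑ ^ 2 * ENNReal.ofReal ((1 + ‖y‖ / μ) ^ (2 * n + 2)) ≤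
      ENNReal.ofReal (2 ^ (2 * n + 2) * (1 + c)) * (‖𝓕 f y‖ₑ ^ 2 +
        ∑ i, ENNReal.ofReal ((μ ^ (2 * n + 2))⁻¹) * ‖𝓕 (G i : Rn n → ℂ) y‖ₑ ^ 2) := by
    intro y
    have h1 : (1 + ‖y‖ / μ) ^ (2 * n + 2) ≤
        2 ^ (2 * n + 2) * (1 + c) * (1 + ∑ i, (μ ^ (2 * n + 2))⁻¹ * |y i| ^ (2 * n + 2)) := by
      have h2 : (1 + ‖y‖ / μ) ^ (2 * n + 2) ≤ 2 ^ (2 * n + 2) * (1 + (‖y‖ / μ) ^ (2 * n + 2)) := by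
        have h0 : 0 ≤ ‖y‖ / μ := by positivity
        rcases le_total (‖y‖ / μ) 1 with h | h
        · calc (1 + ‖y‖ / μ) ^ (2 * n + 2) ≤ 2 ^ (2 * n + 2) * 1 := by
                rw [mul_one]; gcongr; linarith
            _ ≤ _ := by gcongr; linarith [pow_nonneg h0 (2 * n + 2)]
        · calc (1 + ‖y‖ / μ) ^ (2 * n + 2) ≤ (2 * (‖y‖ / μ)) ^ (2 * n + 2) := by gcongr; linarith
            _ = 2 ^ (2 * n + 2) * (‖y‖ / μ) ^ (2 * n + 2) := mul_pow _ _ _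
            _ ≤ _ := by gcongr; linarith
      have h3 := hcn (μ⁻¹ • y)
      have h4 : ∑ i, |(μ⁻¹ • y) i| ^ (2 * n + 2) =
          ∑ i, (μ ^ (2 * n + 2))⁻¹ * |y i| ^ (2 * n + 2) := by
        refine Finset.sum_congr rfl fun i _ => ?_
        rw [PiLp.smul_apply, smul_eq_mul, abs_mul, mul_pow, abs_of_pos (inv_pos.2 hμ), inv_pow]
      rw [h4, norm_smul, Real.norm_eq_abs, abs_of_pos (inv_pos.2 hμ), ← div_eq_inv_mul] at h3
      have h5 : 0 ≤ ∑ i, (μ ^ (2 * n + 2))⁻¹ * |y i| ^ (2 * n + 2) :=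
        Finset.sum_nonneg fun i _ => by positivity
      refine h2.trans ?_
      rw [mul_assoc]
      gcongr
      linarith
    have h6 : ∀ i, ‖y i‖ₑ ^ (2 * n + 2) * ‖𝓕 f y‖ₑ ^ 2 ≤ ‖𝓕 (G i : Rn n → ℂ) y‖ₑ ^ 2 := by
      intro i
      have : inner ℝ y (e i) = y i := by simp [e, EuclideanSpace.inner_single_right]
      rw [hGF i y, enorm_mul, mul_pow, this, IsPiece.coe_toSchwartz, enorm_pow, ← pow_mul,
        show (n + 1) * 2 = 2 * n + 2 by ring, enorm_mul]
      gcongr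
      rw [show ‖(y i : ℂ)‖ₑ = ‖y i‖ₑ by rw [← ofReal_norm, ← ofReal_norm, Complex.norm_real]]
      refine le_mul_of_one_le_left' ?_
      rw [← ofReal_norm, ← ENNReal.ofReal_one]
      refine ENNReal.ofReal_le_ofReal ?_
      simp only [norm_mul, Complex.norm_ofNat, Complex.norm_real, Complex.norm_I, mul_one]
      rw [Real.norm_of_nonneg Real.pi_pos.le]
      linarith [Real.pi_gt_three]
    calc ‖𝓕 f y‖ₑ ^ 2 * ENNReal.ofReal ((1 + ‖y‖ / μ) ^ (2 * n + 2))
        ≤ ‖𝓕 f y‖ₑ ^ 2 * ENNReal.ofReal (2 ^ (2 * n + 2) * (1 + c) *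
            (1 + ∑ i, (μ ^ (2 * n + 2))⁻¹ * |y i| ^ (2 * n + 2))) := by gcongr
      _ = ENNReal.ofReal (2 ^ (2 * n + 2) * (1 + c)) * (‖𝓕 f y‖ₑ ^ 2 +
          ∑ i, ENNReal.ofReal ((μ ^ (2 * n + 2))⁻¹) *
            (‖y i‖ₑ ^ (2 * n + 2) * ‖𝓕 f y‖ₑ ^ 2)) := by
          rw [ENNReal.ofReal_mul (by positivity), ENNReal.ofReal_add zero_le_one
            (Finset.sum_nonneg fun i _ => by positivity), ENNReal.ofReal_one,
            ENNReal.ofReal_sum_of_nonneg fun i _ => by positivity, mul_left_comm,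
            mul_add (‖𝓕 f y‖ₑ ^ 2), mul_one (‖𝓕 f y‖ₑ ^ 2), Finset.mul_sum]
          congr 2
          refine Finset.sum_congr rfl fun i _ => ?_
          rw [ENNReal.ofReal_mul (by positivity), ENNReal.ofReal_pow (abs_nonneg _),
            ← Real.enorm_eq_ofReal_abs]
          ring
      _ ≤ _ := by gcongr with i; exact h6 i
  have hmeas : ∀ g : 𝓢(Rn n, ℂ), Measurable fun y => ‖𝓕 (g : Rn n → ℂ) y‖ₑ ^ 2 := fun g =>
    (𝓕 g).continuous.enorm.measurable.pow_const 2
  refine (lintegral_mono hpt).trans ?_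
  rw [lintegral_const_mul, lintegral_add_left, lintegral_finsetSum]
  rotate_left
  · intro i _; exact (hmeas (G i)).const_mul _
  · exact hmeas hf.toSchwartz
  · exact (hmeas hf.toSchwartz).add
      (Finset.measurable_sum _ fun i _ => (hmeas (G i)).const_mul _)
  have t1 : ∫⁻ y, ‖𝓕 f y‖ₑ ^ 2 ≤ ENNReal.ofReal (B ^ 2 * (4 * Λ) ^ n) := by
    refine (lintegral_enorm_sq_fourier hf.toSchwartz).trans_le ?_
    refine (lintegral_enorm_sq_le_of_support (by positivity) hB hf.eq_zero hf.norm_le).trans_eq ?_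
    congr 3; ring
  have t2 : ∀ i, ∫⁻ y, ENNReal.ofReal ((μ ^ (2 * n + 2))⁻¹) * ‖𝓕 (G i : Rn n → ℂ) y‖ₑ ^ 2 ≤
      ENNReal.ofReal (B ^ 2 * (4 * Λ) ^ n) := by
    intro i
    rw [lintegral_const_mul _ (hmeas (G i)), lintegral_enorm_sq_fourier]
    have : ∫⁻ y, ‖G i y‖ₑ ^ 2 ≤ ENNReal.ofReal ((B * μ ^ (n + 1)) ^ 2 * (2 * (2 * Λ)) ^ n) := by
      refine lintegral_enorm_sq_le_of_support (by positivity) (by positivity) ?_ ?_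
      · rw [hG i]; exact iterate_dirDeriv_eq_zero hf.eq_zero _ _
      · rw [hG i]; exact hf.deriv_le i
    refine (mul_le_mul_right this _).trans_eq ?_
    rw [← ENNReal.ofReal_mul (by positivity)]
    congr 1
    have : 0 < μ ^ (2 * n + 2) := by positivity
    rw [mul_pow, ← pow_mul, show (n + 1) * 2 = 2 * n + 2 by ring]
    field_simp
    ring
  calc _ ≤ ENNReal.ofReal (2 ^ (2 * n + 2) * (1 + c)) * (ENNReal.ofReal (B ^ 2 * (4 * Λ) ^ n) +
        ∑ _i : Fin n, ENNReal.ofReal (B ^ 2 * (4 * Λ) ^ n)) := by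
        gcongr with i
        exact t2 i
    _ = _ := by
        rw [Finset.sum_const, Finset.card_univ, Fintype.card_fin, nsmul_eq_mul,
          ← ENNReal.ofReal_natCast, ← ENNReal.ofReal_mul (by positivity),
          ← ENNReal.ofReal_add (by positivity) (by positivity),
          ← ENNReal.ofReal_mul (by positivity)]
        congr 1
        rw [mul_pow]; ring

lemma ennreal_sq_lintegral_mul_le {α : Type*} [MeasurableSpace α] (ν : Measure α)
    {f g : α → ℝ≥0∞} (hf : AEMeasurable f ν) (hg : AEMeasurable g ν) :
    (∫⁻ a, f a * g a ∂ν) ^ 2 ≤ (∫⁻ a, f a ^ 2 ∂ν) * ∫⁻ a, g a ^ 2 ∂ν := by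
  have h := ENNReal.lintegral_mul_le_Lp_mul_Lq ν (p := 2) (q := 2)
    (Real.holderConjugate_iff.2 ⟨by norm_num, by norm_num⟩) hf hg
  calc (∫⁻ a, f a * g a ∂ν) ^ 2
      ≤ ((∫⁻ a, f a ^ (2 : ℝ) ∂ν) ^ (1 / (2 : ℝ)) * (∫⁻ a, g a ^ (2 : ℝ) ∂ν) ^ (1 / (2 : ℝ))) ^ 2 := by
        gcongr; exact h
    _ = _ := by
        rw [mul_pow, ← ENNReal.rpow_natCast, ← ENNReal.rpow_natCast, ← ENNReal.rpow_mul,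
          ← ENNReal.rpow_mul]
        norm_num

/-- Pointwise estimate for a piece, at the scale `μ` of its kernel. -/
lemma exists_enorm_freqOp_sq_le (n : ℕ) : ∃ C : ℝ, 0 ≤ C ∧
    ∀ (Λ μ B : ℝ) (f : Rn n → ℂ), 0 < Λ → 0 < μ → IsPiece Λ μ B f →
      ∀ (u : 𝓢(Rn n, ℂ)) (x : Rn n), ‖freqOp f u x‖ₑ ^ 2 ≤ ENNReal.ofReal (C * B ^ 2 * Λ ^ n) *
        ∫⁻ y, ‖u y‖ₑ ^ 2 * decayWeight (2 * n + 2) μ (y - x) := by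
  obtain ⟨C, hC, hker⟩ := exists_lintegral_kernel_le n
  refine ⟨C, hC, fun Λ μ B f hΛ hμ hf u x => ?_⟩
  have hFm : Continuous (𝓕 f) := (𝓕 hf.toSchwartz).continuous
  -- Cauchy–Schwarz with `w` on the kernel and `w⁻¹` on `u`; squaring gives the exponent `2n + 2`.
  set w : Rn n → ℝ := fun y => (1 + ‖y - x‖ / μ) ^ (n + 1)
  have hw : ∀ y, 0 < w y := fun y => by positivity
  have hwc : Continuous w := by fun_prop
  have hmul : ∀ y, ‖𝓕 f (y - x) * u y‖ₑ =
      (‖𝓕 f (y - x)‖ₑ * ENNReal.ofReal (w y)) * (‖u y‖ₑ * ENNReal.ofReal (w y)⁻¹) := by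
    intro y
    rw [enorm_mul, mul_mul_mul_comm, ← ENNReal.ofReal_mul (hw y).le, mul_inv_cancel₀ (hw y).ne',
      ENNReal.ofReal_one, mul_one]
  rw [freqOp_eq_kernel hf.integrable]
  calc ‖∫ y, 𝓕 f (y - x) * u y‖ₑ ^ 2
      ≤ (∫⁻ y, ‖𝓕 f (y - x) * u y‖ₑ) ^ 2 := by gcongr; exact enorm_integral_le_lintegral_enorm _
    _ ≤ (∫⁻ y, (‖𝓕 f (y - x)‖ₑ * ENNReal.ofReal (w y)) ^ 2) *
          ∫⁻ y, (‖u y‖ₑ * ENNReal.ofReal (w y)⁻¹) ^ 2 := by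
        simp only [hmul]
        refine ennreal_sq_lintegral_mul_le _ ?_ ?_
        · have : Continuous fun y => ‖𝓕 f (y - x)‖ₑ := (hFm.comp (by fun_prop)).enorm
          exact (this.measurable.mul hwc.measurable.ennreal_ofReal).aemeasurable
        · exact (u.continuous.enorm.measurable.mul hwc.measurable.inv.ennreal_ofReal).aemeasurable
    _ = (∫⁻ y, ‖𝓕 f (y - x)‖ₑ ^ 2 * ENNReal.ofReal ((1 + ‖y - x‖ / μ) ^ (2 * n + 2))) *
          ∫⁻ y, ‖u y‖ₑ ^ 2 * decayWeight (2 * n + 2) μ (y - x) := by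
        congr 1 <;> refine lintegral_congr fun y => ?_
        · rw [mul_pow, ← ENNReal.ofReal_pow (hw y).le, ← pow_mul]
          congr 3; ring
        · rw [mul_pow, ← ENNReal.ofReal_pow (inv_nonneg.2 (hw y).le), inv_pow, ← pow_mul,
            decayWeight]
          congr 4; ring
    _ ≤ _ := by
        gcongr
        rw [lintegral_sub_right_eq_self (μ := volume)
          (fun y => ‖𝓕 f y‖ₑ ^ 2 * ENNReal.ofReal ((1 + ‖y‖ / μ) ^ (2 * n + 2)))]
        exact hker Λ μ B f hΛ hμ hf

/-- `freqOp f u` is a Schwartz function when `f` is. -/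
noncomputable def schwartzOp (f u : 𝓢(Rn n, ℂ)) : 𝓢(Rn n, ℂ) :=
  𝓕⁻ (SchwartzMap.smulLeftCLM ℂ (f : Rn n → ℂ) (𝓕 u))

lemma coe_schwartzOp (f u : 𝓢(Rn n, ℂ)) : (schwartzOp f u : Rn n → ℂ) = freqOp f u := by
  ext x
  rw [schwartzOp, SchwartzMap.fourierInv_coe, SchwartzMap.smulLeftCLM_apply f.hasTemperateGrowth]
  rfl

lemma fourier_schwartzOp (f u : 𝓢(Rn n, ℂ)) (ξ : Rn n) :
    𝓕 (schwartzOp f u : Rn n → ℂ) ξ = f ξ * 𝓕 (u : Rn n → ℂ) ξ := by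
  have : 𝓕 (schwartzOp f u) = SchwartzMap.smulLeftCLM ℂ (f : Rn n → ℂ) (𝓕 u) :=
    FourierTransform.fourier_fourierInv_eq _
  have h2 := congrArg (fun H : 𝓢(Rn n, ℂ) => H ξ) this
  simp only [SchwartzMap.smulLeftCLM_apply_apply f.hasTemperateGrowth] at h2
  exact h2

lemma IsPiece.lintegral_freqOp_sq_le {Λ μ B : ℝ} {f : Rn n → ℂ} (hf : IsPiece Λ μ B f)
    (u : 𝓢(Rn n, ℂ)) :
    ∫⁻ x, ‖freqOp f u x‖ₑ ^ 2 ≤ ENNReal.ofReal (B ^ 2) * ∫⁻ x, ‖u x‖ₑ ^ 2 := by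
  have h := coe_schwartzOp hf.toSchwartz u
  rw [IsPiece.coe_toSchwartz] at h
  rw [← h, ← lintegral_enorm_sq_fourier, ← lintegral_enorm_sq_fourier u,
    ← lintegral_const_mul _ ((𝓕 u).continuous.enorm.measurable.pow_const 2)]
  refine lintegral_mono fun ξ => ?_
  rw [fourier_schwartzOp, enorm_mul, mul_pow, ENNReal.ofReal_pow hf.nonneg]
  gcongr
  rw [← ofReal_norm]
  exact ENNReal.ofReal_le_ofReal (hf.norm_le ξ)

end FrequencyOperators

/-! ### Localisation in space and freezing of the symbol -/

section LocalEstimates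

open FourierTransform LineDeriv

variable {n : ℕ}

/-- The weighted square integral of `u` at scale `R` around `x`. -/
noncomputable def locSq (u : Rn n → ℂ) (R : ℝ) (x : Rn n) : ℝ≥0∞ :=
  ∫⁻ y, ‖u y‖ₑ ^ 2 * decayWeight (2 * n + 2) R (y - x)

lemma integrable_freqOp {f : Rn n → ℂ} (hf : Continuous f) {B : ℝ} (hB : ∀ ξ, ‖f ξ‖ ≤ B)
    (u : 𝓢(Rn n, ℂ)) (x : Rn n) :
    Integrable fun v : Rn n => Complex.exp (↑(2 * Real.pi * inner ℝ v x) * Complex.I) *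
      (f v * 𝓕 (u : Rn n → ℂ) v) := by
  have hc : Continuous fun v : Rn n =>
      Complex.exp (↑(2 * Real.pi * inner ℝ v x) * Complex.I) := by fun_prop
  refine Integrable.bdd_mul (c := 1) ?_ hc.aestronglyMeasurable
    (Filter.Eventually.of_forall fun v => ?_)
  · exact Integrable.bdd_mul (c := B) (𝓕 u).integrable hf.aestronglyMeasurable
      (Filter.Eventually.of_forall hB)
  · rw [Complex.norm_exp_ofReal_mul_I]

lemma freqOp_sub {f g : Rn n → ℂ} (hf : Continuous f) (hg : Continuous g) {B B' : ℝ}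
    (hB : ∀ ξ, ‖f ξ‖ ≤ B) (hB' : ∀ ξ, ‖g ξ‖ ≤ B') (u : 𝓢(Rn n, ℂ)) (x : Rn n) :
    freqOp (fun ξ => f ξ - g ξ) u x = freqOp f u x - freqOp g u x := by
  rw [freqOp_eq_integral, freqOp_eq_integral, freqOp_eq_integral,
    ← integral_sub (integrable_freqOp hf hB u x) (integrable_freqOp hg hB' u x)]
  congr 1; ext v; ring

lemma freqOp_add_right {f : Rn n → ℂ} (hf : Continuous f) {B : ℝ}
    (hB : ∀ ξ, ‖f ξ‖ ≤ B) (u v : 𝓢(Rn n, ℂ)) (x : Rn n) :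
    freqOp f (u + v) x = freqOp f u x + freqOp f v x := by
  have h : ∀ y, 𝓕 ((u + v : 𝓢(Rn n, ℂ)) : Rn n → ℂ) y =
      𝓕 (u : Rn n → ℂ) y + 𝓕 (v : Rn n → ℂ) y := by
    intro y
    have := congrArg (fun H : 𝓢(Rn n, ℂ) => H y) (FourierTransform.fourier_add u v)
    exact this
  rw [freqOp_eq_integral, freqOp_eq_integral, freqOp_eq_integral,
    ← integral_add (integrable_freqOp hf hB u x) (integrable_freqOp hf hB v x)]
  congr 1; ext w; rw [h]; ring

/-- A value at `c` becomes a value at `x` of an operator with modulated symbol, so the difference of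
values at two points is a single multiplier evaluated at one point. -/
lemma freqOp_modulate (f : Rn n → ℂ) (u : 𝓢(Rn n, ℂ)) (x c : Rn n) :
    freqOp (fun ξ => Complex.exp (↑(2 * Real.pi * inner ℝ ξ (c - x)) * Complex.I) * f ξ) u x =
      freqOp f u c := by
  rw [freqOp_eq_integral, freqOp_eq_integral]
  congr 1; ext v
  rw [← mul_assoc, ← mul_assoc, ← mul_assoc, ← Complex.exp_add, inner_sub_right]
  congr 3
  push_cast; ring

/-- Joint continuity makes measurable both the diagonal `x ↦ T_{b(x)} u(x)` and the function of two
variables to which Fubini is applied when the symbol is frozen. -/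
lemma continuous_freqOp {X : Type*} [TopologicalSpace X] [FirstCountableTopology X]
    {b : X → Rn n → ℂ} (hb : Continuous fun p : X × Rn n => b p.1 p.2) {B : ℝ}
    (hB : ∀ z ξ, ‖b z ξ‖ ≤ B) (u : 𝓢(Rn n, ℂ)) :
    Continuous fun p : X × Rn n => freqOp (b p.1) u p.2 := by
  simp only [freqOp_eq_integral]
  have hu : Continuous (𝓕 (u : Rn n → ℂ)) := (𝓕 u).continuous
  refine continuous_of_dominated (bound := fun v => B * ‖𝓕 (u : Rn n → ℂ) v‖) (fun p => ?_)
    (fun p => Filter.Eventually.of_forall fun v => ?_) ?_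
    (Filter.Eventually.of_forall fun v => ?_)
  · have h1 : Continuous fun v => b p.1 v := hb.comp (Continuous.prodMk_right p.1)
    exact Continuous.aestronglyMeasurable (by fun_prop)
  · rw [norm_mul, Complex.norm_exp_ofReal_mul_I, one_mul, norm_mul]
    gcongr
    exact hB _ _
  · exact (𝓕 u).integrable.norm.const_mul B
  · have h1 : Continuous fun p : X × Rn n => b p.1 v :=
      hb.comp (continuous_fst.prodMk continuous_const)
    fun_prop

/-- The far part vanishes up to distance `2R`, so that it stays at distance at least `R` from every
point of the `R`-ball around `z`. -/
lemma exists_cutoff (u : 𝓢(Rn n, ℂ)) (z : Rn n) {R : ℝ} (hR : 0 < R) :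
    ∃ u₁ u₂ : 𝓢(Rn n, ℂ), u = u₁ + u₂ ∧ (∀ y, ‖u₁ y‖ ≤ ‖u y‖) ∧ (∀ y, ‖u₂ y‖ ≤ ‖u y‖) ∧
      (∀ y, 4 * R < ‖y - z‖ → u₁ y = 0) ∧ ∀ y, ‖y - z‖ ≤ 2 * R → u₂ y = 0 := by
  set θ : ContDiffBump z := ⟨2 * R, 4 * R, by positivity, by linarith⟩
  have hsm : ContDiff ℝ ∞ fun y => ((θ y : ℝ) : ℂ) :=
    Complex.ofRealCLM.contDiff.comp θ.contDiff
  have hcs : HasCompactSupport fun y => ((θ y : ℝ) : ℂ) :=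
    θ.hasCompactSupport.comp_left (g := fun t : ℝ => (t : ℂ)) (by simp)
  set Θ : 𝓢(Rn n, ℂ) := hcs.toSchwartzMap hsm
  set u₁ : 𝓢(Rn n, ℂ) := SchwartzMap.smulLeftCLM ℂ (Θ : Rn n → ℂ) u
  have h1 : ∀ y, u₁ y = (θ y : ℂ) * u y := fun y => by
    simp only [u₁, SchwartzMap.smulLeftCLM_apply_apply Θ.hasTemperateGrowth, smul_eq_mul]
    rfl
  have h2 : ∀ y, (u - u₁) y = ((1 - θ y : ℝ) : ℂ) * u y := fun y => by
    rw [sub_apply, h1]; push_cast; ring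
  refine ⟨u₁, u - u₁, by abel, fun y => ?_, fun y => ?_, fun y hy => ?_, fun y hy => ?_⟩
  · rw [h1, norm_mul, Complex.norm_real, Real.norm_of_nonneg θ.nonneg]
    exact mul_le_of_le_one_left (norm_nonneg _) θ.le_one
  · rw [h2, norm_mul, Complex.norm_real, Real.norm_of_nonneg (sub_nonneg.2 θ.le_one)]
    exact mul_le_of_le_one_left (norm_nonneg _) (by linarith [θ.nonneg' y])
  · rw [h1, θ.zero_of_le_dist (by rw [dist_eq_norm]; exact hy.le)]; simp
  · rw [h2, θ.one_of_mem_closedBall (by rwa [mem_closedBall_iff_norm])]; simp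

lemma enorm_add_sq_le (a b : ℂ) : ‖a + b‖ₑ ^ 2 ≤ 2 * ‖a‖ₑ ^ 2 + 2 * ‖b‖ₑ ^ 2 := by
  calc ‖a + b‖ₑ ^ 2 ≤ (‖a‖ₑ + ‖b‖ₑ) ^ 2 := by gcongr; exact enorm_add_le _ _
    _ ≤ 2 * (‖a‖ₑ ^ 2 + ‖b‖ₑ ^ 2) := by
        have := ENNReal.rpow_add_le_mul_rpow_add_rpow ‖a‖ₑ ‖b‖ₑ (p := 2) (by norm_num)
        norm_num at this
        exact this
    _ = _ := by ring

lemma lintegral_enorm_sq_le_locSq {u u₁ : Rn n → ℂ} {z : Rn n} {R : ℝ} (hR : 0 < R)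
    (h : ∀ y, ‖u₁ y‖ ≤ ‖u y‖) (h0 : ∀ y, 4 * R < ‖y - z‖ → u₁ y = 0) :
    ∫⁻ y, ‖u₁ y‖ₑ ^ 2 ≤ ENNReal.ofReal (5 ^ (2 * n + 2)) * locSq u R z := by
  rw [locSq, ← lintegral_const_mul' _ _ ENNReal.ofReal_ne_top]
  refine lintegral_mono fun y => ?_
  by_cases hy : 4 * R < ‖y - z‖
  · simp [h0 y hy]
  · have h1 : (1 : ℝ≥0∞) ≤
        ENNReal.ofReal (5 ^ (2 * n + 2)) * decayWeight (2 * n + 2) R (y - z) := by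
      refine le_trans (le_of_eq ?_) (decayWeight_le_of_le (y := (0 : Rn n)) hR hR ?_)
      · simp [decayWeight]
      · have : ‖y - z‖ / R ≤ 4 := (div_le_iff₀ hR).2 (not_lt.1 hy)
        simp; linarith
    calc ‖u₁ y‖ₑ ^ 2 ≤ ‖u y‖ₑ ^ 2 * 1 := by
          rw [mul_one]; gcongr; exact enorm_le_iff_norm_le.2 (h y)
      _ ≤ ‖u y‖ₑ ^ 2 * (ENNReal.ofReal (5 ^ (2 * n + 2)) * decayWeight (2 * n + 2) R (y - z)) := by
          gcongr
      _ = _ := by ring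

/-- Where `u₂` does not vanish, `R + ‖y - z‖ ≤ 4 ‖y - x‖`, so passing from scale `μ` at `x` to scale
`R` at `z` gains a power of `μ / R`. -/
lemma locSq_le_of_eq_zero {u u₂ : Rn n → ℂ} {x z : Rn n} {μ R : ℝ} (hμ : 0 < μ) (hR : 0 < R)
    (hx : ‖x - z‖ ≤ R) (h : ∀ y, ‖u₂ y‖ ≤ ‖u y‖) (h0 : ∀ y, ‖y - z‖ ≤ 2 * R → u₂ y = 0) :
    locSq u₂ μ x ≤ ENNReal.ofReal ((4 * (μ / R)) ^ (2 * n + 2)) * locSq u R z := by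
  rw [locSq, locSq, ← lintegral_const_mul' _ _ ENNReal.ofReal_ne_top]
  refine lintegral_mono fun y => ?_
  by_cases hy : ‖y - z‖ ≤ 2 * R
  · simp [h0 y hy]
  · rw [mul_left_comm]
    gcongr
    · exact enorm_le_iff_norm_le.2 (h y)
    · refine decayWeight_le_of_le hμ hR ?_
      have h1 : ‖y - z‖ ≤ ‖y - x‖ + ‖x - z‖ := norm_sub_le_norm_sub_add_norm_sub _ _ _
      have h2 : 1 + ‖y - z‖ / R ≤ 4 * ‖y - x‖ / R := by
        rw [le_div_iff₀ hR, add_mul, div_mul_cancel₀ _ hR.ne']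
        linarith
      have h3 : 4 * (μ / R) * (1 + ‖y - x‖ / μ) = 4 * (μ / R) + 4 * ‖y - x‖ / R := by
        field_simp
      have h4 : 0 ≤ 4 * (μ / R) := by positivity
      linarith

lemma IsPiece.continuous_freqOp {Λ μ B : ℝ} {f : Rn n → ℂ} (hf : IsPiece Λ μ B f)
    (u : 𝓢(Rn n, ℂ)) : Continuous (freqOp f u) := by
  have h := coe_schwartzOp hf.toSchwartz u
  rw [IsPiece.coe_toSchwartz] at h
  rw [← h]
  exact (schwartzOp _ u).continuous

/-- The part of `u` near `z` is handled by Plancherel, which does not see the volume of the cube.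
The far part is handled by the pointwise kernel bound, where the tail `(μ / R)^(2n+2)` pays for the
factor `(sΛ)^n`. -/
lemma exists_lintegral_cube_freqOp_le (n : ℕ) : ∃ C : ℝ, 0 ≤ C ∧
    ∀ (Λ μ B : ℝ) (f : Rn n → ℂ), 0 < Λ → 0 < μ → IsPiece Λ μ B f →
      ∀ (u : 𝓢(Rn n, ℂ)) (z : Rn n) (s R : ℝ), 0 < s → 0 < R → n * s ≤ R →
      ∫⁻ x in cube z s, ‖freqOp f u x‖ₑ ^ 2 ≤
        ENNReal.ofReal (C * B ^ 2 * (1 + (s * Λ) ^ n * (μ / R) ^ (2 * n + 2))) * locSq u R z := by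
  obtain ⟨C, hC, hpt⟩ := exists_enorm_freqOp_sq_le n
  refine ⟨2 * 5 ^ (2 * n + 2) + 2 * C * 4 ^ (2 * n + 2), by positivity,
    fun Λ μ B f hΛ hμ hf u z s R hs hR hsR => ?_⟩
  obtain ⟨u₁, u₂, hu, hu₁, hu₂, hz₁, hz₂⟩ := exists_cutoff u z hR
  have hfc := hf.smooth.continuous
  have hcont : ∀ w : 𝓢(Rn n, ℂ), Continuous (freqOp f w) := hf.continuous_freqOp
  have e1 : ∫⁻ x in cube z s, ‖freqOp f u₁ x‖ₑ ^ 2 ≤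
      ENNReal.ofReal (B ^ 2 * 5 ^ (2 * n + 2)) * locSq u R z := by
    refine (setLIntegral_le_lintegral _ _).trans ((hf.lintegral_freqOp_sq_le u₁).trans ?_)
    rw [ENNReal.ofReal_mul (by positivity), mul_assoc]
    gcongr
    exact lintegral_enorm_sq_le_locSq hR hu₁ hz₁
  have e2 : ∫⁻ x in cube z s, ‖freqOp f u₂ x‖ₑ ^ 2 ≤
      ENNReal.ofReal (C * B ^ 2 * Λ ^ n * (4 * (μ / R)) ^ (2 * n + 2) * s ^ n) * locSq u R z := by
    calc ∫⁻ x in cube z s, ‖freqOp f u₂ x‖ₑ ^ 2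
        ≤ ∫⁻ _x in cube z s, ENNReal.ofReal (C * B ^ 2 * Λ ^ n) *
            (ENNReal.ofReal ((4 * (μ / R)) ^ (2 * n + 2)) * locSq u R z) := by
          refine setLIntegral_mono measurable_const fun x hx => ?_
          refine (hpt Λ μ B f hΛ hμ hf u₂ x).trans ?_
          gcongr
          refine locSq_le_of_eq_zero hμ hR ?_ hu₂ hz₂
          exact (norm_sub_le_of_mem_cube hs.le hx (self_mem_cube z hs.le)).trans hsR
      _ = _ := by
          rw [setLIntegral_const, volume_cube _ hs.le, ← mul_assoc,
            ← ENNReal.ofReal_mul (by positivity), mul_right_comm,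
            ← ENNReal.ofReal_mul (by positivity)]
  calc ∫⁻ x in cube z s, ‖freqOp f u x‖ₑ ^ 2
      ≤ ∫⁻ x in cube z s, (2 * ‖freqOp f u₁ x‖ₑ ^ 2 + 2 * ‖freqOp f u₂ x‖ₑ ^ 2) := by
        refine lintegral_mono fun x => ?_
        rw [hu, freqOp_add_right hfc hf.norm_le]
        exact enorm_add_sq_le _ _
    _ = 2 * (∫⁻ x in cube z s, ‖freqOp f u₁ x‖ₑ ^ 2) +
          2 * ∫⁻ x in cube z s, ‖freqOp f u₂ x‖ₑ ^ 2 := by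
        rw [lintegral_add_left, lintegral_const_mul, lintegral_const_mul]
        · exact (hcont u₂).enorm.measurable.pow_const 2
        · exact (hcont u₁).enorm.measurable.pow_const 2
        · exact ((hcont u₁).enorm.measurable.pow_const 2).const_mul _
    _ ≤ 2 * (ENNReal.ofReal (B ^ 2 * 5 ^ (2 * n + 2)) * locSq u R z) +
          2 * (ENNReal.ofReal (C * B ^ 2 * Λ ^ n * (4 * (μ / R)) ^ (2 * n + 2) * s ^ n) *
            locSq u R z) := by gcongr
    _ = ENNReal.ofReal (2 * (B ^ 2 * 5 ^ (2 * n + 2)) +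
          2 * (C * B ^ 2 * Λ ^ n * (4 * (μ / R)) ^ (2 * n + 2) * s ^ n)) * locSq u R z := by
        rw [ENNReal.ofReal_add (by positivity) (by positivity), ENNReal.ofReal_mul zero_le_two,
          ENNReal.ofReal_mul zero_le_two, ENNReal.ofReal_ofNat]
        ring
    _ ≤ _ := by
        refine mul_le_mul_left (ENNReal.ofReal_le_ofReal ?_) _
        set P := (s * Λ) ^ n * (μ / R) ^ (2 * n + 2) with hP
        have hP0 : 0 ≤ P := by positivity
        have : C * B ^ 2 * Λ ^ n * (4 * (μ / R)) ^ (2 * n + 2) * s ^ n =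
            C * B ^ 2 * 4 ^ (2 * n + 2) * P := by rw [hP, mul_pow, mul_pow]; ring
        rw [this]
        have h1 : 0 ≤ C * B ^ 2 * 4 ^ (2 * n + 2) := by positivity
        have h2 : 0 ≤ B ^ 2 * 5 ^ (2 * n + 2) * P := by positivity
        nlinarith

set_option maxHeartbeats 400000 in
/-- Integrated estimate on a cube for an operator with `x`-dependent symbol, obtained by freezing
the symbol at scale `s`. -/
lemma exists_lintegral_freeze_le (n : ℕ) : ∃ C : ℝ, 0 ≤ C ∧
    ∀ (Λ μ B B' s l R : ℝ) (b : Rn n → Rn n → ℂ), 0 < Λ → 0 < μ → 0 < s → s ≤ l → 0 < R →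
      n * s ≤ R → (Continuous fun p : Rn n × Rn n => b p.1 p.2) →
      (∀ z, IsPiece Λ μ B (b z)) →
      (∀ x z, ‖x - z‖ ≤ n * s → IsPiece Λ μ B' (fun ξ => b x ξ - b z ξ)) →
      ∀ (u : 𝓢(Rn n, ℂ)) (c x₀ : Rn n) (M : ℝ≥0∞), x₀ ∈ cube c l →
      CubeAvgLE (fun y => ‖u y‖ₑ ^ 2) x₀ M →
      ∫⁻ x in cube c l, ‖freqOp (b x) u x‖ₑ ^ 2 ≤
        ENNReal.ofReal (C * (B ^ 2 * ((s ^ n)⁻¹ + Λ ^ n * (μ / R) ^ (2 * n + 2)) * R ^ n +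
          B' ^ 2 * Λ ^ n * μ ^ n) * l ^ n) * M := by
  obtain ⟨C₁, hC₁, hpt⟩ := exists_enorm_freqOp_sq_le n
  obtain ⟨C₂, hC₂, hloc⟩ := exists_lintegral_cube_freqOp_le n
  set D : ℝ := 16 ^ (n + 1) * (n + 1) ^ (2 * n + 2) with hD
  refine ⟨2 * C₂ * D * 2 ^ n + 2 * C₁ * D, by positivity,
    fun Λ μ B B' s l R b hΛ hμ hs hsl hR hsR hbc hb hb' u c x₀ M hx₀ hM => ?_⟩
  have hl : 0 < l := hs.trans_le hsl
  have hum : Measurable fun y => ‖u y‖ₑ ^ 2 := u.continuous.enorm.measurable.pow_const 2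
  have hcF : Continuous fun p : Rn n × Rn n => freqOp (b p.1) u p.2 :=
    continuous_freqOp (b := b) (B := B) hbc (fun z => (hb z).norm_le) u
  have hF : Measurable fun p : Rn n × Rn n => ‖freqOp (b p.1) u p.2‖ₑ ^ 2 :=
    (hcF.measurable.enorm).pow_const 2
  have hdiag : Measurable fun x => ‖freqOp (b x) u x‖ₑ ^ 2 := by
    have := hF.comp (measurable_id.prodMk measurable_id : Measurable fun x : Rn n => (x, x))
    exact this
  have hsym : ∀ x z : Rn n, z ∈ cube x s ↔ x ∈ cube z s := fun x z =>
    forall_congr' fun i => by rw [abs_sub_comm]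
  have hset : MeasurableSet {p : Rn n × Rn n | p.2 ∈ cube p.1 s} := by
    have : {p : Rn n × Rn n | p.2 ∈ cube p.1 s} = ⋂ i, {p | |p.2 i - p.1 i| ≤ s / 2} := by
      ext p; simp [cube]
    rw [this]
    have hc : ∀ i, Continuous fun p : Rn n × Rn n => |p.2 i - p.1 i| := fun i => by fun_prop
    exact MeasurableSet.iInter fun i => measurableSet_le (hc i).measurable measurable_const
  -- Exchanging the integrals fixes the symbol `b z` while `x` runs over a cube of side `s` around
  -- `z`, where the estimate for a fixed multiplier applies. The centres `z` stay in the cube of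
  -- side `2 * l` since `s ≤ l`.
  have main : ∫⁻ x in cube c l, ∫⁻ z in cube x s, ‖freqOp (b z) u x‖ₑ ^ 2 ≤
      ENNReal.ofReal (C₂ * B ^ 2 * (1 + (s * Λ) ^ n * (μ / R) ^ (2 * n + 2)) *
        (D * (2 * l) ^ n * R ^ n)) * M := by
    set G : Rn n → Rn n → ℝ≥0∞ := fun x z =>
      {p : Rn n × Rn n | p.2 ∈ cube p.1 s}.indicator (fun p => ‖freqOp (b p.2) u p.1‖ₑ ^ 2) (x, z)
    have hG : Measurable (Function.uncurry G) := (hF.comp measurable_swap).indicator hset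
    have h1 : ∀ x, ∫⁻ z in cube x s, ‖freqOp (b z) u x‖ₑ ^ 2 = ∫⁻ z, G x z := fun x => by
      rw [← lintegral_indicator (measurableSet_cube _ _)]; rfl
    simp only [h1]
    rw [lintegral_lintegral_swap hG.aemeasurable]
    calc ∫⁻ z, ∫⁻ x in cube c l, G x z
        ≤ ∫⁻ z, (cube c (2 * l)).indicator
            (fun z => ∫⁻ x in cube z s, ‖freqOp (b z) u x‖ₑ ^ 2) z := by
          refine lintegral_mono fun z => ?_
          by_cases hz : z ∈ cube c (2 * l)
          · rw [Set.indicator_of_mem hz]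
            refine (setLIntegral_le_lintegral _ _).trans ?_
            rw [← lintegral_indicator (measurableSet_cube _ _)]
            refine lintegral_mono fun x => ?_
            by_cases hx : x ∈ cube z s
            · rw [Set.indicator_of_mem hx]
              exact Set.indicator_le_self' (by simp) _
            · have : (x, z) ∉ {p : Rn n × Rn n | p.2 ∈ cube p.1 s} := fun h => hx ((hsym x z).1 h)
              simp only [G, Set.indicator_of_notMem this]
              exact zero_le
          · rw [Set.indicator_of_notMem hz]
            refine (setLIntegral_congr_fun (g := fun _ => 0) (measurableSet_cube _ _)
              fun x hx => ?_).trans_le (by simp)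
            refine Set.indicator_of_notMem (fun h => hz fun i => ?_) _
            have h1 := abs_le.1 (h i)
            have h2 := abs_le.1 (hx i)
            simp only at h1
            rw [abs_le]
            constructor <;> linarith
      _ ≤ ∫⁻ z in cube c (2 * l),
            ENNReal.ofReal (C₂ * B ^ 2 * (1 + (s * Λ) ^ n * (μ / R) ^ (2 * n + 2))) *
              locSq u R z := by
          rw [lintegral_indicator (measurableSet_cube _ _)]
          exact lintegral_mono fun z => hloc Λ μ B (b z) hΛ hμ (hb z) u z s R hs hR hsR
      _ ≤ _ := by
          rw [lintegral_const_mul' _ _ ENNReal.ofReal_ne_top,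
            ENNReal.ofReal_mul (q := D * (2 * l) ^ n * R ^ n) (by positivity),
            mul_assoc (ENNReal.ofReal _)]
          refine mul_le_mul_right ?_ _
          exact lintegral_cube_lintegral_decayWeight_le hum hM (by positivity)
            (cube_subset_cube c (by linarith) hx₀) hR
  have hrem : ∫⁻ x in cube c l, ENNReal.ofReal (C₁ * B' ^ 2 * Λ ^ n) * locSq u μ x ≤
      ENNReal.ofReal (C₁ * B' ^ 2 * Λ ^ n * (D * l ^ n * μ ^ n)) * M := by
    rw [lintegral_const_mul' _ _ ENNReal.ofReal_ne_top,
      ENNReal.ofReal_mul (q := D * l ^ n * μ ^ n) (by positivity),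
      mul_assoc (ENNReal.ofReal _)]
    refine mul_le_mul_right ?_ _
    exact lintegral_cube_lintegral_decayWeight_le hum hM hl hx₀ hμ
  -- The operator at `x` is compared with all the frozen ones, `z` in the cube of side `s` around
  -- `x`. The difference is a piece of size `B'` and is bounded pointwise.
  have hpoint : ∀ x, ENNReal.ofReal (s ^ n) * ‖freqOp (b x) u x‖ₑ ^ 2 ≤
      2 * (∫⁻ z in cube x s, ‖freqOp (b z) u x‖ₑ ^ 2) +
        2 * ENNReal.ofReal (s ^ n) * (ENNReal.ofReal (C₁ * B' ^ 2 * Λ ^ n) * locSq u μ x) := by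
    intro x
    calc ENNReal.ofReal (s ^ n) * ‖freqOp (b x) u x‖ₑ ^ 2
        = ∫⁻ _z in cube x s, ‖freqOp (b x) u x‖ₑ ^ 2 := by
          rw [setLIntegral_const, volume_cube _ hs.le, mul_comm]
      _ ≤ ∫⁻ z in cube x s, (2 * ‖freqOp (b z) u x‖ₑ ^ 2 +
            2 * (ENNReal.ofReal (C₁ * B' ^ 2 * Λ ^ n) * locSq u μ x)) := by
          refine setLIntegral_mono ?_ fun z hz => ?_
          · have := hF.comp (measurable_id.prodMk measurable_const : Measurable fun z => (z, x))
            exact (this.const_mul 2).add_const _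
          have hxz := norm_sub_le_of_mem_cube hs.le (self_mem_cube x hs.le) hz
          have h1 : freqOp (b x) u x =
              freqOp (b z) u x + freqOp (fun ξ => b x ξ - b z ξ) u x := by
            rw [freqOp_sub (hb x).smooth.continuous (hb z).smooth.continuous (hb x).norm_le
              (hb z).norm_le]
            ring
          rw [h1]
          refine (enorm_add_sq_le _ _).trans ?_
          gcongr
          exact hpt Λ μ B' _ hΛ hμ (hb' x z hxz) u x
      _ = _ := by
          rw [lintegral_add_right _ measurable_const, setLIntegral_const, volume_cube _ hs.le,
            lintegral_const_mul' _ _ (by simp)]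
          ring
  have hsn : ENNReal.ofReal (s ^ n) ≠ 0 := by
    rw [Ne, ENNReal.ofReal_eq_zero, not_le]; positivity
  -- Both sides are multiplied by the volume `s ^ n` instead of dividing the averages by it.
  rw [← ENNReal.mul_le_mul_iff_right hsn ENNReal.ofReal_ne_top]
  have hmeasI : Measurable fun x => ∫⁻ z in cube x s, ‖freqOp (b z) u x‖ₑ ^ 2 := by
    have : Measurable fun x => ∫⁻ z, {p : Rn n × Rn n | p.2 ∈ cube p.1 s}.indicator
        (fun p => ‖freqOp (b p.2) u p.1‖ₑ ^ 2) (x, z) :=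
      ((hF.comp measurable_swap).indicator hset).lintegral_prod_right'
    convert this using 2 with x
    rw [← lintegral_indicator (measurableSet_cube _ _)]; rfl
  calc ENNReal.ofReal (s ^ n) * ∫⁻ x in cube c l, ‖freqOp (b x) u x‖ₑ ^ 2
      = ∫⁻ x in cube c l, ENNReal.ofReal (s ^ n) * ‖freqOp (b x) u x‖ₑ ^ 2 := by
        rw [lintegral_const_mul _ hdiag]
    _ ≤ ∫⁻ x in cube c l, (2 * (∫⁻ z in cube x s, ‖freqOp (b z) u x‖ₑ ^ 2) +
        2 * ENNReal.ofReal (s ^ n) * (ENNReal.ofReal (C₁ * B' ^ 2 * Λ ^ n) * locSq u μ x)) :=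
        lintegral_mono hpoint
    _ ≤ 2 * (ENNReal.ofReal (C₂ * B ^ 2 * (1 + (s * Λ) ^ n * (μ / R) ^ (2 * n + 2)) *
        (D * (2 * l) ^ n * R ^ n)) * M) + 2 * ENNReal.ofReal (s ^ n) *
          (ENNReal.ofReal (C₁ * B' ^ 2 * Λ ^ n * (D * l ^ n * μ ^ n)) * M) := by
        rw [lintegral_add_left (hmeasI.const_mul 2), lintegral_const_mul _ hmeasI,
          lintegral_const_mul' _ _ (ENNReal.mul_ne_top (by simp) ENNReal.ofReal_ne_top)]
        gcongr
    _ = ENNReal.ofReal (2 * (C₂ * B ^ 2 * (1 + (s * Λ) ^ n * (μ / R) ^ (2 * n + 2)) *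
        (D * (2 * l) ^ n * R ^ n)) + 2 * s ^ n *
          (C₁ * B' ^ 2 * Λ ^ n * (D * l ^ n * μ ^ n))) * M := by
        rw [ENNReal.ofReal_add (by positivity) (by positivity), ENNReal.ofReal_mul zero_le_two,
          ENNReal.ofReal_mul (q := C₁ * B' ^ 2 * Λ ^ n * (D * l ^ n * μ ^ n)) (by positivity),
          ENNReal.ofReal_mul (p := 2) (q := s ^ n) zero_le_two, ENNReal.ofReal_ofNat]
        ring
    _ ≤ _ := by
        rw [← mul_assoc (ENNReal.ofReal _), ← ENNReal.ofReal_mul (by positivity)]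
        refine mul_le_mul_left (ENNReal.ofReal_le_ofReal ?_) _
        set X := B ^ 2 * (1 + (s * Λ) ^ n * (μ / R) ^ (2 * n + 2)) * R ^ n * l ^ n with hX
        set Y := s ^ n * (B' ^ 2 * Λ ^ n * μ ^ n) * l ^ n with hY
        have hX0 : 0 ≤ X := by positivity
        have hY0 : 0 ≤ Y := by positivity
        have hs0 : s ^ n ≠ 0 := by positivity
        have r : s ^ n * ((2 * C₂ * D * 2 ^ n + 2 * C₁ * D) *
            (B ^ 2 * ((s ^ n)⁻¹ + Λ ^ n * (μ / R) ^ (2 * n + 2)) * R ^ n +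
              B' ^ 2 * Λ ^ n * μ ^ n) * l ^ n) =
            (2 * C₂ * D * 2 ^ n + 2 * C₁ * D) * (X + Y) := by
          rw [hX, hY, mul_pow s Λ]; field_simp
        have q : 2 * (C₂ * B ^ 2 * (1 + (s * Λ) ^ n * (μ / R) ^ (2 * n + 2)) *
            (D * (2 * l) ^ n * R ^ n)) + 2 * s ^ n *
            (C₁ * B' ^ 2 * Λ ^ n * (D * l ^ n * μ ^ n)) =
            2 * C₂ * D * 2 ^ n * X + 2 * C₁ * D * Y := by
          rw [hX, hY, mul_pow 2 l]; ring
        rw [r, q]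
        have h1 : 0 ≤ 2 * C₂ * D * 2 ^ n := by positivity
        have h2 : 0 ≤ 2 * C₁ * D := by positivity
        nlinarith [mul_nonneg h1 hY0, mul_nonneg h2 hX0]

end LocalEstimates

/-! ### Calculus of iterated directional derivatives -/

section DirectionalDerivatives

variable {V : Type*} [NormedAddCommGroup V] [NormedSpace ℝ V]

lemma contDiff_dirDeriv {f : V → ℂ} (hf : ContDiff ℝ ∞ f) (v : V) : ContDiff ℝ ∞ (dirDeriv v f) :=
  (hf.fderiv_right (m := ∞) (by simp)).clm_apply contDiff_const

lemma contDiff_iterate_dirDeriv {f : V → ℂ} (hf : ContDiff ℝ ∞ f) (v : V) (k : ℕ) :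
    ContDiff ℝ ∞ ((dirDeriv v)^[k] f) := by
  induction k with
  | zero => exact hf
  | succ k ih => rw [Function.iterate_succ_apply']; exact contDiff_dirDeriv ih v

lemma dirDeriv_add {f g : V → ℂ} (hf : Differentiable ℝ f) (hg : Differentiable ℝ g) (v : V) :
    dirDeriv v (fun ξ => f ξ + g ξ) = fun ξ => dirDeriv v f ξ + dirDeriv v g ξ := by
  ext ξ
  simp only [dirDeriv]
  rw [fderiv_fun_add (hf ξ) (hg ξ)]
  rfl

lemma iterate_dirDeriv_add {f g : V → ℂ} (hf : ContDiff ℝ ∞ f) (hg : ContDiff ℝ ∞ g) (v : V)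
    (k : ℕ) : (dirDeriv v)^[k] (fun ξ => f ξ + g ξ) =
      fun ξ => (dirDeriv v)^[k] f ξ + (dirDeriv v)^[k] g ξ := by
  induction k with
  | zero => rfl
  | succ k ih =>
    rw [Function.iterate_succ_apply', ih, dirDeriv_add, Function.iterate_succ_apply',
      Function.iterate_succ_apply']
    · exact (contDiff_iterate_dirDeriv hf v k).differentiable (by simp)
    · exact (contDiff_iterate_dirDeriv hg v k).differentiable (by simp)

lemma dirDeriv_mul {f g : V → ℂ} (hf : Differentiable ℝ f) (hg : Differentiable ℝ g) (v : V) :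
    dirDeriv v (fun ξ => f ξ * g ξ) = fun ξ => dirDeriv v f ξ * g ξ + f ξ * dirDeriv v g ξ := by
  ext ξ
  simp only [dirDeriv]
  rw [fderiv_fun_mul (hf ξ) (hg ξ)]
  simp only [add_apply, smul_apply, smul_eq_mul]
  ring

lemma dirDeriv_const_mul_comp_smul {f : V → ℂ} (hf : Differentiable ℝ f) (v : V) (a : ℂ) (c : ℝ) :
    dirDeriv v (fun ξ => a * f (c • ξ)) = fun ξ => (a * c) * dirDeriv v f (c • ξ) := by
  ext ξ
  have h1 : HasFDerivAt (fun ξ : V => c • ξ) (c • ContinuousLinearMap.id ℝ V) ξ :=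
    (hasFDerivAt_id ξ).const_smul c
  have h2 := ((hf (c • ξ)).hasFDerivAt.comp ξ h1).const_mul a
  simp only [dirDeriv]
  erw [h2.fderiv]
  simp [mul_assoc]

lemma iterate_dirDeriv_comp_smul {f : V → ℂ} (hf : ContDiff ℝ ∞ f) (v : V) (c : ℝ) (k : ℕ) :
    (dirDeriv v)^[k] (fun ξ => f (c • ξ)) = fun ξ => (c : ℂ) ^ k * (dirDeriv v)^[k] f (c • ξ) := by
  induction k with
  | zero => simp
  | succ k ih =>
    rw [Function.iterate_succ_apply', ih, dirDeriv_const_mul_comp_smul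
      ((contDiff_iterate_dirDeriv hf v k).differentiable (by simp)), Function.iterate_succ_apply']
    ext ξ; rw [pow_succ]

/-- Induction on `k` over all `f`, `g`, `B`, `B'`: one derivative turns the product into two
products, with `B` or `B'` multiplied by `μ`. This doubling replaces the binomial formula. -/
lemma norm_iterate_dirDeriv_mul_le (v : V) (μ : ℝ) (ξ : V) (k : ℕ) :
    ∀ (f g : V → ℂ) (B B' : ℝ), ContDiff ℝ ∞ f → ContDiff ℝ ∞ g →
      (∀ r ≤ k, ‖(dirDeriv v)^[r] f ξ‖ ≤ B * μ ^ r) →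
      (∀ r ≤ k, ‖(dirDeriv v)^[r] g ξ‖ ≤ B' * μ ^ r) →
      ‖(dirDeriv v)^[k] (fun ξ => f ξ * g ξ) ξ‖ ≤ 2 ^ k * (B * B') * μ ^ k := by
  induction k with
  | zero =>
    intro f g B B' _ _ h1 h2
    have h1 := h1 0 le_rfl
    have h2 := h2 0 le_rfl
    simp only [Function.iterate_zero, id_eq, pow_zero, mul_one, one_mul, norm_mul] at *
    exact mul_le_mul h1 h2 (norm_nonneg _) ((norm_nonneg _).trans h1)
  | succ k ih =>
    intro f g B B' hf hg h1 h2
    rw [Function.iterate_succ_apply, dirDeriv_mul (hf.differentiable (by simp))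
      (hg.differentiable (by simp)), iterate_dirDeriv_add
      ((contDiff_dirDeriv hf v).mul hg) (hf.mul (contDiff_dirDeriv hg v))]
    have e1 := ih (dirDeriv v f) g (B * μ) B' (contDiff_dirDeriv hf v) hg (fun r hr => by
      have := h1 (r + 1) (by omega)
      rwa [Function.iterate_succ_apply, pow_succ', ← mul_assoc] at this)
      (fun r hr => h2 r (by omega))
    have e2 := ih f (dirDeriv v g) B (B' * μ) hf (contDiff_dirDeriv hg v)
      (fun r hr => h1 r (by omega)) (fun r hr => by
      have := h2 (r + 1) (by omega)
      rwa [Function.iterate_succ_apply, pow_succ', ← mul_assoc] at this)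
    refine (norm_add_le _ _).trans ((add_le_add e1 e2).trans (le_of_eq ?_))
    ring

lemma iterate_dirDeriv_congr {f g : V → ℂ} {ξ : V} (h : f =ᶠ[nhds ξ] g) (v : V) (k : ℕ) :
    (dirDeriv v)^[k] f =ᶠ[nhds ξ] (dirDeriv v)^[k] g := by
  induction k with
  | zero => exact h
  | succ k ih =>
    rw [Function.iterate_succ_apply', Function.iterate_succ_apply']
    filter_upwards [ih.fderiv (𝕜 := ℝ)] with y hy
    simp only [dirDeriv, hy]

lemma iterate_dirDeriv_zero (v : V) (k : ℕ) : (dirDeriv v)^[k] (fun _ => 0) = fun _ => 0 := by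
  induction k with
  | zero => rfl
  | succ k ih => rw [Function.iterate_succ_apply', ih]; ext; simp [dirDeriv]

end DirectionalDerivatives

/-! ### Symbol-type bounds at a single frequency -/

section PointwiseBounds

variable {n : ℕ}

/-- Bounds at the point `ξ` for `f` and its pure derivatives of order at most `n + 1`. -/
def PtBound (f : Rn n → ℂ) (μ B : ℝ) (ξ : Rn n) : Prop :=
  ‖f ξ‖ ≤ B ∧ ∀ i, ∀ k ≤ n + 1, ‖(dirDeriv (EuclideanSpace.single i (1 : ℝ)))^[k] f ξ‖ ≤ B * μ ^ k

namespace PtBound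

variable {f g : Rn n → ℂ} {μ μ' B B' : ℝ} {ξ : Rn n}

lemma nonneg (h : PtBound f μ B ξ) : 0 ≤ B := (norm_nonneg _).trans h.1

lemma mono (h : PtBound f μ B ξ) (hμ : 0 ≤ μ) (hμμ' : μ ≤ μ') (hB : B ≤ B') :
    PtBound f μ' B' ξ := by
  have := h.nonneg
  refine ⟨h.1.trans hB, fun i k hk => (h.2 i k hk).trans ?_⟩
  have : 0 ≤ B' := this.trans hB
  gcongr

lemma mul (hf : PtBound f μ B ξ) (hg : PtBound g μ B' ξ) (hfs : ContDiff ℝ ∞ f)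
    (hgs : ContDiff ℝ ∞ g) (hμ : 0 ≤ μ) :
    PtBound (fun ξ => f ξ * g ξ) μ (2 ^ (n + 1) * (B * B')) ξ := by
  have h1 := hf.nonneg
  have h2 := hg.nonneg
  constructor
  · rw [norm_mul]
    calc ‖f ξ‖ * ‖g ξ‖ ≤ 1 * (B * B') := by
          rw [one_mul]; exact mul_le_mul hf.1 hg.1 (norm_nonneg _) h1
      _ ≤ _ := by gcongr; exact one_le_pow₀ one_le_two
  · intro i k hk
    refine (norm_iterate_dirDeriv_mul_le _ μ ξ k f g B B' hfs hgs
      (fun r hr => hf.2 i r (hr.trans hk)) (fun r hr => hg.2 i r (hr.trans hk))).trans ?_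
    gcongr
    exact one_le_two

lemma add (hf : PtBound f μ B ξ) (hg : PtBound g μ B' ξ) (hfs : ContDiff ℝ ∞ f)
    (hgs : ContDiff ℝ ∞ g) : PtBound (fun ξ => f ξ + g ξ) μ (B + B') ξ := by
  refine ⟨norm_add_le_of_le hf.1 hg.1, fun i k hk => ?_⟩
  rw [iterate_dirDeriv_add hfs hgs, add_mul]
  exact norm_add_le_of_le (hf.2 i k hk) (hg.2 i k hk)

lemma congr (hf : PtBound f μ B ξ) (h : g =ᶠ[nhds ξ] f) : PtBound g μ B ξ := by
  refine ⟨by rw [h.eq_of_nhds]; exact hf.1, fun i k hk => ?_⟩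
  rw [(iterate_dirDeriv_congr h _ k).eq_of_nhds]
  exact hf.2 i k hk

lemma zero (hB : 0 ≤ B) (hμ : 0 ≤ μ) : PtBound (fun _ => 0) μ B ξ := by
  refine ⟨by simpa, fun i k _ => ?_⟩
  rw [iterate_dirDeriv_zero]
  simp only [norm_zero]
  positivity

end PtBound

lemma isPiece_of_ptBound {f : Rn n → ℂ} {Λ μ B : ℝ} (hs : ContDiff ℝ ∞ f)
    (h0 : ∀ ξ, 2 * Λ < ‖ξ‖ → f ξ = 0) (h : ∀ ξ, PtBound f μ B ξ) : IsPiece Λ μ B f :=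
  ⟨hs, h0, fun ξ => (h ξ).1, fun i ξ => (h ξ).2 i _ le_rfl⟩

/-- Bounds for `ξ ↦ 1 - exp (2πi ⟨ξ, w⟩)` in the region `|ξ| ≤ 2Λ` when `|w| Λ ≤ r`. -/
lemma ptBound_one_sub_exp {w ξ : Rn n} {Λ r : ℝ} (hΛ : 0 < Λ) (hξ : ‖ξ‖ ≤ 2 * Λ)
    (hw : ‖w‖ * Λ ≤ r) :
    PtBound (fun ξ => 1 - Complex.exp (↑(2 * Real.pi * inner ℝ ξ w) * Complex.I)) Λ⁻¹
      (13 * (1 + 7 * r) ^ (n + 1) * (‖w‖ * Λ)) ξ := by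
  have hr : 0 ≤ r := (by positivity : (0:ℝ) ≤ ‖w‖ * Λ).trans hw
  have h2pi : 2 * Real.pi ≤ 6.5 := by linarith [Real.pi_lt_d2]
  have hone : (1 : ℝ) ≤ (1 + 7 * r) ^ (n + 1) := one_le_pow₀ (by linarith)
  -- The phase is at most `2π · 2Λ · ‖w‖`, and `13 = 2 · 6.5` with `2π ≤ 6.5`.
  have hzero : ‖(1 : ℂ) - Complex.exp (↑(2 * Real.pi * inner ℝ ξ w) * Complex.I)‖ ≤
      13 * (1 + 7 * r) ^ (n + 1) * (‖w‖ * Λ) := by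
    rw [norm_sub_rev, mul_comm]
    refine (Real.norm_exp_I_mul_ofReal_sub_one_le).trans ?_
    rw [Real.norm_eq_abs, abs_mul, abs_of_pos Real.two_pi_pos]
    calc 2 * Real.pi * |inner ℝ ξ w| ≤ 6.5 * (‖ξ‖ * ‖w‖) := by
          gcongr; exact abs_real_inner_le_norm ξ w
      _ ≤ 6.5 * (2 * Λ * ‖w‖) := by gcongr
      _ = 13 * 1 * (‖w‖ * Λ) := by ring
      _ ≤ _ := by gcongr
  have hder : ∀ (v : Rn n) (k : ℕ), (dirDeriv v)^[k + 1]
      (fun ξ => 1 - Complex.exp (↑(2 * Real.pi * inner ℝ ξ w) * Complex.I)) =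
      fun ξ => -(↑(2 * Real.pi * inner ℝ v w) * Complex.I) ^ (k + 1) *
        Complex.exp (↑(2 * Real.pi * inner ℝ ξ w) * Complex.I) := by
    intro v k
    have hexp : ∀ ξ : Rn n, HasFDerivAt
        (fun ξ : Rn n => Complex.exp (↑(2 * Real.pi * inner ℝ ξ w) * Complex.I))
        (Complex.exp (↑(2 * Real.pi * inner ℝ ξ w) * Complex.I) •
          ((Complex.ofRealCLM.comp ((2 * Real.pi) • ((innerSL ℝ).flip w))).smulRight
            Complex.I)) ξ := by
      intro ξ
      have h1 : HasFDerivAt (fun ξ : Rn n => (↑(2 * Real.pi * inner ℝ ξ w) : ℂ) * Complex.I)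
          ((Complex.ofRealCLM.comp ((2 * Real.pi) • ((innerSL ℝ).flip w))).smulRight
            Complex.I) ξ := by
        exact ((Complex.ofRealCLM.comp ((2 * Real.pi) • ((innerSL ℝ).flip w))).smulRight
            Complex.I).hasFDerivAt
      exact h1.cexp
    have hv : innerSL ℝ w v = inner ℝ v w := by
      rw [innerSL_apply_apply ℝ, real_inner_comm]
    induction k with
    | zero =>
      ext ξ
      simp only [zero_add, Function.iterate_one, dirDeriv]
      erw [((hexp ξ).const_sub 1).fderiv]
      simp [hv]
      ring
    | succ k ih =>
      rw [Function.iterate_succ_apply', ih]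
      ext ξ
      simp only [dirDeriv]
      erw [((hexp ξ).const_mul _).fderiv]
      simp [hv]
      ring
  refine ⟨hzero, fun i k hk => ?_⟩
  rcases k with _ | k
  · simpa using hzero
  · rw [hder, norm_mul, norm_neg, norm_pow, Complex.norm_exp_ofReal_mul_I, mul_one, norm_mul,
      Complex.norm_I, mul_one, Complex.norm_real, Real.norm_eq_abs, abs_mul,
      abs_of_pos Real.two_pi_pos]
    have h1 : |inner ℝ (EuclideanSpace.single i (1 : ℝ)) w| ≤ ‖w‖ := by
      refine (abs_real_inner_le_norm _ _).trans ?_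
      simp
    calc (2 * Real.pi * |inner ℝ (EuclideanSpace.single i (1 : ℝ)) w|) ^ (k + 1)
        ≤ (6.5 * ‖w‖) ^ (k + 1) := by gcongr
      -- One factor `‖w‖ * Λ` is kept as the gain; the others are only known to be at most `r` and
      -- go into the constant.
      _ = (6.5 * (‖w‖ * Λ)) ^ k * (6.5 * (‖w‖ * Λ)) * Λ⁻¹ ^ (k + 1) := by
          rw [← pow_succ, ← mul_pow]; congr 1; field_simp
      _ ≤ (1 + 7 * r) ^ k * (13 * (‖w‖ * Λ)) * Λ⁻¹ ^ (k + 1) := by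
          gcongr
          · nlinarith
          · norm_num
      _ ≤ (1 + 7 * r) ^ (n + 1) * (13 * (‖w‖ * Λ)) * Λ⁻¹ ^ (k + 1) := by
          gcongr
          · linarith
          · omega
      _ = _ := by ring

end PointwiseBounds

/-! ### Dyadic decomposition of a symbol in frequency -/

section DyadicPieces

variable {n : ℕ}

/-- The symbol estimates that are used: pure derivatives in `ξ` of order at most `n + 1`, and
their Lipschitz continuity in `x`. -/
structure SymbolBounds (m ρ δ A : ℝ) (b : Rn n → Rn n → ℂ) : Prop where
  smooth : ContDiff ℝ ∞ fun p : Rn n × Rn n => b p.1 p.2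
  bound : ∀ x ξ, PtBound (b x) ((1 + ‖ξ‖) ^ (-ρ)) (A * (1 + ‖ξ‖) ^ m) ξ
  bound_sub : ∀ x z ξ, PtBound (fun ξ => b x ξ - b z ξ) ((1 + ‖ξ‖) ^ (-ρ))
    (A * ‖x - z‖ * (1 + ‖ξ‖) ^ (m + δ)) ξ

namespace SymbolBounds

variable {m ρ δ A : ℝ} {b : Rn n → Rn n → ℂ}

lemma nonneg (h : SymbolBounds m ρ δ A b) : 0 ≤ A := by
  have := (h.bound 0 0).nonneg
  simpa using this

/-- Used to reach `ρ ≤ δ`, which the high-frequency argument for `ρ < 1` assumes. -/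
lemma mono (h : SymbolBounds m ρ δ A b) {δ' : ℝ} (hδ : δ ≤ δ') : SymbolBounds m ρ δ' A b := by
  refine ⟨h.smooth, h.bound, fun x z ξ => (h.bound_sub x z ξ).mono (by positivity) le_rfl ?_⟩
  have := h.nonneg
  gcongr
  linarith [norm_nonneg ξ]

lemma contDiff_right (h : SymbolBounds m ρ δ A b) (x : Rn n) : ContDiff ℝ ∞ (b x) :=
  h.smooth.comp (contDiff_const.prodMk contDiff_id : ContDiff ℝ ∞ fun ξ : Rn n => (x, ξ))

end SymbolBounds

/-- A smooth bump equal to `1` on the unit ball and supported in the ball of radius `2`. -/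
noncomputable def unitBump (n : ℕ) : ContDiffBump (0 : Rn n) := ⟨1, 2, one_pos, one_lt_two⟩

/-- The cutoff to frequencies `|ξ| ≲ 2 ^ j`. -/
noncomputable def lowCut (j : ℕ) (ξ : Rn n) : ℂ := ((unitBump n (((2 : ℝ) ^ j)⁻¹ • ξ) : ℝ) : ℂ)

/-- The dyadic partition of unity in frequency. -/
noncomputable def dyadicCut : ℕ → Rn n → ℂ
  | 0 => lowCut 0
  | j + 1 => fun ξ => lowCut (j + 1) ξ - lowCut j ξ

lemma contDiff_unitBump : ContDiff ℝ ∞ fun ξ : Rn n => ((unitBump n ξ : ℝ) : ℂ) :=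
  Complex.ofRealCLM.contDiff.comp (unitBump n).contDiff

lemma contDiff_lowCut (j : ℕ) : ContDiff ℝ ∞ (lowCut j : Rn n → ℂ) :=
  contDiff_unitBump.comp (contDiff_const_smul _)

lemma contDiff_dyadicCut (j : ℕ) : ContDiff ℝ ∞ (dyadicCut j : Rn n → ℂ) := by
  cases j with
  | zero => exact contDiff_lowCut 0
  | succ j => exact (contDiff_lowCut _).sub (contDiff_lowCut _)

lemma sum_dyadicCut (J : ℕ) (ξ : Rn n) :
    ∑ j ∈ Finset.range (J + 1), dyadicCut j ξ = lowCut J ξ := by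
  induction J with
  | zero => simp [dyadicCut]
  | succ J ih => rw [Finset.sum_range_succ, ih, dyadicCut]; ring

lemma norm_lowCut_le (j : ℕ) (ξ : Rn n) : ‖lowCut j ξ‖ ≤ 1 := by
  rw [lowCut, Complex.norm_real, Real.norm_of_nonneg (unitBump n).nonneg]
  exact (unitBump n).le_one

lemma lowCut_eq_one {j : ℕ} {ξ : Rn n} (h : ‖ξ‖ ≤ 2 ^ j) : lowCut j ξ = 1 := by
  rw [lowCut, (unitBump n).one_of_mem_closedBall]
  · simp
  · rw [mem_closedBall_zero_iff, norm_smul, Real.norm_of_nonneg (by positivity)]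
    change _ ≤ (1 : ℝ)
    rwa [inv_mul_le_iff₀ (by positivity), mul_one]

lemma lowCut_eq_zero {j : ℕ} {ξ : Rn n} (h : 2 * 2 ^ j ≤ ‖ξ‖) : lowCut j ξ = 0 := by
  rw [lowCut, (unitBump n).zero_of_le_dist]
  · simp
  · rw [dist_zero_right, norm_smul, Real.norm_of_nonneg (by positivity)]
    change (2 : ℝ) ≤ _
    rw [le_inv_mul_iff₀ (by positivity)]
    linarith

/-- The frequencies that the `j`-th dyadic cutoff sees. -/
def InShell (j : ℕ) (ξ : Rn n) : Prop := ‖ξ‖ ≤ 2 * 2 ^ j ∧ (j = 0 ∨ 2 ^ j / 2 ≤ ‖ξ‖)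

lemma dyadicCut_eventually_zero {j : ℕ} {ξ : Rn n} (h : ¬ InShell j ξ) :
    dyadicCut j =ᶠ[nhds ξ] fun _ : Rn n => (0 : ℂ) := by
  rw [InShell, not_and_or, not_or, not_le, not_le] at h
  cases j with
  | zero =>
    rcases h with h | h
    · filter_upwards [(isOpen_lt continuous_const continuous_norm).mem_nhds h] with y hy
      exact lowCut_eq_zero (le_of_lt hy)
    · exact absurd rfl h.1
  | succ j =>
    rcases h with h | h
    · filter_upwards [(isOpen_lt continuous_const continuous_norm).mem_nhds h] with y hy
      have hy : 2 * 2 ^ (j + 1) < ‖y‖ := hy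
      have h2 : (2 : ℝ) * 2 ^ j ≤ ‖y‖ := by
        have : (0 : ℝ) < 2 ^ j := by positivity
        rw [pow_succ] at hy
        linarith
      change lowCut (j + 1) y - lowCut j y = 0
      rw [lowCut_eq_zero hy.le, lowCut_eq_zero h2, sub_zero]
    · filter_upwards [(isOpen_lt continuous_norm continuous_const).mem_nhds h.2] with y hy
      have hy : ‖y‖ < 2 ^ (j + 1) / 2 := hy
      have : (0 : ℝ) < 2 ^ j := by positivity
      rw [pow_succ] at hy
      change lowCut (j + 1) y - lowCut j y = 0
      rw [lowCut_eq_one, lowCut_eq_one, sub_self]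
      · linarith
      · rw [pow_succ]; linarith

lemma exists_ptBound_unitBump (n : ℕ) :
    ∃ K : ℝ, 0 ≤ K ∧ ∀ ξ : Rn n, PtBound (fun ξ => ((unitBump n ξ : ℝ) : ℂ)) 1 K ξ := by
  have hcs : HasCompactSupport fun ξ : Rn n => ((unitBump n ξ : ℝ) : ℂ) :=
    (unitBump n).hasCompactSupport.comp_left (g := fun t : ℝ => (t : ℂ)) (by simp)
  have hcsk : ∀ (v : Rn n) (k : ℕ),
      HasCompactSupport ((dirDeriv v)^[k] fun ξ : Rn n => ((unitBump n ξ : ℝ) : ℂ)) := by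
    intro v k
    induction k with
    | zero => exact hcs
    | succ k ih =>
      rw [Function.iterate_succ_apply']
      exact ih.fderiv_apply (𝕜 := ℝ) v
  have : ∀ (i : Fin n) (k : ℕ), ∃ K, ∀ ξ, ‖((dirDeriv (EuclideanSpace.single i (1 : ℝ)))^[k]
      fun ξ : Rn n => ((unitBump n ξ : ℝ) : ℂ)) ξ‖ ≤ K := fun i k =>
    (hcsk _ k).exists_bound_of_continuous (contDiff_iterate_dirDeriv contDiff_unitBump _ k).continuous
  choose K hK using this
  have hK0 : ∀ i k, 0 ≤ K i k := fun i k => (norm_nonneg _).trans (hK i k 0)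
  have hS : 0 ≤ ∑ i, ∑ k ∈ Finset.range (n + 2), K i k :=
    Finset.sum_nonneg fun i _ => Finset.sum_nonneg fun k _ => hK0 i k
  refine ⟨1 + ∑ i, ∑ k ∈ Finset.range (n + 2), K i k, by positivity, fun ξ => ⟨?_, fun i k hk => ?_⟩⟩
  · rw [Complex.norm_real, Real.norm_of_nonneg (unitBump n).nonneg]
    linarith [(unitBump n).le_one (x := ξ)]
  · rw [one_pow, mul_one]
    refine (hK i k ξ).trans ?_
    have h1 := Finset.single_le_sum (f := fun k => K i k) (fun k _ => hK0 i k)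
      (Finset.mem_range.2 (by omega : k < n + 2))
    have h2 := Finset.single_le_sum (f := fun i => ∑ k ∈ Finset.range (n + 2), K i k)
      (fun i _ => Finset.sum_nonneg fun k _ => hK0 i k) (Finset.mem_univ i)
    linarith

lemma exists_ptBound_dyadicCut (n : ℕ) :
    ∃ K : ℝ, 0 ≤ K ∧ ∀ (j : ℕ) (ξ : Rn n), PtBound (dyadicCut j) ((2 ^ j)⁻¹) K ξ := by
  obtain ⟨K, hK, h⟩ := exists_ptBound_unitBump n
  have hlow : ∀ (j : ℕ) (ξ : Rn n), PtBound (lowCut j) ((2 ^ j)⁻¹) K ξ := by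
    intro j ξ
    refine ⟨(h _).1, fun i k hk => ?_⟩
    change ‖(dirDeriv _)^[k] (fun ξ => (fun η : Rn n => ((unitBump n η : ℝ) : ℂ))
      (((2 : ℝ) ^ j)⁻¹ • ξ)) ξ‖ ≤ _
    rw [iterate_dirDeriv_comp_smul contDiff_unitBump]
    have := (h (((2 : ℝ) ^ j)⁻¹ • ξ)).2 i k hk
    rw [one_pow, mul_one] at this
    rw [norm_mul, norm_pow, Complex.norm_real, Real.norm_of_nonneg (by positivity), mul_comm]
    gcongr
  refine ⟨K + 2 ^ (n + 1) * K, by positivity, fun j ξ => ?_⟩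
  cases j with
  | zero => exact (hlow 0 ξ).mono (by positivity) le_rfl (by linarith [mul_nonneg (by positivity : (0:ℝ) ≤ 2 ^ (n + 1)) hK])
  | succ j =>
    -- The inner cutoff varies at scale `2 ^ j`, half of the scale used for the difference; the `k ≤
    -- n + 1` derivatives therefore cost up to `2 ^ (n + 1)`.
    have h2 : PtBound (fun ξ => -lowCut j ξ) ((2 ^ (j + 1))⁻¹) (2 ^ (n + 1) * K) ξ := by
      refine ⟨?_, fun i k hk => ?_⟩
      · rw [norm_neg]
        exact (hlow j ξ).1.trans (le_mul_of_one_le_left hK (one_le_pow₀ one_le_two))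
      · have e2 : ∀ (v : Rn n) (k : ℕ), (dirDeriv v)^[k] (fun ξ : Rn n => -lowCut j ξ) =
            fun ξ => -(dirDeriv v)^[k] (lowCut j) ξ := by
          intro v k
          induction k with
          | zero => rfl
          | succ k ih =>
            rw [Function.iterate_succ_apply', ih, Function.iterate_succ_apply']
            ext ξ
            simp [dirDeriv, fderiv_fun_neg]
        rw [e2, norm_neg]
        refine ((hlow j ξ).2 i k hk).trans ?_
        rw [pow_succ (2 : ℝ) j, mul_inv, mul_pow _ _ k]
        calc K * ((2 : ℝ) ^ j)⁻¹ ^ k = 2 ^ k * K * (((2 : ℝ) ^ j)⁻¹ ^ k * 2⁻¹ ^ k) := by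
              rw [inv_pow 2 k]; field_simp
          _ ≤ _ := by gcongr; exact one_le_two
    refine ((hlow (j + 1) ξ).add h2 (contDiff_lowCut _) (contDiff_lowCut _).neg).congr ?_
    exact Filter.Eventually.of_forall fun ξ => by simp [dyadicCut, sub_eq_add_neg]

/-- On the shell, `1 + ‖ξ‖` agrees with `2 ^ j` up to a factor `3` either way, including `j = 0`,
where the shell is a ball. -/
lemma rpow_le_of_inShell {j : ℕ} {ξ : Rn n} (h : InShell j ξ) {t T : ℝ} (ht : |t| ≤ T) :
    (1 + ‖ξ‖) ^ t ≤ 3 ^ T * ((2 : ℝ) ^ j) ^ t := by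
  have hj : (1 : ℝ) ≤ 2 ^ j := one_le_pow₀ one_le_two
  have hlow : (2 : ℝ) ^ j / 3 ≤ 1 + ‖ξ‖ := by
    rcases h.2 with h0 | h0
    · subst h0; have := norm_nonneg ξ; norm_num; linarith
    · linarith
  have hup : 1 + ‖ξ‖ ≤ 3 * 2 ^ j := by linarith [h.1]
  rcases le_total 0 t with h0 | h0
  · calc (1 + ‖ξ‖) ^ t ≤ (3 * 2 ^ j) ^ t := by gcongr
      _ = 3 ^ t * ((2 : ℝ) ^ j) ^ t := Real.mul_rpow (by norm_num) (by positivity)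
      _ ≤ _ := by gcongr; exacts [by norm_num, (le_abs_self t).trans ht]
  · calc (1 + ‖ξ‖) ^ t ≤ ((2 : ℝ) ^ j / 3) ^ t :=
          Real.rpow_le_rpow_of_nonpos (by positivity) hlow h0
      _ = 3 ^ (-t) * ((2 : ℝ) ^ j) ^ t := by
          rw [Real.div_rpow (by positivity) (by norm_num), Real.rpow_neg (by norm_num)]
          field_simp
      _ ≤ _ := by gcongr; exacts [by norm_num, (neg_le_abs t).trans ht]

/-- Off the shell the cutoff vanishes in a neighbourhood, so bounds on `g` matter only on it. The
condition `2^{-j} ≤ μ` makes derivatives of the cutoff no worse than those of `g`. -/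
lemma PtBound.dyadicCut_mul {K : ℝ} {j : ℕ} (hK : ∀ ξ : Rn n, PtBound (dyadicCut j) ((2 ^ j)⁻¹) K ξ)
    {g : Rn n → ℂ} (hg : ContDiff ℝ ∞ g) {μ B : ℝ} (hB : 0 ≤ B) (hμ : ((2 : ℝ) ^ j)⁻¹ ≤ μ)
    (h : ∀ ξ, InShell j ξ → PtBound g μ B ξ) (ξ : Rn n) :
    PtBound (fun ξ => dyadicCut j ξ * g ξ) μ (2 ^ (n + 1) * (K * B)) ξ := by
  have hμ0 : 0 ≤ μ := le_trans (by positivity) hμ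
  have hK0 := (hK ξ).nonneg
  by_cases hξ : InShell j ξ
  · exact ((hK ξ).mono (by positivity) hμ le_rfl).mul (h ξ hξ) (contDiff_dyadicCut j) hg hμ0
  · refine (PtBound.zero (by positivity) hμ0).congr ?_
    filter_upwards [dyadicCut_eventually_zero hξ] with y hy
    rw [hy, zero_mul]

lemma dyadicCut_mul_eq_zero (j : ℕ) (g : Rn n → ℂ) (ξ : Rn n) (h : 2 * 2 ^ j < ‖ξ‖) :
    dyadicCut j ξ * g ξ = 0 := by
  rw [(dyadicCut_eventually_zero fun hs => (not_lt.2 hs.1) h).eq_of_nhds, zero_mul]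

/-- The dyadic pieces of a symbol. -/
noncomputable def symbolPiece (b : Rn n → Rn n → ℂ) (j : ℕ) (x ξ : Rn n) : ℂ :=
  dyadicCut j ξ * b x ξ

lemma PtBound.of_bracket {g : Rn n → ℂ} {j : ℕ} {ξ : Rn n} {ρ A t T : ℝ} (hρ0 : 0 ≤ ρ) (hρ1 : ρ ≤ 1)
    (hA : 0 ≤ A) (h : PtBound g ((1 + ‖ξ‖) ^ (-ρ)) (A * (1 + ‖ξ‖) ^ t) ξ) (hξ : InShell j ξ)
    (ht : |t| ≤ T) :
    PtBound g (((2 : ℝ) ^ j) ^ (-ρ)) (3 ^ (T + (n + 1)) * A * ((2 : ℝ) ^ j) ^ t) ξ := by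
  have h1 := rpow_le_of_inShell hξ ht
  have h3 : (3 : ℝ) ^ T ≤ 3 ^ (T + (n + 1)) :=
    Real.rpow_le_rpow_of_exponent_le (by norm_num) (by linarith [n.cast_nonneg (α := ℝ)])
  refine ⟨h.1.trans ?_, fun i k hk => (h.2 i k hk).trans ?_⟩
  · calc A * (1 + ‖ξ‖) ^ t ≤ A * (3 ^ T * ((2 : ℝ) ^ j) ^ t) := by gcongr
      _ ≤ A * (3 ^ (T + (n + 1)) * ((2 : ℝ) ^ j) ^ t) := by gcongr
      _ = _ := by ring
  · have h2 : ((1 + ‖ξ‖) ^ (-ρ)) ^ k ≤ 3 ^ ((n : ℝ) + 1) * (((2 : ℝ) ^ j) ^ (-ρ)) ^ k := by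
      rw [← Real.rpow_natCast, ← Real.rpow_natCast, ← Real.rpow_mul (by positivity),
        ← Real.rpow_mul (by positivity)]
      refine rpow_le_of_inShell hξ ?_
      rw [abs_mul, abs_neg, abs_of_nonneg hρ0, Nat.abs_cast]
      have : (k : ℝ) ≤ n + 1 := by exact_mod_cast hk
      nlinarith [k.cast_nonneg (α := ℝ)]
    calc A * (1 + ‖ξ‖) ^ t * ((1 + ‖ξ‖) ^ (-ρ)) ^ k
        ≤ A * (3 ^ T * ((2 : ℝ) ^ j) ^ t) * (3 ^ ((n : ℝ) + 1) * (((2 : ℝ) ^ j) ^ (-ρ)) ^ k) := by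
          gcongr
      _ = _ := by rw [Real.rpow_add (by norm_num) T (n + 1)]; ring

lemma inv_two_pow_le_rpow {ρ : ℝ} (hρ1 : ρ ≤ 1) (j : ℕ) :
    ((2 : ℝ) ^ j)⁻¹ ≤ ((2 : ℝ) ^ j) ^ (-ρ) := by
  rw [← Real.rpow_neg_one]
  exact Real.rpow_le_rpow_of_exponent_le (one_le_pow₀ one_le_two) (by linarith)

/-- The three bounds serve the size of a piece, the error of freezing it in `x`, and the comparison
of the operator at `x` with its value at the centre `c` of a cube. -/
lemma exists_symbolPiece_bounds (n : ℕ) (m ρ δ A : ℝ) (hρ0 : 0 ≤ ρ) (hρ1 : ρ ≤ 1) (hδ1 : δ ≤ 1)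
    (hA : 0 ≤ A) : ∃ C : ℝ, 0 ≤ C ∧ ∀ b : Rn n → Rn n → ℂ, SymbolBounds m ρ δ A b → ∀ j : ℕ,
      (∀ x ξ, PtBound (symbolPiece b j x) (((2 : ℝ) ^ j) ^ (-ρ)) (C * ((2 : ℝ) ^ j) ^ m) ξ) ∧
      (∀ x z ξ, PtBound (fun ξ => symbolPiece b j x ξ - symbolPiece b j z ξ)
        (((2 : ℝ) ^ j) ^ (-ρ)) (C * ‖x - z‖ * ((2 : ℝ) ^ j) ^ (m + δ)) ξ) ∧
      (∀ x c ξ, ‖c - x‖ * 2 ^ j ≤ n → PtBound (fun ξ => symbolPiece b j x ξ -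
        Complex.exp (↑(2 * Real.pi * inner ℝ ξ (c - x)) * Complex.I) * symbolPiece b j c ξ)
        (((2 : ℝ) ^ j) ^ (-ρ)) (C * (‖c - x‖ * 2 ^ j) * ((2 : ℝ) ^ j) ^ m) ξ) := by
  obtain ⟨K, hK, hdy⟩ := exists_ptBound_dyadicCut n
  set T : ℝ := |m| + |δ| with hT
  set C₁ : ℝ := 2 ^ (n + 1) * (K * (3 ^ (T + (n + 1)) * A)) with hC₁
  set C₂ : ℝ := 2 ^ (n + 1) * (13 * (1 + 7 * n) ^ (n + 1) * C₁) with hC₂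
  have hC₁0 : 0 ≤ C₁ := by positivity
  have hC₂0 : 0 ≤ C₂ := by positivity
  refine ⟨C₁ + C₂ + C₁, by positivity, fun b hb j => ?_⟩
  have hj : (0 : ℝ) < 2 ^ j := by positivity
  have hj1 : (1 : ℝ) ≤ 2 ^ j := one_le_pow₀ one_le_two
  have hμ0 : (0 : ℝ) ≤ ((2 : ℝ) ^ j) ^ (-ρ) := by positivity
  have hμ := inv_two_pow_le_rpow hρ1 j
  have hm : |m| ≤ T := by rw [hT]; linarith [abs_nonneg δ]
  have hmδ : |m + δ| ≤ T := abs_add_le _ _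
  have hsm : ∀ x, ContDiff ℝ ∞ (symbolPiece b j x) := fun x =>
    (contDiff_dyadicCut j).mul (hb.contDiff_right x)
  have h1 : ∀ x ξ, PtBound (symbolPiece b j x) (((2 : ℝ) ^ j) ^ (-ρ)) (C₁ * ((2 : ℝ) ^ j) ^ m) ξ := by
    intro x ξ
    refine (PtBound.dyadicCut_mul (hdy j) (hb.contDiff_right x) (by positivity) hμ
      (fun ξ hξ => (hb.bound x ξ).of_bracket hρ0 hρ1 hA hξ hm) ξ).mono hμ0 le_rfl (le_of_eq ?_)
    rw [hC₁]; ring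
  have h2 : ∀ x z ξ, PtBound (fun ξ => symbolPiece b j x ξ - symbolPiece b j z ξ)
      (((2 : ℝ) ^ j) ^ (-ρ)) (C₁ * ‖x - z‖ * ((2 : ℝ) ^ j) ^ (m + δ)) ξ := by
    intro x z ξ
    have := PtBound.dyadicCut_mul (hdy j)
      ((hb.contDiff_right x).sub (hb.contDiff_right z)) (by positivity) hμ
      (fun ξ hξ => (hb.bound_sub x z ξ).of_bracket hρ0 hρ1
        (mul_nonneg hA (norm_nonneg _)) hξ hmδ) ξ
    refine (this.congr ?_).mono hμ0 le_rfl (le_of_eq ?_)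
    · exact Filter.Eventually.of_forall fun ξ => by simp only [symbolPiece]; ring
    · rw [hC₁]; ring
  refine ⟨fun x ξ => (h1 x ξ).mono hμ0 le_rfl ?_, fun x z ξ => (h2 x z ξ).mono hμ0 le_rfl ?_,
    fun x c ξ hcx => ?_⟩
  · gcongr; linarith
  · gcongr; linarith
  · set w := c - x with hw
    -- With `e` the exponential, `b_x - e b_c = (b_x - b_c) + (1 - e) b_c`. The second term gains
    -- `‖w‖ 2^j` from the phase; the first gains `‖w‖ 2^{δj}`, which is no larger because `δ ≤ 1`.
    have h3 : PtBound (fun ξ => (1 - Complex.exp (↑(2 * Real.pi * inner ℝ ξ w) * Complex.I)) *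
        symbolPiece b j c ξ) (((2 : ℝ) ^ j) ^ (-ρ)) (C₂ * (‖w‖ * 2 ^ j) * ((2 : ℝ) ^ j) ^ m) ξ := by
      by_cases hξ : InShell j ξ
      · have e1 := (ptBound_one_sub_exp hj hξ.1 hcx).mono (by positivity) hμ le_rfl
        refine (e1.mul (h1 c ξ) ?_ (hsm c) hμ0).mono hμ0 le_rfl (le_of_eq ?_)
        · have : ContDiff ℝ ∞ fun ξ : Rn n => (2 * Real.pi * inner ℝ ξ w : ℝ) :=
            contDiff_const.mul (contDiff_id.inner ℝ contDiff_const)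
          exact contDiff_const.sub
            (((Complex.ofRealCLM.contDiff.comp this).mul contDiff_const).cexp)
        · rw [hC₂]; ring
      · refine (PtBound.zero (by positivity) hμ0).congr ?_
        filter_upwards [dyadicCut_eventually_zero hξ] with y hy
        rw [symbolPiece, hy, zero_mul, mul_zero]
    have hsexp : ContDiff ℝ ∞ fun ξ : Rn n =>
        (1 - Complex.exp (↑(2 * Real.pi * inner ℝ ξ w) * Complex.I)) * symbolPiece b j c ξ := by
      have : ContDiff ℝ ∞ fun ξ : Rn n => (2 * Real.pi * inner ℝ ξ w : ℝ) :=
        contDiff_const.mul (contDiff_id.inner ℝ contDiff_const)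
      exact (contDiff_const.sub
        (((Complex.ofRealCLM.contDiff.comp this).mul contDiff_const).cexp)).mul (hsm c)
    refine (((h2 x c ξ).add h3 ((hsm x).sub (hsm c)) hsexp).congr ?_).mono hμ0 le_rfl ?_
    · exact Filter.Eventually.of_forall fun ξ => by ring
    · have e1 : ((2 : ℝ) ^ j) ^ (m + δ) ≤ 2 ^ j * ((2 : ℝ) ^ j) ^ m := by
        calc ((2 : ℝ) ^ j) ^ (m + δ) ≤ ((2 : ℝ) ^ j) ^ (m + 1) :=
              Real.rpow_le_rpow_of_exponent_le hj1 (by linarith)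
          _ = _ := by rw [Real.rpow_add hj, Real.rpow_one, mul_comm]
      have e2 : ‖x - c‖ = ‖w‖ := norm_sub_rev _ _
      rw [e2]
      have e3 : C₁ * ‖w‖ * ((2 : ℝ) ^ j) ^ (m + δ) ≤ C₁ * ‖w‖ * (2 ^ j * ((2 : ℝ) ^ j) ^ m) := by
        gcongr
      have e4 : 0 ≤ C₁ * (‖w‖ * 2 ^ j * ((2 : ℝ) ^ j) ^ m) := by positivity
      nlinarith

end DyadicPieces

/-! ### From Hörmander class estimates to the bounds used, in the normalisation of `𝓕` -/

section SymbolConversion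

open FourierTransform

lemma multiDeriv_single {n : ℕ} {V : Type*} [NormedAddCommGroup V] [NormedSpace ℝ V]
    (v : Fin n → V) (i : Fin n) (k : ℕ) (f : V → ℂ) :
    multiDeriv v (Pi.single i k) f = (dirDeriv (v i))^[k] f := by
  have key : ∀ l : List (Fin n), l.Nodup →
      l.foldr (fun j g => (dirDeriv (v j))^[(Pi.single i k : Fin n → ℕ) j] g) f =
        if i ∈ l then (dirDeriv (v i))^[k] f else f := by
    intro l hl
    induction l with
    | nil => rfl
    | cons j l ih =>
      rw [List.nodup_cons] at hl
      rw [List.foldr_cons, ih hl.2]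
      by_cases hij : i = j
      · subst hij
        simp [hl.1]
      · rw [Pi.single_eq_of_ne (Ne.symm hij)]
        simp [hij]
  rw [multiDeriv, key _ (List.nodup_finRange n), if_pos (List.mem_finRange i)]

lemma multiOrder_single {n : ℕ} (i : Fin n) (k : ℕ) : multiOrder (Pi.single i k) = k := by
  simp [multiOrder]

lemma iterate_dirDeriv_slice {E F : Type*} [NormedAddCommGroup E] [NormedSpace ℝ E]
    [NormedAddCommGroup F] [NormedSpace ℝ F] {a : E × F → ℂ} (ha : ContDiff ℝ ∞ a) (x : E) (v : F)
    (k : ℕ) : (dirDeriv v)^[k] (fun ξ => a (x, ξ)) =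
      fun ξ => (dirDeriv ((0 : E), v))^[k] a (x, ξ) := by
  induction k with
  | zero => rfl
  | succ k ih =>
    rw [Function.iterate_succ_apply', ih, Function.iterate_succ_apply']
    ext ξ
    have hd := (contDiff_iterate_dirDeriv ha ((0 : E), v) k).differentiable (by simp) (x, ξ)
    have h2 := hd.hasFDerivAt.comp ξ (hasFDerivAt_prodMk_right x ξ)
    simp only [dirDeriv]
    erw [h2.fderiv]
    simp

lemma iterate_dirDeriv_sub {V : Type*} [NormedAddCommGroup V] [NormedSpace ℝ V] {f g : V → ℂ}
    (hf : ContDiff ℝ ∞ f) (hg : ContDiff ℝ ∞ g) (v : V) (k : ℕ) :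
    (dirDeriv v)^[k] (fun ξ => f ξ - g ξ) =
      fun ξ => (dirDeriv v)^[k] f ξ - (dirDeriv v)^[k] g ξ := by
  have h := iterate_dirDeriv_add (hf.sub hg) hg v k
  simp only [sub_add_cancel] at h
  ext ξ
  rw [eq_sub_iff_add_eq]
  exact (congrFun h ξ).symm

variable {n : ℕ}

lemma one_add_norm_div_le_bracket (ξ : Rn n) :
    (1 + ‖ξ‖) / 7 ≤ bracket ((2 * Real.pi) • ξ) ∧ bracket ((2 * Real.pi) • ξ) ≤ 7 * (1 + ‖ξ‖) := by
  have h1 : ‖(2 * Real.pi) • ξ‖ = 2 * Real.pi * ‖ξ‖ := by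
    rw [norm_smul, Real.norm_of_nonneg Real.two_pi_pos.le]
  have hpi : 2 * Real.pi ≤ 6.5 := by linarith [Real.pi_lt_d2]
  have hpi2 : 6 ≤ 2 * Real.pi := by linarith [Real.pi_gt_three]
  have h0 := norm_nonneg ξ
  rw [bracket, h1]
  constructor
  · refine Real.le_sqrt_of_sq_le ?_
    have : (6 * ‖ξ‖) ^ 2 ≤ (2 * Real.pi * ‖ξ‖) ^ 2 := by gcongr
    nlinarith [sq_nonneg (‖ξ‖ - 1)]
  · rw [Real.sqrt_le_left (by positivity)]
    have : (2 * Real.pi * ‖ξ‖) ^ 2 ≤ (6.5 * ‖ξ‖) ^ 2 := by gcongr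
    nlinarith

lemma bracket_rpow_le (ξ : Rn n) {t T : ℝ} (ht : |t| ≤ T) :
    bracket ((2 * Real.pi) • ξ) ^ t ≤ 7 ^ T * (1 + ‖ξ‖) ^ t := by
  obtain ⟨hlow, hup⟩ := one_add_norm_div_le_bracket ξ
  have hpos : 0 < (1 + ‖ξ‖) / 7 := by positivity
  rcases le_total 0 t with h0 | h0
  · calc bracket ((2 * Real.pi) • ξ) ^ t ≤ (7 * (1 + ‖ξ‖)) ^ t :=
          Real.rpow_le_rpow (hpos.le.trans hlow) hup h0
      _ = 7 ^ t * (1 + ‖ξ‖) ^ t := Real.mul_rpow (by norm_num) (by positivity)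
      _ ≤ _ := by gcongr; exacts [by norm_num, (le_abs_self t).trans ht]
  · calc bracket ((2 * Real.pi) • ξ) ^ t ≤ ((1 + ‖ξ‖) / 7) ^ t :=
          Real.rpow_le_rpow_of_nonpos hpos hlow h0
      _ = 7 ^ (-t) * (1 + ‖ξ‖) ^ t := by
          rw [Real.div_rpow (by positivity) (by norm_num), Real.rpow_neg (by norm_num)]
          field_simp
      _ ≤ _ := by gcongr; exacts [by norm_num, (neg_le_abs t).trans ht]

/-- The symbol in the normalisation of `𝓕`. -/
noncomputable def rescaledSymbol (a : Rn n × Rn n → ℂ) (x ξ : Rn n) : ℂ := a (x, (2 * Real.pi) • ξ)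

lemma iterate_dirDeriv_rescaledSymbol {a : Rn n × Rn n → ℂ} (ha : ContDiff ℝ ∞ a) (x : Rn n)
    (i : Fin n) (k : ℕ) (ξ : Rn n) :
    (dirDeriv (EuclideanSpace.single i (1 : ℝ)))^[k] (rescaledSymbol a x) ξ =
      ((2 * Real.pi : ℝ) : ℂ) ^ k * derivXi (Pi.single i k) a (x, (2 * Real.pi) • ξ) := by
  have h := iterate_dirDeriv_comp_smul (f := fun ξ => a (x, ξ))
    (ha.comp (contDiff_const.prodMk contDiff_id : ContDiff ℝ ∞ fun ξ : Rn n => (x, ξ)))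
    (EuclideanSpace.single i (1 : ℝ)) (2 * Real.pi) k
  change (dirDeriv _)^[k] (fun ξ => a (x, (2 * Real.pi) • ξ)) ξ = _
  rw [h, iterate_dirDeriv_slice ha, derivXi, multiDeriv_single]

lemma contDiff_derivXi_single {a : Rn n × Rn n → ℂ} (ha : ContDiff ℝ ∞ a) (i : Fin n) (k : ℕ) :
    ContDiff ℝ ∞ (derivXi (Pi.single i k) a) := by
  rw [derivXi, multiDeriv_single]
  exact contDiff_iterate_dirDeriv ha _ k

/-- The mean value inequality; the operator norm of the `x`-derivative is at most the sum of the `n`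
partial derivatives. -/
lemma norm_sub_le_of_derivX {G : Rn n × Rn n → ℂ} (hG : ContDiff ℝ ∞ G) {D : ℝ} {ξ : Rn n}
    (hD : ∀ l x, ‖derivX (Pi.single l 1) G (x, ξ)‖ ≤ D) (hD0 : 0 ≤ D) (x z : Rn n) :
    ‖G (x, ξ) - G (z, ξ)‖ ≤ n * D * ‖x - z‖ := by
  have hd : ∀ y, HasFDerivAt (fun y => G (y, ξ))
      ((fderiv ℝ G (y, ξ)).comp (ContinuousLinearMap.inl ℝ (Rn n) (Rn n))) y := fun y =>
    (hG.differentiable (by simp) (y, ξ)).hasFDerivAt.comp y (hasFDerivAt_prodMk_left y ξ)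
  refine Convex.norm_image_sub_le_of_norm_hasFDerivWithin_le (s := Set.univ)
    (f := fun y => G (y, ξ)) (fun y _ => (hd y).hasFDerivWithinAt) (fun y _ => ?_) convex_univ
    (Set.mem_univ z) (Set.mem_univ x)
  refine ContinuousLinearMap.opNorm_le_bound _ (by positivity) fun w => ?_
  have hw : w = ∑ l, w l • (EuclideanSpace.single l (1 : ℝ) : Rn n) := by
    ext i
    simp [Finset.sum_apply, Pi.single_apply]
  have hl : ∀ l, ‖(fderiv ℝ G (y, ξ)).comp (ContinuousLinearMap.inl ℝ (Rn n) (Rn n))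
      (EuclideanSpace.single l (1 : ℝ))‖ ≤ D := by
    intro l
    have := hD l y
    rw [derivX, multiDeriv_single] at this
    exact this
  calc ‖(fderiv ℝ G (y, ξ)).comp (ContinuousLinearMap.inl ℝ (Rn n) (Rn n)) w‖
      = ‖∑ l, w l • (fderiv ℝ G (y, ξ)).comp (ContinuousLinearMap.inl ℝ (Rn n) (Rn n))
          (EuclideanSpace.single l (1 : ℝ))‖ := by
        conv_lhs => rw [hw]
        rw [map_sum]
        simp only [map_smul]
    _ ≤ ∑ l : Fin n, ‖w‖ * D := by
        refine norm_sum_le_of_le _ fun l _ => ?_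
        rw [norm_smul]
        gcongr
        · exact PiLp.norm_apply_le w l
        · exact hl l
    _ = n * D * ‖w‖ := by simp; ring

/-- Only finitely many of the symbol constants enter: `α = k e_i` with `k ≤ n + 1`, and `β = 0` or
`β = e_l`. -/
lemma exists_symbolBounds (hn : 0 < n) (m ρ δ : ℝ) (hρ0 : 0 ≤ ρ) (hρ1 : ρ ≤ 1) (hδ0 : 0 ≤ δ)
    (hδ1 : δ < 1) (A : (Fin n → ℕ) → (Fin n → ℕ) → ℝ) :
    ∃ A' : ℝ, 0 ≤ A' ∧ ∀ a : Rn n × Rn n → ℂ, IsSymbol m ρ δ A a →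
      SymbolBounds m ρ δ A' (rescaledSymbol a) := by
  -- Dominates every exponent `|m - ρ k + s|` with `k ≤ n + 1` and `0 ≤ s ≤ 1`.
  set T : ℝ := |m| + (n + 2) with hT
  set S : ℝ := ∑ i : Fin n, ∑ k ∈ Finset.range (n + 2),
    (|A (Pi.single i k) 0| + n * ∑ l : Fin n, |A (Pi.single i k) (Pi.single l 1)|) with hS
  have hterm : ∀ (i : Fin n) (k : ℕ), 0 ≤ |A (Pi.single i k) 0| +
      n * ∑ l : Fin n, |A (Pi.single i k) (Pi.single l 1)| := fun i k => by
    have : 0 ≤ ∑ l : Fin n, |A (Pi.single i k) (Pi.single l 1)| :=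
      Finset.sum_nonneg fun l _ => abs_nonneg _
    positivity
  have hle : ∀ (i : Fin n) (k : ℕ), k ≤ n + 1 → |A (Pi.single i k) 0| +
      n * ∑ l : Fin n, |A (Pi.single i k) (Pi.single l 1)| ≤ S := fun i k hk => by
    have h1 := Finset.single_le_sum (f := fun k => |A (Pi.single i k) 0| +
      n * ∑ l : Fin n, |A (Pi.single i k) (Pi.single l 1)|) (fun k _ => hterm i k)
      (Finset.mem_range.2 (by omega : k < n + 2))
    exact h1.trans (Finset.single_le_sum (f := fun i => ∑ k ∈ Finset.range (n + 2),
      (|A (Pi.single i k) 0| + n * ∑ l : Fin n, |A (Pi.single i k) (Pi.single l 1)|))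
      (fun i _ => Finset.sum_nonneg fun k _ => hterm i k) (Finset.mem_univ i))
  have hS0 : 0 ≤ S := Finset.sum_nonneg fun i _ => Finset.sum_nonneg fun k _ => hterm i k
  set P : ℝ := (2 * Real.pi) ^ (n + 1) * 7 ^ T * S with hP
  have hpi1 : 1 ≤ 2 * Real.pi := by linarith [Real.pi_gt_three]
  refine ⟨P, by positivity, fun a ha => ?_⟩
  have hexp : ∀ (k : ℕ) (s : ℝ), k ≤ n + 1 → 0 ≤ s → s ≤ 1 → |m - ρ * k + s| ≤ T := by
    intro k s hk hs0 hs1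
    have hk' : (k : ℝ) ≤ n + 1 := by exact_mod_cast hk
    have h1 : 0 ≤ ρ * k := by positivity
    have h2 : ρ * k ≤ n + 1 := by nlinarith [k.cast_nonneg (α := ℝ)]
    have h3 := abs_le.1 (le_refl |m|)
    rw [hT, abs_le]
    constructor <;> linarith
  have hpow : ∀ (ξ : Rn n) (k : ℕ) (s : ℝ), (1 + ‖ξ‖) ^ (m - ρ * k + s) =
      (1 + ‖ξ‖) ^ (m + s) * ((1 + ‖ξ‖) ^ (-ρ)) ^ k := by
    intro ξ k s
    rw [← Real.rpow_natCast, ← Real.rpow_mul (by positivity), ← Real.rpow_add (by positivity)]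
    congr 1; ring
  have hDk : ∀ (i : Fin n) (k : ℕ), k ≤ n + 1 → ∀ x ξ,
      ‖(dirDeriv (EuclideanSpace.single i (1 : ℝ)))^[k] (rescaledSymbol a x) ξ‖ ≤
        P * (1 + ‖ξ‖) ^ m * ((1 + ‖ξ‖) ^ (-ρ)) ^ k := by
    intro i k hk x ξ
    have hb := ha.bound (Pi.single i k) 0 x ((2 * Real.pi) • ξ)
    -- The zero multi-index is written as a single one of order `0`, in the coordinate supplied by
    -- `0 < n`.
    have hX0 : derivX (0 : Fin n → ℕ) (derivXi (Pi.single i k) a) = derivXi (Pi.single i k) a := by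
      have := multiDeriv_single (fun i => ((EuclideanSpace.single i (1 : ℝ) : Rn n), (0 : Rn n)))
        ⟨0, hn⟩ 0 (derivXi (Pi.single i k) a)
      rwa [Pi.single_zero] at this
    have hm0 : multiOrder (0 : Fin n → ℕ) = 0 := by simp [multiOrder]
    rw [hX0, multiOrder_single, hm0, Nat.cast_zero, mul_zero] at hb
    rw [iterate_dirDeriv_rescaledSymbol ha.smooth, norm_mul, norm_pow, Complex.norm_real,
      Real.norm_of_nonneg Real.two_pi_pos.le]
    have hbr := bracket_rpow_le ξ (hexp k 0 hk le_rfl zero_le_one)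
    calc (2 * Real.pi) ^ k * ‖derivXi (Pi.single i k) a (x, (2 * Real.pi) • ξ)‖
        ≤ (2 * Real.pi) ^ (n + 1) * (|A (Pi.single i k) 0| *
            (7 ^ T * (1 + ‖ξ‖) ^ (m - ρ * k + 0))) := by
          gcongr
          refine hb.trans ?_
          have hbnn : 0 ≤ bracket ((2 * Real.pi) • ξ) ^ (m - ρ * k + 0) :=
            Real.rpow_nonneg (Real.sqrt_nonneg _) _
          exact mul_le_mul (le_abs_self _) hbr hbnn (abs_nonneg _)
      _ ≤ (2 * Real.pi) ^ (n + 1) * (S * (7 ^ T * (1 + ‖ξ‖) ^ (m - ρ * k + 0))) := by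
          gcongr
          refine le_trans ?_ (hle i k hk)
          have : 0 ≤ (n : ℝ) * ∑ l : Fin n, |A (Pi.single i k) (Pi.single l 1)| :=
            mul_nonneg n.cast_nonneg (Finset.sum_nonneg fun l _ => abs_nonneg _)
          linarith
      _ = _ := by rw [hpow, add_zero, hP]; ring
  have hbs : ContDiff ℝ ∞ fun p : Rn n × Rn n => rescaledSymbol a p.1 p.2 :=
    ha.smooth.comp (contDiff_fst.prodMk (contDiff_snd.const_smul (2 * Real.pi)))
  have hbx : ∀ x, ContDiff ℝ ∞ (rescaledSymbol a x) := fun x =>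
    hbs.comp (contDiff_const.prodMk contDiff_id : ContDiff ℝ ∞ fun ξ : Rn n => (x, ξ))
  have hSk : ∀ (i : Fin n) (k : ℕ), k ≤ n + 1 → ∀ x z ξ,
      ‖(dirDeriv (EuclideanSpace.single i (1 : ℝ)))^[k]
        (fun ξ => rescaledSymbol a x ξ - rescaledSymbol a z ξ) ξ‖ ≤
        P * ‖x - z‖ * (1 + ‖ξ‖) ^ (m + δ) * ((1 + ‖ξ‖) ^ (-ρ)) ^ k := by
    intro i k hk x z ξ
    rw [iterate_dirDeriv_sub (hbx x) (hbx z)]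
    simp only [iterate_dirDeriv_rescaledSymbol ha.smooth]
    rw [← mul_sub, norm_mul, norm_pow, Complex.norm_real, Real.norm_of_nonneg Real.two_pi_pos.le]
    have hbr := bracket_rpow_le ξ (hexp k δ hk hδ0 hδ1.le)
    set W := (1 + ‖ξ‖) ^ (m - ρ * k + δ) with hW
    have hsum0 : 0 ≤ ∑ l : Fin n, |A (Pi.single i k) (Pi.single l 1)| :=
      Finset.sum_nonneg fun l _ => abs_nonneg _
    have hlip := norm_sub_le_of_derivX (contDiff_derivXi_single ha.smooth i k)
      (ξ := (2 * Real.pi) • ξ)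
      (D := (∑ l : Fin n, |A (Pi.single i k) (Pi.single l 1)|) * (7 ^ T * W)) (fun l y => by
        have hb := ha.bound (Pi.single i k) (Pi.single l 1) y ((2 * Real.pi) • ξ)
        rw [multiOrder_single, multiOrder_single, Nat.cast_one, mul_one] at hb
        refine hb.trans ?_
        have hbnn : 0 ≤ bracket ((2 * Real.pi) • ξ) ^ (m - ρ * k + δ) :=
          Real.rpow_nonneg (Real.sqrt_nonneg _) _
        refine mul_le_mul ?_ hbr hbnn hsum0
        exact (le_abs_self _).trans (Finset.single_le_sum
          (f := fun l => |A (Pi.single i k) (Pi.single l 1)|) (fun _ _ => abs_nonneg _)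
          (Finset.mem_univ l))) (by positivity) x z
    calc (2 * Real.pi) ^ k * ‖derivXi (Pi.single i k) a (x, (2 * Real.pi) • ξ) -
          derivXi (Pi.single i k) a (z, (2 * Real.pi) • ξ)‖
        ≤ (2 * Real.pi) ^ (n + 1) * ((n * ∑ l : Fin n, |A (Pi.single i k) (Pi.single l 1)|) *
            (7 ^ T * W) * ‖x - z‖) := by
          gcongr
          refine hlip.trans (le_of_eq ?_)
          ring
      _ ≤ (2 * Real.pi) ^ (n + 1) * (S * (7 ^ T * W) * ‖x - z‖) := by
          gcongr
          refine le_trans ?_ (hle i k hk)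
          linarith [abs_nonneg (A (Pi.single i k) 0)]
      _ = _ := by rw [hW, hpow, hP]; ring
  refine ⟨hbs, fun x ξ => ⟨?_, fun i k hk => hDk i k hk x ξ⟩,
    fun x z ξ => ⟨?_, fun i k hk => hSk i k hk x z ξ⟩⟩
  · have := hDk ⟨0, hn⟩ 0 (by omega) x ξ
    rwa [pow_zero, mul_one] at this
  · have := hSk ⟨0, hn⟩ 0 (by omega) x z ξ
    rwa [pow_zero, mul_one] at this

/-- The substitution `ξ ↦ 2πξ`, whose Jacobian cancels `(2π)^{-n}`. -/
lemma pseudoDiff_eq_freqOp (a : Rn n × Rn n → ℂ) (u : 𝓢(Rn n, ℂ)) (x : Rn n) :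
    pseudoDiff a u x = freqOp (rescaledSymbol a x) u x := by
  have hF : ∀ ξ : Rn n, fourierHat u ((2 * Real.pi) • ξ) = 𝓕 (u : Rn n → ℂ) ξ := by
    intro ξ
    rw [fourierHat, Real.fourier_eq']
    refine integral_congr_ae (Filter.Eventually.of_forall fun y => ?_)
    simp only [smul_eq_mul, inner_smul_right]
    congr 2
    push_cast; ring
  set F : Rn n → ℂ := fun ξ =>
    Complex.exp (Complex.I * ((inner ℝ x ξ : ℝ) : ℂ)) * a (x, ξ) * fourierHat u ξ with hFdef
  have h := Measure.integral_comp_smul volume F (2 * Real.pi)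
  rw [finrank_euclideanSpace_fin, abs_of_pos (by positivity)] at h
  have h2 : ∫ ξ, F ((2 * Real.pi) • ξ) = freqOp (rescaledSymbol a x) u x := by
    rw [freqOp_eq_integral]
    refine integral_congr_ae (Filter.Eventually.of_forall fun ξ => ?_)
    simp only [hFdef, hF, rescaledSymbol, inner_smul_right, real_inner_comm ξ x]
    rw [← mul_assoc]
    congr 3
    ring
  rw [pseudoDiff, ← h2, h, Complex.real_smul]
  congr 1
  push_cast
  rw [one_div]

end SymbolConversion

/-! ### Almost orthogonality of slowly varying coefficients times dyadic blocks -/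

section AlmostOrthogonality

open LineDeriv ComplexConjugate

/-- The `L²` norm. -/
noncomputable def l2Norm {n : ℕ} (f : Rn n → ℂ) : ℝ≥0∞ := (∫⁻ x, ‖f x‖ₑ ^ 2) ^ (1 / 2 : ℝ)

variable {n : ℕ}

lemma l2Norm_sq (f : Rn n → ℂ) : l2Norm f ^ 2 = ∫⁻ x, ‖f x‖ₑ ^ 2 := by
  rw [l2Norm, ← ENNReal.rpow_natCast, ← ENNReal.rpow_mul]
  norm_num

lemma lintegral_enorm_mul_le {f g : Rn n → ℂ} (hf : AEStronglyMeasurable f)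
    (hg : AEStronglyMeasurable g) : ∫⁻ x, ‖f x‖ₑ * ‖g x‖ₑ ≤ l2Norm f * l2Norm g := by
  have h := ENNReal.lintegral_mul_le_Lp_mul_Lq volume (p := 2) (q := 2)
    (Real.holderConjugate_iff.2 ⟨by norm_num, by norm_num⟩) hf.enorm hg.enorm
  simp only [Pi.mul_apply, ENNReal.rpow_two] at h
  exact h

lemma enorm_le_ofReal {z : ℂ} {B : ℝ} (h : ‖z‖ ≤ B) : ‖z‖ₑ ≤ ENNReal.ofReal B := by
  rw [← ofReal_norm]; exact ENNReal.ofReal_le_ofReal h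

lemma SchwartzMap.exists_norm_le (W : 𝓢(Rn n, ℂ)) : ∃ C, ∀ x, ‖W x‖ ≤ C := by
  obtain ⟨C, _, hC⟩ := W.decay 0 0
  exact ⟨C, fun x => by simpa using hC x⟩

lemma coe_lineDerivOp (v : Rn n) (W : 𝓢(Rn n, ℂ)) : ((∂_{v} W : 𝓢(Rn n, ℂ)) : Rn n → ℂ) = dirDeriv v W := by
  ext x; rw [SchwartzMap.lineDerivOp_apply_eq_fderiv]; rfl

/-- Integration by parts takes the derivative off `Q` and lets it fall on `c`, `c'` or `W`;
Cauchy–Schwarz then handles each term. -/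
lemma enorm_integral_mul_dirDeriv_le {c c' : Rn n → ℂ} {B D D' : ℝ} {v : Rn n}
    (hc : Differentiable ℝ c) (hc' : Differentiable ℝ c') (hB : ∀ x, ‖c x‖ ≤ B)
    (hB' : ∀ x, ‖c' x‖ ≤ B) (hD : ∀ x, ‖fderiv ℝ c x v‖ ≤ D) (hD' : ∀ x, ‖fderiv ℝ c' x v‖ ≤ D')
    (W Q : 𝓢(Rn n, ℂ)) :
    ‖∫ x, conj (c x * W x) * c' x * dirDeriv v Q x‖ₑ ≤
      (ENNReal.ofReal (B * D + B * D') * l2Norm W + ENNReal.ofReal (B * B) * l2Norm (dirDeriv v W)) *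
        l2Norm Q := by
  have hB0 : 0 ≤ B := (norm_nonneg _).trans (hB 0)
  have hD0 : 0 ≤ D := (norm_nonneg _).trans (hD 0)
  have hD0' : 0 ≤ D' := (norm_nonneg _).trans (hD' 0)
  obtain ⟨CW, hCW⟩ := W.exists_norm_le
  obtain ⟨CW', hCW'⟩ := (∂_{v} W : 𝓢(Rn n, ℂ)).exists_norm_le
  rw [coe_lineDerivOp] at hCW'
  set g : Rn n → ℂ := fun x => conj (c x * W x) * c' x with hg
  have hgd : ∀ x, HasFDerivAt g (conj (c x * W x) • fderiv ℝ c' x + c' x •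
      ((Complex.conjCLE : ℂ →L[ℝ] ℂ).comp (c x • fderiv ℝ W x + W x • fderiv ℝ c x))) x := by
    intro x
    have h1 : HasFDerivAt (fun x => c x * W x) (c x • fderiv ℝ W x + W x • fderiv ℝ c x) x :=
      (hc x).hasFDerivAt.mul (W.differentiable x).hasFDerivAt
    have h2 : HasFDerivAt (fun x => conj (c x * W x))
        ((Complex.conjCLE : ℂ →L[ℝ] ℂ).comp (c x • fderiv ℝ W x + W x • fderiv ℝ c x)) x :=
      (Complex.conjCLE : ℂ →L[ℝ] ℂ).hasFDerivAt.comp x h1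
    exact h2.mul (hc' x).hasFDerivAt
  have hgv : ∀ x, fderiv ℝ g x v = conj (c x * W x) * fderiv ℝ c' x v +
      c' x * conj (c x * fderiv ℝ W x v + W x * fderiv ℝ c x v) := by
    intro x
    rw [(hgd x).fderiv]
    simp only [add_apply, smul_apply, ContinuousLinearMap.comp_apply, smul_eq_mul]
    simp
  have hgcont : Continuous g := continuous_iff_continuousAt.2 fun x => (hgd x).continuousAt
  have hgbd : ∀ x, ‖g x‖ ≤ B * CW * B := by
    intro x
    simp only [hg, norm_mul, RCLike.norm_conj]
    have := hB x; have := hB' x; have := hCW x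
    gcongr
    exact mul_nonneg hB0 ((norm_nonneg _).trans this)
  have hgvle : ∀ x, ‖fderiv ℝ g x v‖ ≤ (B * D + B * D') * ‖W x‖ + B * B * ‖dirDeriv v W x‖ := by
    intro x
    rw [hgv]
    have h1 := hB x; have h2 := hB' x; have h3 := hD x; have h4 := hD' x
    calc _ ≤ ‖c x‖ * ‖W x‖ * ‖fderiv ℝ c' x v‖ +
          ‖c' x‖ * (‖c x‖ * ‖dirDeriv v W x‖ + ‖W x‖ * ‖fderiv ℝ c x v‖) := by
          refine (norm_add_le _ _).trans ?_
          rw [norm_mul, norm_mul, RCLike.norm_conj, RCLike.norm_conj, norm_mul]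
          gcongr
          refine (norm_add_le _ _).trans ?_
          rw [norm_mul, norm_mul]; rfl
      _ ≤ B * ‖W x‖ * D' + B * (B * ‖dirDeriv v W x‖ + ‖W x‖ * D) := by gcongr
      _ = _ := by ring
  have hgvm : Measurable fun x => fderiv ℝ g x v := measurable_fderiv_apply_const ℝ g v
  have hgvbd : ∀ x, ‖fderiv ℝ g x v‖ ≤ (B * D + B * D') * CW + B * B * CW' := fun x =>
    (hgvle x).trans (by have := hCW x; have := hCW' x; gcongr)
  have hQ : Integrable (Q : Rn n → ℂ) := Q.integrable
  have hQ' : Integrable fun x => fderiv ℝ Q x v := by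
    have := (∂_{v} Q : 𝓢(Rn n, ℂ)).integrable (μ := volume)
    rwa [coe_lineDerivOp] at this
  have key : ∫ x, g x * fderiv ℝ Q x v = -∫ x, fderiv ℝ g x v * Q x := by
    refine integral_mul_fderiv_eq_neg_fderiv_mul_of_integrable
      (hQ.bdd_mul hgvm.aestronglyMeasurable (Filter.Eventually.of_forall hgvbd))
      (hQ'.bdd_mul hgcont.aestronglyMeasurable (Filter.Eventually.of_forall hgbd))
      (hQ.bdd_mul hgcont.aestronglyMeasurable (Filter.Eventually.of_forall hgbd))
      (fun x _ => (hgd x).differentiableAt) (fun x _ => Q.differentiable x)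
  change ‖∫ x, g x * fderiv ℝ Q x v‖ₑ ≤ _
  rw [key, enorm_neg]
  have hdWc : Continuous (dirDeriv v W) := by
    rw [← coe_lineDerivOp]; exact (∂_{v} W : 𝓢(Rn n, ℂ)).continuous
  calc ‖∫ x, fderiv ℝ g x v * Q x‖ₑ ≤ ∫⁻ x, ‖fderiv ℝ g x v * Q x‖ₑ :=
        enorm_integral_le_lintegral_enorm _
    _ ≤ ∫⁻ x, (ENNReal.ofReal (B * D + B * D') * (‖W x‖ₑ * ‖Q x‖ₑ) +
          ENNReal.ofReal (B * B) * (‖dirDeriv v W x‖ₑ * ‖Q x‖ₑ)) := by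
        refine lintegral_mono fun x => ?_
        rw [enorm_mul, ← mul_assoc, ← mul_assoc, ← add_mul]
        gcongr
        refine (enorm_le_ofReal (hgvle x)).trans_eq ?_
        rw [ENNReal.ofReal_add (by positivity) (by positivity), ENNReal.ofReal_mul (by positivity),
          ENNReal.ofReal_mul (by positivity), ofReal_norm, ofReal_norm]
    _ = ENNReal.ofReal (B * D + B * D') * (∫⁻ x, ‖W x‖ₑ * ‖Q x‖ₑ) +
          ENNReal.ofReal (B * B) * ∫⁻ x, ‖dirDeriv v W x‖ₑ * ‖Q x‖ₑ := by
        rw [lintegral_add_left, lintegral_const_mul' _ _ ENNReal.ofReal_ne_top,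
          lintegral_const_mul' _ _ ENNReal.ofReal_ne_top]
        exact (W.continuous.enorm.measurable.mul Q.continuous.enorm.measurable).const_mul _
    _ ≤ ENNReal.ofReal (B * D + B * D') * (l2Norm W * l2Norm Q) +
          ENNReal.ofReal (B * B) * (l2Norm (dirDeriv v W) * l2Norm Q) := by
        gcongr
        · exact lintegral_enorm_mul_le W.continuous.aestronglyMeasurable
            Q.continuous.aestronglyMeasurable
        · exact lintegral_enorm_mul_le hdWc.aestronglyMeasurable Q.continuous.aestronglyMeasurable
    _ = _ := by ring

/-- Frequency-localised data: `W j` lives at frequency `2 ^ j` and has size `p j`. -/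
structure IsDyadicFamily (K : ℝ) (p : ℕ → ℝ≥0∞) (W : ℕ → 𝓢(Rn n, ℂ)) : Prop where
  norm_le : ∀ j, l2Norm (W j) ≤ p j
  deriv_le : ∀ j l, l2Norm (dirDeriv (EuclideanSpace.single l (1 : ℝ)) (W j)) ≤
    ENNReal.ofReal (K * 2 ^ j) * p j
  exists_div : ∀ k, 2 ≤ k → ∃ Q : Fin n → 𝓢(Rn n, ℂ),
    (∀ l, l2Norm (Q l) ≤ ENNReal.ofReal (K * (2 ^ k)⁻¹) * p k) ∧
    ∀ x, W k x = ∑ l, dirDeriv (EuclideanSpace.single l (1 : ℝ)) (Q l) x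

/-- Bounded coefficients that oscillate at frequency at most `2 ^ (δ j)`. -/
structure IsCoeffFamily (δ B : ℝ) (c : ℕ → Rn n → ℂ) : Prop where
  differentiable : ∀ j, Differentiable ℝ (c j)
  norm_le : ∀ j x, ‖c j x‖ ≤ B
  deriv_le : ∀ j l x, ‖fderiv ℝ (c j) x (EuclideanSpace.single l (1 : ℝ))‖ ≤ B * ((2 : ℝ) ^ j) ^ δ

lemma l2Norm_coeff_mul_le {c : Rn n → ℂ} {B : ℝ} (hB : ∀ x, ‖c x‖ ≤ B) (W : Rn n → ℂ) :
    l2Norm (fun x => c x * W x) ≤ ENNReal.ofReal B * l2Norm W := by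
  have : l2Norm (fun x => c x * W x) ^ 2 ≤ (ENNReal.ofReal B * l2Norm W) ^ 2 := by
    rw [mul_pow, l2Norm_sq, l2Norm_sq, ← lintegral_const_mul' _ _ (by simp)]
    refine lintegral_mono fun x => ?_
    rw [enorm_mul, mul_pow]
    gcongr
    exact enorm_le_ofReal (hB x)
  exact (ENNReal.pow_le_pow_left_iff two_ne_zero).1 this

/-- The higher-frequency factor is a divergence of functions smaller by `2^{-k}`. After integration
by parts the derivative costs `2^{δk}` on a coefficient and `2^j` on `W j`, so the pairing is of
relative size `2^{-(1-δ)k} + 2^{j-k}`, at most a multiple of `r^{k-j}` with `r = 2^{-(1-δ)}`. For `k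
< 2` there is no divergence form, but then `k - j ≤ 1` and plain Cauchy–Schwarz is enough, as `r ≥
1/2`. -/
lemma enorm_pairing_le {K δ B : ℝ} (hK : 0 ≤ K) (hδ0 : 0 ≤ δ) (hδ1 : δ < 1) {p : ℕ → ℝ≥0∞}
    {W : ℕ → 𝓢(Rn n, ℂ)} (hW : IsDyadicFamily K p W) {c : ℕ → Rn n → ℂ}
    (hc : IsCoeffFamily δ B c) {j k : ℕ} (hjk : j ≤ k) :
    ‖∫ x, conj (c j x * W j x) * (c k x * W k x)‖ₑ ≤
      ENNReal.ofReal ((2 + n * (K * (2 + K))) * B ^ 2 * ((1 / 2 : ℝ) ^ (1 - δ)) ^ (k - j)) *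
        (p j * p k) := by
  have hB0 : 0 ≤ B := (norm_nonneg _).trans (hc.norm_le 0 0)
  set r : ℝ := (1 / 2 : ℝ) ^ (1 - δ) with hr
  have hr0 : 0 < r := by positivity
  have hr2 : 1 / 2 ≤ r := by
    calc (1 / 2 : ℝ) = (1 / 2) ^ (1 : ℝ) := (Real.rpow_one _).symm
      _ ≤ r := Real.rpow_le_rpow_of_exponent_ge (by norm_num) (by norm_num) (by linarith)
  have hr1 : r ≤ 1 := Real.rpow_le_one (by norm_num) (by norm_num) (by linarith)
  have hcont : ∀ j, Continuous fun x => c j x * W j x := fun j =>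
    (hc.differentiable j).continuous.mul (W j).continuous
  rcases Nat.lt_or_ge k 2 with hk | hk
  · calc ‖∫ x, conj (c j x * W j x) * (c k x * W k x)‖ₑ
        ≤ ∫⁻ x, ‖c j x * W j x‖ₑ * ‖c k x * W k x‖ₑ := by
          refine (enorm_integral_le_lintegral_enorm _).trans_eq ?_
          refine lintegral_congr fun x => ?_
          rw [enorm_mul, ← ofReal_norm (conj _), RCLike.norm_conj, ofReal_norm]
      _ ≤ (ENNReal.ofReal B * p j) * (ENNReal.ofReal B * p k) := by
          refine (lintegral_enorm_mul_le (hcont j).aestronglyMeasurable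
            (hcont k).aestronglyMeasurable).trans ?_
          gcongr
          · refine (l2Norm_coeff_mul_le (hc.norm_le j) _).trans ?_
            gcongr; exact hW.norm_le j
          · refine (l2Norm_coeff_mul_le (hc.norm_le k) _).trans ?_
            gcongr; exact hW.norm_le k
      _ = ENNReal.ofReal (B ^ 2) * (p j * p k) := by
          rw [ENNReal.ofReal_pow hB0]; ring
      _ ≤ _ := by
          gcongr
          have h1 : 1 / 2 ≤ r ^ (k - j) := by
            have : k - j ≤ 1 := by omega
            calc 1 / 2 ≤ r ^ 1 := by simpa using hr2
              _ ≤ r ^ (k - j) := pow_le_pow_of_le_one hr0.le hr1 this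
          have h2 : 0 ≤ n * (K * (2 + K)) := by positivity
          calc B ^ 2 = 2 * B ^ 2 * (1 / 2) := by ring
            _ ≤ (2 + n * (K * (2 + K))) * B ^ 2 * r ^ (k - j) := by gcongr; linarith
  · obtain ⟨Q, hQ, hdiv⟩ := hW.exists_div k hk
    have hg : ∀ l, Integrable fun x => conj (c j x * W j x) * c k x *
        dirDeriv (EuclideanSpace.single l (1 : ℝ)) (Q l) x := by
      intro l
      obtain ⟨CW, hCW⟩ := (W j).exists_norm_le
      refine Integrable.bdd_mul (c := B * CW * B) ?_ ?_ (Filter.Eventually.of_forall fun x => ?_)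
      · rw [← coe_lineDerivOp]; exact SchwartzMap.integrable _
      · exact ((Complex.continuous_conj.comp (hcont j)).mul
          (hc.differentiable k).continuous).aestronglyMeasurable
      · rw [norm_mul, RCLike.norm_conj, norm_mul]
        have h1 := hc.norm_le j x; have h2 := hc.norm_le k x; have h3 := hCW x
        gcongr
        exact mul_nonneg hB0 ((norm_nonneg _).trans h3)
    have e1 : ∫ x, conj (c j x * W j x) * (c k x * W k x) =
        ∑ l, ∫ x, conj (c j x * W j x) * c k x *
          dirDeriv (EuclideanSpace.single l (1 : ℝ)) (Q l) x := by
      rw [← integral_finsetSum _ fun l _ => hg l]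
      refine integral_congr_ae (Filter.Eventually.of_forall fun x => ?_)
      simp only
      rw [hdiv x, Finset.mul_sum, Finset.mul_sum]
      exact Finset.sum_congr rfl fun l _ => by ring
    have hkd : ((2 : ℝ) ^ k) ^ δ * (2 ^ k)⁻¹ ≤ r ^ (k - j) := by
      have : ((2 : ℝ) ^ k) ^ δ * (2 ^ k)⁻¹ = r ^ k := by
        rw [hr, ← Real.rpow_natCast, ← Real.rpow_natCast, ← Real.rpow_mul (by norm_num),
          ← Real.rpow_mul (by norm_num), one_div, Real.inv_rpow (by norm_num),
          ← Real.rpow_neg (by norm_num), ← Real.rpow_neg (by norm_num),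
          ← Real.rpow_add (by norm_num)]
        congr 1; ring
      rw [this]
      exact pow_le_pow_of_le_one hr0.le hr1 (Nat.sub_le _ _)
    have hjd : ((2 : ℝ) ^ j) ^ δ ≤ ((2 : ℝ) ^ k) ^ δ := by
      gcongr; norm_num
    have hjk2 : (2 : ℝ) ^ j * (2 ^ k)⁻¹ ≤ r ^ (k - j) := by
      have : (2 : ℝ) ^ j * (2 ^ k)⁻¹ = (1 / 2) ^ (k - j) := by
        obtain ⟨d, rfl⟩ := Nat.exists_eq_add_of_le hjk
        rw [Nat.add_sub_cancel_left, pow_add, one_div, inv_pow]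
        field_simp
      rw [this]
      gcongr
    rw [e1]
    calc ‖∑ l, ∫ x, conj (c j x * W j x) * c k x *
          dirDeriv (EuclideanSpace.single l (1 : ℝ)) (Q l) x‖ₑ
        ≤ ∑ l, ‖∫ x, conj (c j x * W j x) * c k x *
          dirDeriv (EuclideanSpace.single l (1 : ℝ)) (Q l) x‖ₑ := enorm_sum_le _ _
      _ ≤ ∑ _l : Fin n, ENNReal.ofReal ((K * (2 + K)) * B ^ 2 * r ^ (k - j)) * (p j * p k) := by
          refine Finset.sum_le_sum fun l _ => ?_
          refine (enorm_integral_mul_dirDeriv_le (hc.differentiable j) (hc.differentiable k)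
            (hc.norm_le j) (hc.norm_le k) (hc.deriv_le j l) (hc.deriv_le k l) (W j) (Q l)).trans ?_
          calc _ ≤ (ENNReal.ofReal (B * (B * ((2 : ℝ) ^ j) ^ δ) + B * (B * ((2 : ℝ) ^ k) ^ δ)) * p j +
                ENNReal.ofReal (B * B) * (ENNReal.ofReal (K * 2 ^ j) * p j)) *
                (ENNReal.ofReal (K * (2 ^ k)⁻¹) * p k) := by
                gcongr
                · exact hW.norm_le j
                · exact hW.deriv_le j l
                · exact hQ l
            _ = ENNReal.ofReal ((B * (B * ((2 : ℝ) ^ j) ^ δ) + B * (B * ((2 : ℝ) ^ k) ^ δ) +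
                B * B * (K * 2 ^ j)) * (K * (2 ^ k)⁻¹)) * (p j * p k) := by
                rw [ENNReal.ofReal_mul (q := K * (2 ^ k)⁻¹) (by positivity),
                  ENNReal.ofReal_add (q := B * B * (K * 2 ^ j)) (by positivity) (by positivity),
                  ENNReal.ofReal_mul (p := B * B) (by positivity)]
                ring
            _ ≤ _ := by
                refine mul_le_mul_left (ENNReal.ofReal_le_ofReal ?_) _
                calc (B * (B * ((2 : ℝ) ^ j) ^ δ) + B * (B * ((2 : ℝ) ^ k) ^ δ) +
                      B * B * (K * 2 ^ j)) * (K * (2 ^ k)⁻¹)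
                    ≤ (B * (B * ((2 : ℝ) ^ k) ^ δ) + B * (B * ((2 : ℝ) ^ k) ^ δ) +
                      B * B * (K * 2 ^ j)) * (K * (2 ^ k)⁻¹) := by gcongr
                  _ = B ^ 2 * K * (2 * (((2 : ℝ) ^ k) ^ δ * (2 ^ k)⁻¹) +
                      K * (2 ^ j * (2 ^ k)⁻¹)) := by ring
                  _ ≤ B ^ 2 * K * (2 * r ^ (k - j) + K * r ^ (k - j)) := by gcongr
                  _ = _ := by ring
      _ = ENNReal.ofReal (n * ((K * (2 + K)) * B ^ 2 * r ^ (k - j))) * (p j * p k) := by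
          rw [Finset.sum_const, Finset.card_univ, Fintype.card_fin, nsmul_eq_mul,
            ENNReal.ofReal_mul n.cast_nonneg, ENNReal.ofReal_natCast]
          ring
      _ ≤ _ := by
          refine mul_le_mul_left (ENNReal.ofReal_le_ofReal ?_) _
          have : 0 ≤ 2 * (B ^ 2 * r ^ (k - j)) := by positivity
          linarith

/-- With truncated subtraction the exponent is `|k - j|`. It is injective in `k` on either side of
`j`, whence two geometric series. -/
lemma sum_geometric_dist_le {r : ℝ} (hr0 : 0 ≤ r) (hr1 : r < 1) (F : Finset ℕ) (j : ℕ) :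
    ∑ k ∈ F, r ^ ((k - j) + (j - k)) ≤ 2 * (1 - r)⁻¹ := by
  have hsum := summable_geometric_of_lt_one hr0 hr1
  have aux : ∀ (G : Finset ℕ) (φ : ℕ → ℕ), Set.InjOn φ G → ∑ k ∈ G, r ^ φ k ≤ (1 - r)⁻¹ := by
    intro G φ hφ
    rw [← tsum_geometric_of_lt_one hr0 hr1, ← Finset.sum_image (f := fun i => r ^ i) hφ]
    exact hsum.sum_le_tsum _ fun i _ => pow_nonneg hr0 i
  rw [← Finset.sum_filter_add_sum_filter_not F (fun k => j ≤ k), two_mul]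
  gcongr
  · exact aux _ _ fun a ha b hb h => by
      simp only [Finset.coe_filter, Set.mem_ofPred_eq] at ha hb
      omega
  · exact aux _ _ fun a ha b hb h => by
      simp only [Finset.coe_filter, Set.mem_ofPred_eq] at ha hb
      omega

lemma integrable_pairing {δ B : ℝ} {W : ℕ → 𝓢(Rn n, ℂ)} {c : ℕ → Rn n → ℂ}
    (hc : IsCoeffFamily δ B c) (j k : ℕ) :
    Integrable fun x => conj (c j x * W j x) * (c k x * W k x) := by
  obtain ⟨CW, hCW⟩ := (W j).exists_norm_le
  have h1 : Integrable fun x => c k x * W k x :=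
    (W k).integrable.bdd_mul (hc.differentiable k).continuous.aestronglyMeasurable
      (Filter.Eventually.of_forall (hc.norm_le k))
  refine h1.bdd_mul (c := B * CW)
    (Complex.continuous_conj.comp ((hc.differentiable j).continuous.mul
      (W j).continuous)).aestronglyMeasurable (Filter.Eventually.of_forall fun x => ?_)
  rw [RCLike.norm_conj, norm_mul]
  exact mul_le_mul (hc.norm_le j x) (hCW x) (norm_nonneg _) ((norm_nonneg _).trans (hc.norm_le j x))

lemma enorm_pairing_le_dist {K δ B : ℝ} (hK : 0 ≤ K) (hδ0 : 0 ≤ δ) (hδ1 : δ < 1) {p : ℕ → ℝ≥0∞}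
    {W : ℕ → 𝓢(Rn n, ℂ)} (hW : IsDyadicFamily K p W) {c : ℕ → Rn n → ℂ}
    (hc : IsCoeffFamily δ B c) (j k : ℕ) :
    ‖∫ x, conj (c j x * W j x) * (c k x * W k x)‖ₑ ≤
      ENNReal.ofReal ((2 + n * (K * (2 + K))) * B ^ 2 *
        ((1 / 2 : ℝ) ^ (1 - δ)) ^ ((k - j) + (j - k))) * (p j * p k) := by
  rcases le_total j k with h | h
  · rw [Nat.sub_eq_zero_of_le h, add_zero]
    exact enorm_pairing_le hK hδ0 hδ1 hW hc h
  · rw [Nat.sub_eq_zero_of_le h, zero_add, mul_comm (p j)]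
    have : ∫ x, conj (c j x * W j x) * (c k x * W k x) =
        conj (∫ x, conj (c k x * W k x) * (c j x * W j x)) := by
      rw [← integral_conj]
      refine integral_congr_ae (Filter.Eventually.of_forall fun x => ?_)
      simp only [map_mul, Complex.conj_conj]
      ring
    rw [this, ← ofReal_norm, RCLike.norm_conj, ofReal_norm]
    exact enorm_pairing_le hK hδ0 hδ1 hW hc h

lemma lintegral_sum_sq_le_sum_pairing (φ : ℕ → Rn n → ℂ)
    (hint : ∀ j k, Integrable fun x => conj (φ j x) * φ k x) (F : Finset ℕ) :
    ∫⁻ x, ‖∑ j ∈ F, φ j x‖ₑ ^ 2 ≤ ∑ j ∈ F, ∑ k ∈ F, ‖∫ x, conj (φ j x) * φ k x‖ₑ := by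
  have hexpand : ∀ x, (‖∑ j ∈ F, φ j x‖ ^ 2 : ℝ) =
      (∑ j ∈ F, ∑ k ∈ F, conj (φ j x) * φ k x).re := by
    intro x
    rw [← Finset.sum_mul_sum, ← map_sum, mul_comm, Complex.mul_conj, Complex.ofReal_re,
      Complex.normSq_eq_norm_sq]
  have hsumint : Integrable fun x => ∑ j ∈ F, ∑ k ∈ F, conj (φ j x) * φ k x :=
    integrable_finsetSum _ fun j _ => integrable_finsetSum _ fun k _ => hint j k
  have hre : Integrable fun x => (∑ j ∈ F, ∑ k ∈ F, conj (φ j x) * φ k x).re := hsumint.re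
  calc ∫⁻ x, ‖∑ j ∈ F, φ j x‖ₑ ^ 2
      = ENNReal.ofReal (∫ x, (∑ j ∈ F, ∑ k ∈ F, conj (φ j x) * φ k x).re) := by
        rw [ofReal_integral_eq_lintegral_ofReal hre]
        · refine lintegral_congr fun x => ?_
          rw [← ofReal_norm, ← ENNReal.ofReal_pow (norm_nonneg _), hexpand]
        · exact Filter.Eventually.of_forall fun x => by
            simp only [Pi.zero_apply]; rw [← hexpand]; positivity
    _ ≤ ‖∫ x, ∑ j ∈ F, ∑ k ∈ F, conj (φ j x) * φ k x‖ₑ := by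
        have : ∫ x, (∑ j ∈ F, ∑ k ∈ F, conj (φ j x) * φ k x).re =
            (∫ x, ∑ j ∈ F, ∑ k ∈ F, conj (φ j x) * φ k x).re :=
          integral_re hsumint
        rw [this, ← ofReal_norm]
        exact ENNReal.ofReal_le_ofReal (Complex.re_le_norm _)
    _ ≤ ∑ j ∈ F, ∑ k ∈ F, ‖∫ x, conj (φ j x) * φ k x‖ₑ := by
        rw [integral_finsetSum _ fun j _ => integrable_finsetSum _ fun k _ => hint j k]
        refine (enorm_sum_le _ _).trans (Finset.sum_le_sum fun j _ => ?_)
        rw [integral_finsetSum _ fun k _ => hint j k]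
        exact enorm_sum_le _ _

/-- Almost orthogonality of the pieces `c j * W j`. -/
lemma lintegral_sum_sq_le {K δ B : ℝ} (hK : 0 ≤ K) (hδ0 : 0 ≤ δ) (hδ1 : δ < 1) {p : ℕ → ℝ≥0∞}
    {W : ℕ → 𝓢(Rn n, ℂ)} (hW : IsDyadicFamily K p W) {c : ℕ → Rn n → ℂ}
    (hc : IsCoeffFamily δ B c) (F : Finset ℕ) :
    ∫⁻ x, ‖∑ j ∈ F, c j x * W j x‖ₑ ^ 2 ≤
      ENNReal.ofReal ((2 + n * (K * (2 + K))) * B ^ 2 * (4 * (1 - (1 / 2 : ℝ) ^ (1 - δ))⁻¹)) *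
        ∑ j ∈ F, p j ^ 2 := by
  have hpair := enorm_pairing_le_dist hK hδ0 hδ1 hW hc
  set r : ℝ := (1 / 2 : ℝ) ^ (1 - δ) with hr
  have hr0 : 0 ≤ r := by positivity
  have hr1 : r < 1 := Real.rpow_lt_one (by norm_num) (by norm_num) (by linarith)
  set D : ℝ := (2 + n * (K * (2 + K))) * B ^ 2 with hD
  have hD0 : 0 ≤ D := by positivity
  refine (lintegral_sum_sq_le_sum_pairing _ (integrable_pairing hc) F).trans ?_
  have hrow : ∀ j, ∑ k ∈ F, ENNReal.ofReal (D * r ^ ((k - j) + (j - k))) ≤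
      ENNReal.ofReal (D * (2 * (1 - r)⁻¹)) := by
    intro j
    rw [← ENNReal.ofReal_sum_of_nonneg fun k _ => by positivity, ← Finset.mul_sum]
    gcongr
    exact sum_geometric_dist_le hr0 hr1 F j
  set E : ℕ → ℕ → ℝ≥0∞ := fun j k => ENNReal.ofReal (D * r ^ ((k - j) + (j - k))) with hE
  have hEsymm : ∀ j k, E j k = E k j := fun j k => by simp only [hE, add_comm]
  -- Schur's test: `p j * p k ≤ p j ^ 2 + p k ^ 2`, and the matrix `E` is symmetric with bounded row
  -- sums.
  calc _ ≤ ∑ j ∈ F, ∑ k ∈ F, (E j k * p j ^ 2 + E j k * p k ^ 2) := by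
        refine Finset.sum_le_sum fun j _ => Finset.sum_le_sum fun k _ => (hpair j k).trans ?_
        rw [← mul_add]
        refine mul_le_mul_right ?_ _
        rcases le_total (p j) (p k) with h | h
        · calc p j * p k ≤ p k * p k := by gcongr
            _ ≤ _ := by rw [← sq]; exact le_add_self
        · calc p j * p k ≤ p j * p j := by gcongr
            _ ≤ _ := by rw [← sq]; exact le_self_add
    _ = ∑ j ∈ F, 2 * ((∑ k ∈ F, E j k) * p j ^ 2) := by
        simp only [Finset.sum_add_distrib]
        rw [Finset.sum_comm (f := fun j k => E j k * p k ^ 2), ← Finset.sum_add_distrib]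
        refine Finset.sum_congr rfl fun j _ => ?_
        rw [← Finset.sum_mul, ← Finset.sum_mul, two_mul, Finset.sum_congr rfl fun k _ => hEsymm k j]
    _ ≤ ∑ j ∈ F, 2 * (ENNReal.ofReal (D * (2 * (1 - r)⁻¹)) * p j ^ 2) := by
        gcongr with j
        exact hrow j
    _ = _ := by
        rw [Finset.mul_sum]
        refine Finset.sum_congr rfl fun j _ => ?_
        rw [← mul_assoc, ← ENNReal.ofReal_ofNat, ← ENNReal.ofReal_mul (by norm_num)]
        congr 2; ring

end AlmostOrthogonality

/-! ### Littlewood–Paley blocks of a Schwartz function form a dyadic family -/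

section DyadicFamily

open FourierTransform LineDeriv

variable {n : ℕ}

lemma l2Norm_le_of_sq_le {f : Rn n → ℂ} {p : ℝ≥0∞} (h : ∫⁻ x, ‖f x‖ₑ ^ 2 ≤ p ^ 2) :
    l2Norm f ≤ p := by
  rw [← l2Norm_sq] at h
  exact (ENNReal.pow_le_pow_left_iff two_ne_zero).1 h

lemma l2Norm_fourier (g : 𝓢(Rn n, ℂ)) : l2Norm (𝓕 (g : Rn n → ℂ)) = l2Norm g := by
  rw [l2Norm, l2Norm, lintegral_enorm_sq_fourier]

/-- The `L²` mass of `f` on `S`. -/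
noncomputable def l2Mass (S : Set (Rn n)) (f : Rn n → ℂ) : ℝ≥0∞ :=
  (∫⁻ ξ in S, ‖f ξ‖ₑ ^ 2) ^ (1 / 2 : ℝ)

lemma l2Mass_sq (S : Set (Rn n)) (f : Rn n → ℂ) : l2Mass S f ^ 2 = ∫⁻ ξ in S, ‖f ξ‖ₑ ^ 2 := by
  rw [l2Mass, ← ENNReal.rpow_natCast, ← ENNReal.rpow_mul]
  norm_num

lemma l2Norm_le_l2Mass {f g : Rn n → ℂ} {S : Set (Rn n)} (hS : MeasurableSet S) {B : ℝ}
    (h0 : ∀ ξ, ξ ∉ S → f ξ = 0) (h : ∀ ξ ∈ S, ‖f ξ‖ ≤ B * ‖g ξ‖) :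
    l2Norm f ≤ ENNReal.ofReal B * l2Mass S g := by
  refine l2Norm_le_of_sq_le ?_
  rw [mul_pow, l2Mass_sq, ← lintegral_const_mul' _ _ (by simp), ← lintegral_indicator hS]
  refine lintegral_mono fun ξ => ?_
  by_cases hξ : ξ ∈ S
  · rw [Set.indicator_of_mem hξ, ← mul_pow]
    gcongr
    rw [← ofReal_norm (g ξ), ← ENNReal.ofReal_mul' (norm_nonneg _)]
    exact enorm_le_ofReal (h ξ hξ)
  · simp [h0 ξ hξ]

/-- A cutoff equal to one on the `j`-th dyadic shell. -/
noncomputable def fatCut (j : ℕ) (ξ : Rn n) : ℂ :=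
  lowCut (j + 1) ξ - if 2 ≤ j then lowCut (j - 2) ξ else 0

/-- The frequencies that `fatCut j` sees. -/
def fatShell (n j : ℕ) : Set (Rn n) := {ξ | ‖ξ‖ ≤ 4 * 2 ^ j ∧ (2 ≤ j → 2 ^ j ≤ 4 * ‖ξ‖)}

lemma measurableSet_fatShell (j : ℕ) : MeasurableSet (fatShell n j) := by
  refine ((isClosed_le continuous_norm continuous_const).inter ?_).measurableSet
  by_cases hj : 2 ≤ j
  · simp only [hj, forall_const]
    exact isClosed_le continuous_const (continuous_const.mul continuous_norm)
  · simp only [hj, false_imp_iff]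
    exact isClosed_univ

lemma contDiff_fatCut (j : ℕ) : ContDiff ℝ ∞ (fatCut j : Rn n → ℂ) := by
  unfold fatCut
  split_ifs
  · exact (contDiff_lowCut _).sub (contDiff_lowCut _)
  · exact (contDiff_lowCut _).sub contDiff_const

lemma norm_fatCut_le (j : ℕ) (ξ : Rn n) : ‖fatCut j ξ‖ ≤ 2 := by
  have h1 := norm_lowCut_le (j + 1) ξ
  rw [fatCut]
  split_ifs
  · have h2 := norm_lowCut_le (j - 2) ξ
    linarith [norm_sub_le (lowCut (j + 1) ξ) (lowCut (j - 2) ξ)]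
  · rw [sub_zero]; linarith

lemma four_mul_two_pow_sub {j : ℕ} (hj : 2 ≤ j) : (4 : ℝ) * 2 ^ (j - 2) = 2 ^ j := by
  obtain ⟨k, rfl⟩ := Nat.exists_eq_add_of_le hj
  rw [Nat.add_sub_cancel_left, pow_add]; norm_num

lemma fatCut_eq_zero_of_lt {j : ℕ} {ξ : Rn n} (h : 4 * 2 ^ j < ‖ξ‖) : fatCut j ξ = 0 := by
  have h0 : (0 : ℝ) < 2 ^ j := by positivity
  rw [fatCut, lowCut_eq_zero (by rw [pow_succ]; linarith)]
  split_ifs with hj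
  · have := four_mul_two_pow_sub hj
    rw [lowCut_eq_zero (by linarith), sub_zero]
  · simp

lemma fatCut_eq_zero_of_gt {j : ℕ} (hj : 2 ≤ j) {ξ : Rn n} (h : 4 * ‖ξ‖ < 2 ^ j) :
    fatCut j ξ = 0 := by
  have := four_mul_two_pow_sub hj
  have h0 : (0 : ℝ) < 2 ^ j := by positivity
  rw [fatCut, if_pos hj, lowCut_eq_one (by rw [pow_succ]; linarith [norm_nonneg ξ]),
    lowCut_eq_one (by linarith), sub_self]

lemma fatCut_eq_zero {j : ℕ} {ξ : Rn n} (h : ξ ∉ fatShell n j) : fatCut j ξ = 0 := by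
  rw [fatShell, Set.mem_ofPred_eq, not_and_or, not_le, Classical.not_imp, not_le] at h
  rcases h with h | h
  · exact fatCut_eq_zero_of_lt h
  · exact fatCut_eq_zero_of_gt h.1 h.2

lemma fatCut_eq_one {j : ℕ} {ξ : Rn n} (h : InShell j ξ) : fatCut j ξ = 1 := by
  rw [fatCut, lowCut_eq_one (by rw [pow_succ]; linarith [h.1])]
  split_ifs with hj
  · have := four_mul_two_pow_sub hj
    have h2 := h.2.resolve_left (by omega)
    rw [lowCut_eq_zero (by linarith), sub_zero]
  · rw [sub_zero]

/-- If `m` is the least index `≥ 2` whose shell contains `ξ`, any other such `k` satisfies `2^k ≤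
4‖ξ‖ ≤ 16 · 2^m`. This leaves five indices, besides `0` and `1`. -/
lemma card_filter_mem_fatShell_le (F : Finset ℕ) (ξ : Rn n) [DecidablePred fun j => ξ ∈ fatShell n j] :
    (F.filter fun j => ξ ∈ fatShell n j).card ≤ 7 := by
  classical
  by_cases hex : ∃ j, 2 ≤ j ∧ ξ ∈ fatShell n j
  · set m := Nat.find hex with hm
    have hmin := Nat.find_spec hex
    rw [← hm] at hmin
    have hsub : (F.filter fun j => ξ ∈ fatShell n j) ⊆ Finset.range 2 ∪ Finset.Icc m (m + 4) := by
      intro k hk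
      rw [Finset.mem_filter] at hk
      rw [Finset.mem_union, Finset.mem_range, Finset.mem_Icc]
      by_cases hk2 : k < 2
      · exact Or.inl hk2
      · refine Or.inr ⟨Nat.find_min' hex ⟨by omega, hk.2⟩, ?_⟩
        have h1 := hk.2.2 (by omega)
        have h2 := hmin.2.1
        have h3 : (2 : ℝ) ^ k ≤ 2 ^ (m + 4) := by
          rw [pow_add]; linarith
        exact (pow_le_pow_iff_right₀ (by norm_num)).1 h3
    refine (Finset.card_le_card hsub).trans ((Finset.card_union_le _ _).trans ?_)
    simp
    omega
  · push Not at hex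
    have hsub : (F.filter fun j => ξ ∈ fatShell n j) ⊆ Finset.range 2 := by
      intro k hk
      rw [Finset.mem_filter] at hk
      rw [Finset.mem_range]
      by_contra h
      exact hex k (by omega) hk.2
    exact (Finset.card_le_card hsub).trans (by simp)

lemma sum_l2Mass_sq_le (F : Finset ℕ) (u : 𝓢(Rn n, ℂ)) :
    ∑ j ∈ F, l2Mass (fatShell n j) (𝓕 (u : Rn n → ℂ)) ^ 2 ≤ 7 * ∫⁻ x, ‖u x‖ₑ ^ 2 := by
  classical
  have hm : Measurable fun ξ => ‖𝓕 (u : Rn n → ℂ) ξ‖ₑ ^ 2 :=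
    (𝓕 u).continuous.enorm.measurable.pow_const 2
  simp only [l2Mass_sq, ← lintegral_indicator (measurableSet_fatShell _)]
  rw [← lintegral_finsetSum _ fun j _ => hm.indicator (measurableSet_fatShell j),
    ← lintegral_enorm_sq_fourier u, ← lintegral_const_mul _ hm]
  refine lintegral_mono fun ξ => ?_
  simp only [Set.indicator_apply]
  rw [← Finset.sum_filter, Finset.sum_const, nsmul_eq_mul]
  gcongr
  exact_mod_cast card_filter_mem_fatShell_le F ξ

lemma hasCompactSupport_fatCut (j : ℕ) : HasCompactSupport (fatCut j : Rn n → ℂ) := by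
  refine HasCompactSupport.intro (isCompact_closedBall (0 : Rn n) (4 * 2 ^ j)) fun ξ hξ => ?_
  rw [mem_closedBall_zero_iff, not_le] at hξ
  exact fatCut_eq_zero_of_lt hξ

/-- `fatCut j` as a Schwartz function. -/
noncomputable def fatCutSchwartz (n j : ℕ) : 𝓢(Rn n, ℂ) :=
  (hasCompactSupport_fatCut j).toSchwartzMap (contDiff_fatCut j)

lemma coe_fatCutSchwartz (j : ℕ) : (fatCutSchwartz n j : Rn n → ℂ) = fatCut j := rfl

/-- The multiplier `ξ_l |ξ|⁻² / (2 π i)` localised to a dyadic shell away from the origin. -/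
noncomputable def divCut (k : ℕ) (l : Fin n) (ξ : Rn n) : ℂ :=
  ((ξ l * (‖ξ‖ ^ 2)⁻¹ : ℝ) : ℂ) * ((2 * Real.pi * Complex.I)⁻¹ * fatCut k ξ)

/-- For `k ≥ 2` the cutoff vanishes near the origin and hides the singularity of `|ξ|⁻²`; this is
why divergence forms are asked for only from `k = 2` on. -/
lemma contDiff_divCut {k : ℕ} (hk : 2 ≤ k) (l : Fin n) : ContDiff ℝ ∞ (divCut k l) := by
  rw [contDiff_iff_contDiffAt]
  intro ξ
  by_cases hξ : ξ = 0
  · have : divCut k l =ᶠ[nhds ξ] fun _ => 0 := by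
      have h0 : 4 * ‖ξ‖ < 2 ^ k := by rw [hξ, norm_zero, mul_zero]; positivity
      filter_upwards [(isOpen_lt (continuous_const.mul continuous_norm) continuous_const).mem_nhds h0]
        with y hy
      rw [divCut, fatCut_eq_zero_of_gt hk hy, mul_zero, mul_zero]
    exact contDiffAt_const.congr_of_eventuallyEq this
  · have h1 : ContDiffAt ℝ ∞ (fun ξ : Rn n => ξ l * (‖ξ‖ ^ 2)⁻¹) ξ := by
      refine ContDiffAt.mul ?_ (ContDiffAt.inv (contDiff_norm_sq ℝ).contDiffAt (by simpa using hξ))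
      exact (EuclideanSpace.proj l : Rn n →L[ℝ] ℝ).contDiff.contDiffAt
    have h2 := Complex.ofRealCLM.contDiff.contDiffAt.comp (n := ∞) ξ h1
    exact h2.mul (contDiffAt_const.mul (contDiff_fatCut k).contDiffAt)

lemma hasCompactSupport_divCut (k : ℕ) (l : Fin n) : HasCompactSupport (divCut k l) := by
  have : HasCompactSupport fun ξ : Rn n => (2 * Real.pi * Complex.I)⁻¹ * fatCut k ξ :=
    (hasCompactSupport_fatCut k).mul_left
  exact this.mul_left

lemma abs_apply_le_norm (ξ : Rn n) (l : Fin n) : |ξ l| ≤ ‖ξ‖ := PiLp.norm_apply_le ξ l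

lemma norm_divCut_le {k : ℕ} (hk : 2 ≤ k) (l : Fin n) {ξ : Rn n} (hξ : ξ ∈ fatShell n k) :
    ‖divCut k l ξ‖ ≤ 8 * (2 ^ k)⁻¹ := by
  have h1 := hξ.2 hk
  have h2k : (0 : ℝ) < 2 ^ k := by positivity
  have hpos : 0 < ‖ξ‖ := by linarith
  have h3 : ‖(2 * Real.pi * Complex.I : ℂ)⁻¹‖ ≤ 1 := by
    rw [norm_inv]
    refine inv_le_one_of_one_le₀ ?_
    simp only [norm_mul, Complex.norm_ofNat, Complex.norm_real, Complex.norm_I, mul_one]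
    rw [Real.norm_of_nonneg Real.pi_pos.le]
    linarith [Real.pi_gt_three]
  rw [divCut, norm_mul, norm_mul, Complex.norm_real, norm_mul, norm_inv, Real.norm_eq_abs,
    Real.norm_of_nonneg (by positivity : (0 : ℝ) ≤ ‖ξ‖ ^ 2)]
  calc |ξ l| * (‖ξ‖ ^ 2)⁻¹ * (‖(2 * Real.pi * Complex.I : ℂ)⁻¹‖ * ‖fatCut k ξ‖)
      ≤ ‖ξ‖ * (‖ξ‖ ^ 2)⁻¹ * (1 * 2) := by
        gcongr
        · exact abs_apply_le_norm ξ l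
        · exact norm_fatCut_le k ξ
    _ = 2 * ‖ξ‖⁻¹ := by field_simp
    _ ≤ 2 * (4 * (2 ^ k)⁻¹) := by
        gcongr
        rw [inv_le_iff_one_le_mul₀ hpos]
        field_simp
        linarith
    _ = _ := by ring

lemma fourier_dirDeriv (W : 𝓢(Rn n, ℂ)) (v : Rn n) (y : Rn n) :
    𝓕 (dirDeriv v W) y = 2 * Real.pi * Complex.I * inner ℝ y v * 𝓕 (W : Rn n → ℂ) y := by
  obtain ⟨G, hG, hF⟩ := fourier_iterate_dirDeriv W v 1
  rw [Function.iterate_one] at hG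
  rw [← hG, hF, pow_one]

lemma l2Norm_dirDeriv (W : 𝓢(Rn n, ℂ)) (v : Rn n) :
    l2Norm (dirDeriv v W) =
      l2Norm fun y => 2 * Real.pi * Complex.I * inner ℝ y v * 𝓕 (W : Rn n → ℂ) y := by
  rw [← coe_lineDerivOp, ← l2Norm_fourier, coe_lineDerivOp]
  congr 1
  ext y
  exact fourier_dirDeriv W v y

/-- All bounds are read off on the Fourier side by Plancherel. The divergence form is the identity
`∑ 2πi ξ_l · divCut k l = fatCut k`, that is, `∑ ξ_l² = |ξ|²`. The constant `64` is not sharp. -/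
lemma isDyadicFamily_schwartzOp (u : 𝓢(Rn n, ℂ)) :
    IsDyadicFamily 64 (fun j => 2 * l2Mass (fatShell n j) (𝓕 (u : Rn n → ℂ)))
      fun j => schwartzOp (fatCutSchwartz n j) u := by
  have h2 : ∀ {a : ℝ} {P : ℝ≥0∞}, 0 ≤ a → ENNReal.ofReal (2 * a) * P = ENNReal.ofReal a * (2 * P) := by
    intro a P ha
    rw [ENNReal.ofReal_mul zero_le_two, ENNReal.ofReal_ofNat]; ring
  refine ⟨fun j => ?_, fun j l => ?_, fun k hk => ?_⟩
  · rw [← l2Norm_fourier]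
    refine le_trans ?_ ((h2 (a := 1) zero_le_one).trans (by rw [ENNReal.ofReal_one, one_mul])).le
    refine l2Norm_le_l2Mass (measurableSet_fatShell j) (fun ξ hξ => ?_) fun ξ _ => ?_
    · rw [fourier_schwartzOp, coe_fatCutSchwartz, fatCut_eq_zero hξ, zero_mul]
    · rw [fourier_schwartzOp, norm_mul]
      gcongr
      rw [mul_one]; exact norm_fatCut_le j ξ
  · rw [l2Norm_dirDeriv, ← h2 (by positivity)]
    refine l2Norm_le_l2Mass (measurableSet_fatShell j) (fun ξ hξ => ?_) fun ξ hξ => ?_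
    · rw [fourier_schwartzOp, coe_fatCutSchwartz, fatCut_eq_zero hξ]; simp
    · rw [fourier_schwartzOp, norm_mul, norm_mul (fatCutSchwartz n j ξ), ← mul_assoc]
      refine mul_le_mul_of_nonneg_right ?_ (norm_nonneg _)
      simp only [norm_mul, Complex.norm_ofNat, Complex.norm_real, Complex.norm_I, mul_one]
      rw [EuclideanSpace.inner_single_right, Real.norm_of_nonneg Real.pi_pos.le]
      simp only [one_mul, conj_trivial, Real.norm_eq_abs]
      have h3 := hξ.1
      have h4 := abs_apply_le_norm ξ l
      calc 2 * Real.pi * |ξ l| * ‖fatCut j ξ‖ ≤ 2 * 4 * (4 * 2 ^ j) * 2 := by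
            gcongr
            · exact Real.pi_lt_four.le
            · linarith
            · exact norm_fatCut_le j ξ
        _ ≤ _ := by linarith [(by positivity : (0 : ℝ) < 2 ^ j)]
  · refine ⟨fun l => schwartzOp ((hasCompactSupport_divCut k l).toSchwartzMap (contDiff_divCut hk l)) u,
      fun l => ?_, ?_⟩
    · rw [← l2Norm_fourier, ← h2 (by positivity)]
      refine l2Norm_le_l2Mass (measurableSet_fatShell k) (fun ξ hξ => ?_) fun ξ hξ => ?_
      · rw [fourier_schwartzOp]
        change divCut k l ξ * _ = 0
        rw [divCut, fatCut_eq_zero hξ]; simp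
      · rw [fourier_schwartzOp, norm_mul]
        gcongr
        refine (norm_divCut_le hk l hξ).trans ?_
        linarith [(by positivity : (0 : ℝ) < (2 ^ k)⁻¹)]
    · have key : schwartzOp (fatCutSchwartz n k) u =
          ∑ l, ∂_{EuclideanSpace.single l (1 : ℝ)} (schwartzOp
            ((hasCompactSupport_divCut k l).toSchwartzMap (contDiff_divCut hk l)) u) := by
        have hinj : Function.Injective (fun f : 𝓢(Rn n, ℂ) => 𝓕 f) := fun f g hfg => by
          have h := congrArg (fun f : 𝓢(Rn n, ℂ) => 𝓕⁻ f) hfg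
          simpa using h
        apply hinj
        change 𝓕 _ = 𝓕 _
        rw [FourierTransform.fourier_sum]
        ext ξ
        rw [sum_apply]
        change 𝓕 (schwartzOp (fatCutSchwartz n k) u : Rn n → ℂ) ξ = ∑ l, 𝓕 ((∂_{EuclideanSpace.single l (1 : ℝ)}
          (schwartzOp ((hasCompactSupport_divCut k l).toSchwartzMap (contDiff_divCut hk l)) u) :
            𝓢(Rn n, ℂ)) : Rn n → ℂ) ξ
        simp only [coe_lineDerivOp, fourier_dirDeriv, fourier_schwartzOp]
        change fatCut k ξ * _ = ∑ l, _ * (divCut k l ξ * _)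
        by_cases hξ : ξ ∈ fatShell n k
        · have hpos : ‖ξ‖ ≠ 0 := by
            have h1 := hξ.2 hk
            have h2k : (0 : ℝ) < 2 ^ k := by positivity
            linarith
          have hsum : ∑ l, ((ξ l : ℂ) * ξ l) = (‖ξ‖ : ℂ) ^ 2 := by
            rw [← Complex.ofReal_pow, EuclideanSpace.real_norm_sq_eq]
            push_cast
            exact Finset.sum_congr rfl fun l _ => (sq _).symm
          have hπ : (Real.pi : ℂ) ≠ 0 := by exact_mod_cast Real.pi_ne_zero
          have hpos' : (‖ξ‖ : ℂ) ≠ 0 := by exact_mod_cast hpos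
          have hterm : ∀ l : Fin n, 2 * Real.pi * Complex.I *
              ((inner ℝ ξ (EuclideanSpace.single l (1 : ℝ)) : ℝ) : ℂ) *
              (divCut k l ξ * 𝓕 (u : Rn n → ℂ) ξ) =
              ((ξ l : ℂ) * ξ l) * ((((‖ξ‖ : ℂ) ^ 2)⁻¹) * (fatCut k ξ * 𝓕 (u : Rn n → ℂ) ξ)) := by
            intro l
            rw [EuclideanSpace.inner_single_right, divCut]
            push_cast
            simp only [conj_trivial, one_mul]
            field_simp [Complex.I_ne_zero]
          rw [Finset.sum_congr rfl fun l _ => hterm l, ← Finset.sum_mul, hsum]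
          field_simp
        · simp [divCut, fatCut_eq_zero hξ]
      intro x
      have h := congrArg (fun f : 𝓢(Rn n, ℂ) => f x) key
      simp only [sum_apply] at h
      rw [h]
      refine Finset.sum_congr rfl fun l _ => ?_
      exact congrFun (coe_lineDerivOp _ _) x

/-- Translation of Schwartz functions. -/
noncomputable def translation (a : Rn n) (W : 𝓢(Rn n, ℂ)) : 𝓢(Rn n, ℂ) :=
  SchwartzMap.compSubConstCLM ℂ a W

lemma coe_translation (a : Rn n) (W : 𝓢(Rn n, ℂ)) :
    (translation a W : Rn n → ℂ) = fun x => W (x - a) := rfl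

lemma l2Norm_comp_sub (f : Rn n → ℂ) (a : Rn n) : l2Norm (fun x => f (x - a)) = l2Norm f := by
  rw [l2Norm, l2Norm, lintegral_sub_right_eq_self (μ := volume) (fun x => ‖f x‖ₑ ^ 2)]

lemma dirDeriv_translation (v a : Rn n) (W : 𝓢(Rn n, ℂ)) :
    dirDeriv v (translation a W) = fun x => dirDeriv v W (x - a) := by
  ext x
  rw [dirDeriv, dirDeriv, coe_translation]
  exact congrArg (fun L : Rn n →L[ℝ] ℂ => L v) (fderiv_comp_sub (f := (W : Rn n → ℂ)) (𝕜 := ℝ) (x := x) a)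

/-- Each requirement concerns one index and is translation invariant, so the shifts may depend on
`j`. They will be by multiples `2^{-j} v`. -/
lemma IsDyadicFamily.translate {K : ℝ} {p : ℕ → ℝ≥0∞} {W : ℕ → 𝓢(Rn n, ℂ)}
    (h : IsDyadicFamily K p W) (a : ℕ → Rn n) :
    IsDyadicFamily K p fun j => translation (a j) (W j) := by
  refine ⟨fun j => ?_, fun j l => ?_, fun k hk => ?_⟩
  · rw [coe_translation, l2Norm_comp_sub]; exact h.norm_le j
  · rw [dirDeriv_translation, l2Norm_comp_sub]; exact h.deriv_le j l
  · obtain ⟨Q, hQ, hdiv⟩ := h.exists_div k hk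
    refine ⟨fun l => translation (a k) (Q l), fun l => ?_, fun x => ?_⟩
    · rw [coe_translation, l2Norm_comp_sub]; exact hQ l
    · simp only [dirDeriv_translation]
      exact hdiv _

end DyadicFamily

/-! ### `L²` boundedness for symbols of order zero and type `(1, δ)` -/

section GlobalBound

open FourierTransform LineDeriv

variable {n : ℕ}

lemma continuous_section {X Y Z : Type*} [TopologicalSpace X] [TopologicalSpace Y]
    [TopologicalSpace Z] {f : X → Y → Z} (hf : Continuous fun p : X × Y => f p.1 p.2) (x : X) :
    Continuous (f x) := hf.comp (Continuous.prodMk_right x)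

lemma enorm_fourier_le (f : Rn n → ℂ) (y : Rn n) : ‖𝓕 f y‖ₑ ≤ ∫⁻ ξ, ‖f ξ‖ₑ := by
  rw [Real.fourier_eq']
  refine (enorm_integral_le_lintegral_enorm _).trans_eq (lintegral_congr fun v => ?_)
  rw [enorm_smul, ← ofReal_norm, Complex.norm_exp_ofReal_mul_I, ENNReal.ofReal_one, one_mul]

lemma norm_fourier_le_of_support {f : Rn n → ℂ} {r B : ℝ} (hr : 0 ≤ r) (hB : 0 ≤ B)
    (h0 : ∀ ξ, r < ‖ξ‖ → f ξ = 0) (hb : ∀ ξ, ‖f ξ‖ ≤ B) (y : Rn n) :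
    ‖𝓕 f y‖ ≤ B * (2 * r) ^ n := by
  have h : ‖𝓕 f y‖ₑ ≤ ENNReal.ofReal (B * (2 * r) ^ n) := by
    refine (enorm_fourier_le f y).trans ?_
    calc ∫⁻ ξ, ‖f ξ‖ₑ ≤ ∫⁻ ξ, (cube 0 (2 * r)).indicator (fun _ => ENNReal.ofReal B) ξ := by
          refine lintegral_mono fun ξ => ?_
          by_cases hξ : ξ ∈ cube 0 (2 * r)
          · rw [Set.indicator_of_mem hξ]
            exact enorm_le_ofReal (hb ξ)
          · have : f ξ = 0 := by
              refine h0 ξ ?_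
              by_contra h
              exact hξ (closedBall_subset_cube 0 r (mem_closedBall_zero_iff.2 (not_lt.1 h)))
            simp [this]
      _ = _ := by
          rw [lintegral_indicator (measurableSet_cube _ _), setLIntegral_const,
            volume_cube _ (by positivity), ← ENNReal.ofReal_mul hB]
  rw [← ofReal_norm] at h
  exact (ENNReal.ofReal_le_ofReal_iff (by positivity)).1 h

/-- Pointwise decay of the kernel of a piece. -/
lemma exists_norm_fourier_le (n : ℕ) : ∃ C : ℝ, 0 ≤ C ∧
    ∀ (Λ μ B : ℝ) (f : Rn n → ℂ), 0 < Λ → 0 < μ → IsPiece Λ μ B f →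
      ∀ y, ‖𝓕 f y‖ ≤ C * B * Λ ^ n * ((1 + ‖y‖ / μ) ^ (n + 1))⁻¹ := by
  obtain ⟨c, hc, hcn⟩ := exists_norm_pow_le n (n + 1)
  refine ⟨2 ^ (n + 1) * (1 + c) * (1 + n) * 4 ^ n, by positivity, fun Λ μ B f hΛ hμ hf y => ?_⟩
  have hB := hf.nonneg
  have h1 : (1 + ‖y‖ / μ) ^ (n + 1) ≤
      2 ^ (n + 1) * (1 + c) * (1 + ∑ i, (μ ^ (n + 1))⁻¹ * |y i| ^ (n + 1)) := by
    have h2 : (1 + ‖y‖ / μ) ^ (n + 1) ≤ 2 ^ (n + 1) * (1 + (‖y‖ / μ) ^ (n + 1)) := by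
      have h0 : 0 ≤ ‖y‖ / μ := by positivity
      rcases le_total (‖y‖ / μ) 1 with h | h
      · calc (1 + ‖y‖ / μ) ^ (n + 1) ≤ 2 ^ (n + 1) * 1 := by
              rw [mul_one]; gcongr; linarith
          _ ≤ _ := by gcongr; linarith [pow_nonneg h0 (n + 1)]
      · calc (1 + ‖y‖ / μ) ^ (n + 1) ≤ (2 * (‖y‖ / μ)) ^ (n + 1) := by gcongr; linarith
          _ = 2 ^ (n + 1) * (‖y‖ / μ) ^ (n + 1) := mul_pow _ _ _
          _ ≤ _ := by gcongr; linarith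
    have h3 := hcn (μ⁻¹ • y)
    have h4 : ∑ i, |(μ⁻¹ • y) i| ^ (n + 1) = ∑ i, (μ ^ (n + 1))⁻¹ * |y i| ^ (n + 1) := by
      refine Finset.sum_congr rfl fun i _ => ?_
      rw [PiLp.smul_apply, smul_eq_mul, abs_mul, mul_pow, abs_of_pos (inv_pos.2 hμ), inv_pow]
    rw [h4, norm_smul, Real.norm_eq_abs, abs_of_pos (inv_pos.2 hμ), ← div_eq_inv_mul] at h3
    have h5 : 0 ≤ ∑ i, (μ ^ (n + 1))⁻¹ * |y i| ^ (n + 1) :=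
      Finset.sum_nonneg fun i _ => by positivity
    refine h2.trans ?_
    rw [mul_assoc]
    gcongr
    linarith
  -- The scheme of `exists_lintegral_kernel_le`, with the sup of a transform bounded by an `L¹` norm
  -- in place of Plancherel.
  have t1 : ‖𝓕 f y‖ ≤ B * (4 * Λ) ^ n := by
    refine (norm_fourier_le_of_support (by positivity) hB hf.eq_zero hf.norm_le y).trans_eq ?_
    congr 2; ring
  have t2 : ∀ i, (μ ^ (n + 1))⁻¹ * |y i| ^ (n + 1) * ‖𝓕 f y‖ ≤ B * (4 * Λ) ^ n := by
    intro i
    obtain ⟨G, hG, hGF⟩ := fourier_iterate_dirDeriv hf.toSchwartz (EuclideanSpace.single i 1) (n + 1)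
    have h6 : ‖𝓕 (G : Rn n → ℂ) y‖ ≤ B * μ ^ (n + 1) * (2 * (2 * Λ)) ^ n := by
      refine norm_fourier_le_of_support (by positivity) (by positivity) ?_ ?_ y
      · rw [hG]; exact iterate_dirDeriv_eq_zero hf.eq_zero _ _
      · rw [hG]; exact hf.deriv_le i
    have h7 : |y i| ^ (n + 1) * ‖𝓕 f y‖ ≤ ‖𝓕 (G : Rn n → ℂ) y‖ := by
      have : inner ℝ y (EuclideanSpace.single i (1 : ℝ)) = y i := by
        simp [EuclideanSpace.inner_single_right]
      rw [hGF y, norm_mul, norm_pow, this, IsPiece.coe_toSchwartz]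
      gcongr
      simp only [norm_mul, Complex.norm_ofNat, Complex.norm_real, Complex.norm_I, mul_one,
        Real.norm_eq_abs]
      rw [abs_of_pos Real.pi_pos]
      refine le_mul_of_one_le_left (abs_nonneg _) ?_
      linarith [Real.pi_gt_three]
    have hμ' : 0 < μ ^ (n + 1) := by positivity
    rw [mul_assoc, inv_mul_le_iff₀ hμ']
    refine (h7.trans h6).trans_eq ?_
    rw [show 2 * (2 * Λ) = 4 * Λ by ring]
    ring
  have hw : 0 < (1 + ‖y‖ / μ) ^ (n + 1) := by positivity
  rw [← div_eq_mul_inv, le_div_iff₀ hw]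
  calc ‖𝓕 f y‖ * (1 + ‖y‖ / μ) ^ (n + 1)
      ≤ ‖𝓕 f y‖ * (2 ^ (n + 1) * (1 + c) * (1 + ∑ i, (μ ^ (n + 1))⁻¹ * |y i| ^ (n + 1))) := by gcongr
    _ = 2 ^ (n + 1) * (1 + c) * (‖𝓕 f y‖ + ∑ i, (μ ^ (n + 1))⁻¹ * |y i| ^ (n + 1) * ‖𝓕 f y‖) := by
        rw [← Finset.sum_mul]; ring
    _ ≤ 2 ^ (n + 1) * (1 + c) * (B * (4 * Λ) ^ n + ∑ _i : Fin n, B * (4 * Λ) ^ n) := by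
        refine mul_le_mul_of_nonneg_left (add_le_add t1 (Finset.sum_le_sum fun i _ => t2 i)) ?_
        positivity
    _ = _ := by
        rw [Finset.sum_const, Finset.card_univ, Fintype.card_fin, nsmul_eq_mul, mul_pow]
        ring

/-- The uniform Lipschitz bound in `x` and the common compact support in `ξ` provide the integrable
majorant for differentiating under the integral. -/
lemma differentiable_fourier_param {g : Rn n → Rn n → ℂ} {r L : ℝ}
    (hg : ContDiff ℝ ∞ fun p : Rn n × Rn n => g p.1 p.2) (h0 : ∀ x ξ, r < ‖ξ‖ → g x ξ = 0)
    (hL : ∀ x z ξ, ‖g x ξ - g z ξ‖ ≤ L * ‖x - z‖) (y : Rn n) :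
    Differentiable ℝ fun x => 𝓕 (g x) y := by
  intro x₀
  have hgc : ∀ x, Continuous (g x) := fun x => hg.continuous.comp (Continuous.prodMk_right x)
  have hgd : ∀ ξ, Differentiable ℝ fun x => g x ξ := fun ξ =>
    (hg.comp (contDiff_id.prodMk contDiff_const : ContDiff ℝ ∞ fun x : Rn n => (x, ξ))).differentiable
      (by simp)
  simp only [Real.fourier_eq', smul_eq_mul]
  have hexp : Continuous fun ξ : Rn n =>
      Complex.exp (((-2 * Real.pi * inner ℝ ξ y : ℝ) : ℂ) * Complex.I) := by fun_prop
  have hcs : HasCompactSupport (g x₀) := by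
    refine HasCompactSupport.intro (isCompact_closedBall (0 : Rn n) r) fun ξ hξ => h0 x₀ ξ ?_
    rwa [mem_closedBall_zero_iff, not_le] at hξ
  have key := hasFDerivAt_integral_of_dominated_loc_of_lip' (𝕜 := ℝ) (μ := (volume : Measure (Rn n)))
    (F := fun x ξ => Complex.exp (((-2 * Real.pi * inner ℝ ξ y : ℝ) : ℂ) * Complex.I) * g x ξ)
    (F' := fun ξ => Complex.exp (((-2 * Real.pi * inner ℝ ξ y : ℝ) : ℂ) * Complex.I) •
      fderiv ℝ (fun x => g x ξ) x₀) (x₀ := x₀) (s := Set.univ)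
    (bound := (Metric.closedBall (0 : Rn n) r).indicator fun _ => L) Filter.univ_mem ?_ ?_ ?_ ?_ ?_ ?_
  · exact key.2.differentiableAt
  · exact fun x _ => (hexp.mul (hgc x)).aestronglyMeasurable
  · refine ((hgc x₀).integrable_of_hasCompactSupport hcs).bdd_mul (c := 1) hexp.aestronglyMeasurable
      (Filter.Eventually.of_forall fun ξ => ?_)
    rw [Complex.norm_exp_ofReal_mul_I]
  · have hsw : Continuous (Function.uncurry fun ξ x : Rn n => g x ξ) :=
      hg.continuous.comp continuous_swap
    have h1 := (measurable_fderiv_with_param ℝ hsw).comp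
      (measurable_id.prodMk measurable_const : Measurable fun ξ : Rn n => (ξ, x₀))
    have h2 : Measurable fun ξ => fderiv ℝ (fun x => g x ξ) x₀ := h1
    exact hexp.aestronglyMeasurable.smul h2.aestronglyMeasurable
  · refine Filter.Eventually.of_forall fun ξ x _ => ?_
    rw [← mul_sub, norm_mul, Complex.norm_exp_ofReal_mul_I, one_mul]
    by_cases hξ : ξ ∈ Metric.closedBall (0 : Rn n) r
    · rw [Set.indicator_of_mem hξ]; exact hL x x₀ ξ
    · rw [Set.indicator_of_notMem hξ]
      rw [mem_closedBall_zero_iff, not_le] at hξ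
      rw [h0 x ξ hξ, h0 x₀ ξ hξ]; simp
  · exact (integrable_indicator_iff measurableSet_closedBall).2
      (integrableOn_const (measure_closedBall_lt_top.ne))
  · refine Filter.Eventually.of_forall fun ξ => ?_
    have := (hgd ξ x₀).hasFDerivAt.const_smul
      (Complex.exp (((-2 * Real.pi * inner ℝ ξ y : ℝ) : ℂ) * Complex.I))
    exact this

lemma continuous_fourier_param {g : Rn n → Rn n → ℂ} {r B : ℝ}
    (hg : Continuous fun p : Rn n × Rn n => g p.1 p.2) (h0 : ∀ x ξ, r < ‖ξ‖ → g x ξ = 0)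
    (hB : ∀ x ξ, ‖g x ξ‖ ≤ B) {φ ψ : Rn n × Rn n → Rn n} (hφ : Continuous φ) (hψ : Continuous ψ) :
    Continuous fun p : Rn n × Rn n => 𝓕 (g (φ p)) (ψ p) := by
  simp only [Real.fourier_eq', smul_eq_mul]
  refine continuous_of_dominated (bound := (Metric.closedBall (0 : Rn n) r).indicator fun _ => B)
    (fun p => ?_) (fun p => Filter.Eventually.of_forall fun ξ => ?_) ?_
    (Filter.Eventually.of_forall fun ξ => ?_)
  · have h1 : Continuous (g (φ p)) := hg.comp (Continuous.prodMk_right (φ p))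
    exact Continuous.aestronglyMeasurable (by fun_prop)
  · rw [norm_mul, Complex.norm_exp_ofReal_mul_I, one_mul]
    by_cases hξ : ξ ∈ Metric.closedBall (0 : Rn n) r
    · rw [Set.indicator_of_mem hξ]; exact hB _ _
    · rw [Set.indicator_of_notMem hξ]
      rw [mem_closedBall_zero_iff, not_le] at hξ
      rw [h0 _ ξ hξ, norm_zero]
  · exact (integrable_indicator_iff measurableSet_closedBall).2
      (integrableOn_const (measure_closedBall_lt_top.ne))
  · have h1 : Continuous fun p : Rn n × Rn n => g (φ p) ξ :=
      hg.comp (hφ.prodMk continuous_const)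
    fun_prop

lemma SymbolBounds.contDiff_symbolPiece {m ρ δ A : ℝ} {b : Rn n → Rn n → ℂ}
    (h : SymbolBounds m ρ δ A b) (j : ℕ) :
    ContDiff ℝ ∞ fun p : Rn n × Rn n => symbolPiece b j p.1 p.2 :=
  ((contDiff_dyadicCut j).comp contDiff_snd).mul h.smooth

lemma SymbolBounds.contDiff_symbolPiece_right {m ρ δ A : ℝ} {b : Rn n → Rn n → ℂ}
    (h : SymbolBounds m ρ δ A b) (j : ℕ) (x : Rn n) : ContDiff ℝ ∞ (symbolPiece b j x) :=
  (contDiff_dyadicCut j).mul (h.contDiff_right x)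

lemma symbolPiece_eq_zero (b : Rn n → Rn n → ℂ) (j : ℕ) (x ξ : Rn n) (h : 2 * 2 ^ j < ‖ξ‖) :
    symbolPiece b j x ξ = 0 := dyadicCut_mul_eq_zero j _ ξ h

/-- The kernel of a dyadic piece, rescaled to unit scale. -/
noncomputable def shellKernel (b : Rn n → Rn n → ℂ) (j : ℕ) (v x : Rn n) : ℂ :=
  (((2 : ℝ) ^ j) ^ n)⁻¹ • 𝓕 (symbolPiece b j x) (((2 : ℝ) ^ j)⁻¹ • v)

/-- For `ρ = 1` the kernel of the `j`-th piece has height `2^{jn}` and width `2^{-j}`; the rescaling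
removes both. Its `x`-derivative is bounded through the Lipschitz estimate, since differences of
pieces are pieces, with an additional factor `2^{δj}`. -/
lemma exists_isCoeffFamily_shellKernel (n : ℕ) (δ A : ℝ) (hδ1 : δ ≤ 1) (hA : 0 ≤ A) :
    ∃ C : ℝ, 0 ≤ C ∧ ∀ b : Rn n → Rn n → ℂ, SymbolBounds 0 1 δ A b → ∀ v,
      IsCoeffFamily δ (C * ((1 + ‖v‖) ^ (n + 1))⁻¹) fun j x => shellKernel b j v x := by
  obtain ⟨C, hC, hker⟩ := exists_norm_fourier_le n
  obtain ⟨D, hD, hpc⟩ := exists_symbolPiece_bounds n 0 1 δ A zero_le_one le_rfl hδ1 hA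
  refine ⟨C * D, by positivity, fun b hb v => ?_⟩
  have hscale : ∀ (j : ℕ) (E : ℝ) (f : Rn n → ℂ), IsPiece (2 ^ j) (((2 : ℝ) ^ j) ^ (-1 : ℝ)) E f →
      ‖(((2 : ℝ) ^ j) ^ n)⁻¹ • 𝓕 f (((2 : ℝ) ^ j)⁻¹ • v)‖ ≤ C * E * ((1 + ‖v‖) ^ (n + 1))⁻¹ := by
    intro j E f hf
    have h2 : (0 : ℝ) < 2 ^ j := by positivity
    have h3 := hker _ _ _ f h2 (by positivity) hf (((2 : ℝ) ^ j)⁻¹ • v)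
    rw [norm_smul, norm_inv, Real.norm_of_nonneg h2.le, Real.rpow_neg_one,
      show (2 ^ j : ℝ)⁻¹ * ‖v‖ / (2 ^ j)⁻¹ = ‖v‖ by field_simp] at h3
    rw [norm_smul, norm_inv, Real.norm_of_nonneg (by positivity)]
    rw [inv_mul_le_iff₀ (by positivity)]
    refine h3.trans_eq (by ring)
  have hpiece : ∀ j x, IsPiece (2 ^ j) (((2 : ℝ) ^ j) ^ (-1 : ℝ)) D (symbolPiece b j x) := by
    intro j x
    have := isPiece_of_ptBound (hb.contDiff_symbolPiece_right j x) (symbolPiece_eq_zero b j x)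
      ((hpc b hb j).1 x)
    simpa using this
  have hpiece' : ∀ j x z, IsPiece (2 ^ j) (((2 : ℝ) ^ j) ^ (-1 : ℝ))
      (D * ‖x - z‖ * ((2 : ℝ) ^ j) ^ δ) fun ξ => symbolPiece b j x ξ - symbolPiece b j z ξ := by
    intro j x z
    have := isPiece_of_ptBound (Λ := 2 ^ j) ((hb.contDiff_symbolPiece_right j x).sub
      (hb.contDiff_symbolPiece_right j z)) (fun ξ hξ => by
        rw [symbolPiece_eq_zero b j x ξ hξ, symbolPiece_eq_zero b j z ξ hξ, sub_zero])
      ((hpc b hb j).2.1 x z)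
    rwa [zero_add] at this
  refine ⟨fun j => ?_, fun j x => hscale j D _ (hpiece j x), fun j l x => ?_⟩
  · have h := differentiable_fourier_param (r := 2 * 2 ^ j)
      (L := D * ((2 : ℝ) ^ j) ^ δ) (hb.contDiff_symbolPiece j) (symbolPiece_eq_zero b j)
      (fun x z ξ => ((hpiece' j x z).norm_le ξ).trans_eq (by ring)) (((2 : ℝ) ^ j)⁻¹ • v)
    exact h.const_smul (((2 : ℝ) ^ j) ^ n)⁻¹
  · have hlip : ‖fderiv ℝ (fun x => shellKernel b j v x) x‖ ≤
        C * D * ((1 + ‖v‖) ^ (n + 1))⁻¹ * ((2 : ℝ) ^ j) ^ δ := by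
      refine norm_fderiv_le_of_lip' ℝ (by positivity) (Filter.Eventually.of_forall fun z => ?_)
      have hint : ∀ x, Integrable (symbolPiece b j x) := fun x => (hpiece j x).integrable
      have : shellKernel b j v z - shellKernel b j v x = (((2 : ℝ) ^ j) ^ n)⁻¹ •
          𝓕 (fun ξ => symbolPiece b j z ξ - symbolPiece b j x ξ) (((2 : ℝ) ^ j)⁻¹ • v) := by
        rw [shellKernel, shellKernel, ← smul_sub]
        congr 1
        have h1 := VectorFourier.fourierIntegral_add (μ := volume) (L := innerₗ (Rn n))
          Real.continuous_fourierChar continuous_inner (hint x) ((hint z).sub (hint x))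
        have h2 := congrFun h1 (((2 : ℝ) ^ j)⁻¹ • v)
        rw [add_sub_cancel] at h2
        change 𝓕 (symbolPiece b j z) _ = 𝓕 (symbolPiece b j x) _ +
          𝓕 (symbolPiece b j z - symbolPiece b j x) _ at h2
        rw [h2, add_sub_cancel_left]
        rfl
      rw [this]
      refine (hscale j _ _ (hpiece' j z x)).trans_eq ?_
      ring
    refine (ContinuousLinearMap.le_opNorm _ _).trans ?_
    rw [PiLp.norm_single, norm_one, mul_one]
    exact hlip

/-- The fat cutoff is `1` wherever the piece is nonzero, so it can be inserted for free. The kernel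
integral is then written in the variable `y = x + 2^{-j} v`, and for fixed `v` it is a coefficient
times a dyadic block. -/
lemma freqOp_symbolPiece_eq {m ρ δ A : ℝ} {b : Rn n → Rn n → ℂ} (hb : SymbolBounds m ρ δ A b)
    (j : ℕ) (u : 𝓢(Rn n, ℂ)) (x : Rn n) :
    freqOp (symbolPiece b j x) u x = ∫ v, shellKernel b j v x *
      translation (-((2 : ℝ) ^ j)⁻¹ • v) (schwartzOp (fatCutSchwartz n j) u) x := by
  set W := schwartzOp (fatCutSchwartz n j) u with hW
  have h2 : (0 : ℝ) < 2 ^ j := by positivity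
  have hcs : HasCompactSupport (symbolPiece b j x) := by
    refine HasCompactSupport.intro (isCompact_closedBall (0 : Rn n) (2 * 2 ^ j)) fun ξ hξ => ?_
    rw [mem_closedBall_zero_iff, not_le] at hξ
    exact symbolPiece_eq_zero b j x ξ hξ
  have hint : Integrable (symbolPiece b j x) :=
    (hb.contDiff_symbolPiece_right j x).continuous.integrable_of_hasCompactSupport hcs
  have e1 : freqOp (symbolPiece b j x) u x = freqOp (symbolPiece b j x) W x := by
    rw [freqOp_eq_integral, freqOp_eq_integral]
    refine integral_congr_ae (Filter.Eventually.of_forall fun ξ => ?_)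
    simp only
    rw [hW, fourier_schwartzOp, coe_fatCutSchwartz]
    by_cases hξ : InShell j ξ
    · rw [fatCut_eq_one hξ, one_mul]
    · rw [symbolPiece, (dyadicCut_eventually_zero hξ).eq_of_nhds]; simp
  rw [e1, freqOp_eq_kernel hint]
  have e2 := integral_add_right_eq_self (μ := volume) (fun y => 𝓕 (symbolPiece b j x) (y - x) * W y) x
  simp only [add_sub_cancel_right] at e2
  have e3 := Measure.integral_comp_inv_smul_of_nonneg (volume : Measure (Rn n))
    (fun z => 𝓕 (symbolPiece b j x) z * W (z + x)) h2.le
  rw [finrank_euclideanSpace_fin] at e3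
  rw [← e2, ← inv_smul_smul₀ (pow_pos h2 n).ne' (∫ z, 𝓕 (symbolPiece b j x) z * W (z + x)), ← e3,
    ← integral_smul]
  refine integral_congr_ae (Filter.Eventually.of_forall fun v => ?_)
  simp only [coe_translation, shellKernel, smul_mul_assoc, neg_smul, sub_neg_eq_add]
  rw [add_comm x]

lemma continuous_shellKernel {m ρ δ A C : ℝ} {b : Rn n → Rn n → ℂ} (hb : SymbolBounds m ρ δ A b)
    (j : ℕ) (hC : ∀ x ξ, ‖symbolPiece b j x ξ‖ ≤ C) :
    Continuous fun p : Rn n × Rn n => shellKernel b j p.2 p.1 := by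
  have h2 : Continuous fun p : Rn n × Rn n => ((2 : ℝ) ^ j)⁻¹ • p.2 := by fun_prop
  have h3 : Continuous fun p : Rn n × Rn n =>
      𝓕 (symbolPiece b j p.1) (((2 : ℝ) ^ j)⁻¹ • p.2) :=
    continuous_fourier_param (hb.contDiff_symbolPiece j).continuous (symbolPiece_eq_zero b j) hC
      continuous_fst h2
  exact h3.const_smul (((2 : ℝ) ^ j) ^ n)⁻¹

lemma enorm_integral_sq_le_weighted (h : Rn n → ℂ) (hh : Continuous h) :
    ‖∫ v, h v‖ₑ ^ 2 ≤ ENNReal.ofReal (4 ^ (n + 1)) *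
      ∫⁻ v, ENNReal.ofReal ((1 + ‖v‖) ^ (n + 1)) * ‖h v‖ₑ ^ 2 := by
  set s : Rn n → ℝ := fun v => Real.sqrt ((1 + ‖v‖) ^ (n + 1)) with hs
  have hsc : Continuous s := by fun_prop
  have hs0 : ∀ v, 0 < s v := fun v => Real.sqrt_pos.2 (by positivity)
  have hs2 : ∀ v, s v ^ 2 = (1 + ‖v‖) ^ (n + 1) := fun v => Real.sq_sqrt (by positivity)
  calc ‖∫ v, h v‖ₑ ^ 2 ≤ (∫⁻ v, ENNReal.ofReal (s v)⁻¹ * (ENNReal.ofReal (s v) * ‖h v‖ₑ)) ^ 2 := by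
        gcongr
        refine (enorm_integral_le_lintegral_enorm _).trans_eq (lintegral_congr fun v => ?_)
        rw [← mul_assoc, ← ENNReal.ofReal_mul (inv_nonneg.2 (hs0 v).le), inv_mul_cancel₀ (hs0 v).ne',
          ENNReal.ofReal_one, one_mul]
    _ ≤ (∫⁻ v, ENNReal.ofReal (s v)⁻¹ ^ 2) * ∫⁻ v, (ENNReal.ofReal (s v) * ‖h v‖ₑ) ^ 2 :=
        ennreal_sq_lintegral_mul_le _ hsc.measurable.inv.ennreal_ofReal.aemeasurable
          (hsc.measurable.ennreal_ofReal.mul hh.enorm.measurable).aemeasurable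
    _ ≤ _ := by
        gcongr with v
        · have := lintegral_decayWeight_le one_pos (0 : Rn n)
          rw [one_pow, mul_one] at this
          refine le_trans (le_of_eq (lintegral_congr fun v => ?_)) this
          rw [← ENNReal.ofReal_pow (inv_nonneg.2 (hs0 v).le), inv_pow, hs2, decayWeight, sub_zero,
            div_one]
        · rw [mul_pow, ← ENNReal.ofReal_pow (hs0 v).le, hs2]

/-- The integrand in the kernel representation of a dyadic piece. -/
noncomputable def shellTerm (b : Rn n → Rn n → ℂ) (u : 𝓢(Rn n, ℂ)) (j : ℕ) (x v : Rn n) : ℂ :=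
  shellKernel b j v x * translation (-((2 : ℝ) ^ j)⁻¹ • v) (schwartzOp (fatCutSchwartz n j) u) x

lemma continuous_shellTerm {m ρ δ A C : ℝ} {b : Rn n → Rn n → ℂ} (hb : SymbolBounds m ρ δ A b)
    (u : 𝓢(Rn n, ℂ)) (j : ℕ) (hC : ∀ x ξ, ‖symbolPiece b j x ξ‖ ≤ C) :
    Continuous fun p : Rn n × Rn n => shellTerm b u j p.1 p.2 := by
  refine (continuous_shellKernel hb j hC).mul ?_
  have h1 : Continuous fun p : Rn n × Rn n => p.1 - -((2 : ℝ) ^ j)⁻¹ • p.2 := by fun_prop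
  have h2 : Continuous fun p : Rn n × Rn n =>
    schwartzOp (fatCutSchwartz n j) u (p.1 - -((2 : ℝ) ^ j)⁻¹ • p.2) :=
      (schwartzOp (fatCutSchwartz n j) u).continuous.comp h1
  exact h2

lemma integrable_shellTerm {C : ℝ} {b : Rn n → Rn n → ℂ} (u : 𝓢(Rn n, ℂ)) (j : ℕ) (x : Rn n)
    (hC0 : 0 ≤ C) (hc : Continuous (shellTerm b u j x))
    (hC : ∀ v, ‖shellKernel b j v x‖ ≤ C * ((1 + ‖v‖) ^ (n + 1))⁻¹) :
    Integrable (shellTerm b u j x) := by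
  refine ⟨hc.aestronglyMeasurable, ?_⟩
  obtain ⟨CW, hCW⟩ := (schwartzOp (fatCutSchwartz n j) u).exists_norm_le
  have hCW0 : 0 ≤ CW := (norm_nonneg _).trans (hCW 0)
  have hle : ∀ v, ‖shellTerm b u j x v‖ₑ ≤
      ENNReal.ofReal (C * CW) * decayWeight (n + 1) 1 (v - 0) := by
    intro v
    rw [decayWeight, ← ENNReal.ofReal_mul (by positivity), sub_zero, div_one]
    refine enorm_le_ofReal ?_
    rw [shellTerm, norm_mul]
    calc _ ≤ C * ((1 + ‖v‖) ^ (n + 1))⁻¹ * CW :=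
          mul_le_mul (hC v) (hCW _) (norm_nonneg _) (by positivity)
      _ = _ := by ring
  refine lt_of_le_of_lt (lintegral_mono hle) ?_
  rw [lintegral_const_mul' _ _ ENNReal.ofReal_ne_top]
  exact ENNReal.mul_lt_top ENNReal.ofReal_lt_top
    ((lintegral_decayWeight_le one_pos 0).trans_lt ENNReal.ofReal_lt_top)

/-- Weighted Cauchy–Schwarz in `v`: the weight `(1 + |v|)^{n+1}` against the squared decay leaves
the integrable `(1 + |v|)^{-(n+1)}`. -/
lemma lintegral_enorm_integral_sq_le {h : Rn n → Rn n → ℂ}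
    (hc : Continuous fun p : Rn n × Rn n => h p.1 p.2) {K : ℝ} (hK : 0 ≤ K) {I : ℝ≥0∞}
    (hv : ∀ v, ∫⁻ x, ‖h x v‖ₑ ^ 2 ≤ ENNReal.ofReal (K * (((1 + ‖v‖) ^ (n + 1))⁻¹) ^ 2) * I) :
    ∫⁻ x, ‖∫ v, h x v‖ₑ ^ 2 ≤ ENNReal.ofReal (4 ^ (n + 1) * (4 ^ (n + 1) * K)) * I := by
  have hmeas : Measurable fun p : Rn n × Rn n =>
      ENNReal.ofReal ((1 + ‖p.2‖) ^ (n + 1)) * ‖h p.1 p.2‖ₑ ^ 2 := by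
    refine Measurable.mul ?_ (hc.enorm.measurable.pow_const 2)
    have : Continuous fun p : Rn n × Rn n => (1 + ‖p.2‖) ^ (n + 1) := by fun_prop
    exact this.measurable.ennreal_ofReal
  calc _ ≤ ∫⁻ x, ENNReal.ofReal (4 ^ (n + 1)) *
        ∫⁻ v, ENNReal.ofReal ((1 + ‖v‖) ^ (n + 1)) * ‖h x v‖ₑ ^ 2 :=
        lintegral_mono fun x => enorm_integral_sq_le_weighted _ (hc.comp (Continuous.prodMk_right x))
    _ = ENNReal.ofReal (4 ^ (n + 1)) *
        ∫⁻ v, ENNReal.ofReal ((1 + ‖v‖) ^ (n + 1)) * ∫⁻ x, ‖h x v‖ₑ ^ 2 := by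
        rw [lintegral_const_mul' _ _ ENNReal.ofReal_ne_top, lintegral_lintegral_swap hmeas.aemeasurable]
        congr 1
        exact lintegral_congr fun v => lintegral_const_mul' _ _ ENNReal.ofReal_ne_top
    _ ≤ ENNReal.ofReal (4 ^ (n + 1)) *
        ∫⁻ v, (ENNReal.ofReal K * I) * decayWeight (n + 1) 1 (v - 0) := by
        refine mul_le_mul_right (lintegral_mono fun v => ?_) _
        refine (mul_le_mul_right (hv v) _).trans_eq ?_
        rw [decayWeight, sub_zero, div_one, ENNReal.ofReal_mul hK]
        have h0 : (0 : ℝ) < (1 + ‖v‖) ^ (n + 1) := by positivity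
        have : ENNReal.ofReal ((1 + ‖v‖) ^ (n + 1)) *
            ENNReal.ofReal ((((1 + ‖v‖) ^ (n + 1))⁻¹) ^ 2) =
            ENNReal.ofReal ((1 + ‖v‖) ^ (n + 1))⁻¹ := by
          rw [← ENNReal.ofReal_mul h0.le]
          congr 1
          field_simp
        rw [← this]; ring
    _ ≤ ENNReal.ofReal (4 ^ (n + 1)) * ((ENNReal.ofReal K * I) * ENNReal.ofReal (4 ^ (n + 1))) := by
        rw [lintegral_const_mul _ (measurable_decayWeight_sub_right _ _ _)]
        gcongr
        simpa using lintegral_decayWeight_le one_pos (0 : Rn n)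
    _ = _ := by
        rw [ENNReal.ofReal_mul (q := 4 ^ (n + 1) * K) (by positivity),
          ENNReal.ofReal_mul (q := K) (by positivity)]
        ring

/-- `L²` boundedness of the dyadic partial sums of a symbol of order zero and type `(1, δ)`. -/
lemma exists_lintegral_sum_freqOp_le (n : ℕ) (δ A : ℝ) (hδ0 : 0 ≤ δ) (hδ1 : δ < 1) (hA : 0 ≤ A) :
    ∃ C : ℝ, 0 ≤ C ∧ ∀ b : Rn n → Rn n → ℂ, SymbolBounds 0 1 δ A b → ∀ (F : Finset ℕ)
      (u : 𝓢(Rn n, ℂ)), ∫⁻ x, ‖∑ j ∈ F, freqOp (symbolPiece b j x) u x‖ₑ ^ 2 ≤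
        ENNReal.ofReal C * ∫⁻ x, ‖u x‖ₑ ^ 2 := by
  obtain ⟨C, hC, hcoef⟩ := exists_isCoeffFamily_shellKernel n δ A hδ1.le hA
  obtain ⟨D, hD, hpc⟩ := exists_symbolPiece_bounds n 0 1 δ A zero_le_one le_rfl hδ1.le hA
  set K₀ : ℝ := (2 + n * (64 * (2 + 64))) * C ^ 2 * (4 * (1 - (1 / 2 : ℝ) ^ (1 - δ))⁻¹) with hK₀
  have hr1 : (1 / 2 : ℝ) ^ (1 - δ) < 1 :=
    Real.rpow_lt_one (by norm_num) (by norm_num) (by linarith)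
  have hK₀0 : 0 ≤ K₀ := by
    have : 0 ≤ (1 - (1 / 2 : ℝ) ^ (1 - δ))⁻¹ := inv_nonneg.2 (by linarith)
    positivity
  -- Each `4 ^ (n + 1)` is an integral of the weight in `v`, and `28 = 2² · 7`: the factor `2` in
  -- the sizes of the blocks, squared, times the overlap of the fat shells.
  refine ⟨4 ^ (n + 1) * (4 ^ (n + 1) * K₀) * 28, by positivity, fun b hb F u => ?_⟩
  have hcont : ∀ j, Continuous fun p : Rn n × Rn n => shellTerm b u j p.1 p.2 := fun j =>
    continuous_shellTerm hb u j (C := D) fun x ξ => by simpa using ((hpc b hb j).1 x ξ).1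
  have hcontx : ∀ j x, Continuous fun v => shellTerm b u j x v := fun j x =>
    continuous_section (f := shellTerm b u j) (hcont j) x
  have hint : ∀ j x, Integrable (shellTerm b u j x) := fun j x =>
    integrable_shellTerm u j x hC (hcontx j x)
      fun v => (hcoef b hb v).norm_le j x
  have hsum : Continuous fun p : Rn n × Rn n => ∑ j ∈ F, shellTerm b u j p.1 p.2 :=
    continuous_finsetSum _ fun j _ => hcont j
  have heq : ∀ x, ∑ j ∈ F, freqOp (symbolPiece b j x) u x = ∫ v, ∑ j ∈ F, shellTerm b u j x v := by
    intro x
    rw [integral_finsetSum _ fun j _ => hint j x]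
    exact Finset.sum_congr rfl fun j _ => freqOp_symbolPiece_eq hb j u x
  have hv : ∀ v, ∫⁻ x, ‖∑ j ∈ F, shellTerm b u j x v‖ₑ ^ 2 ≤
      ENNReal.ofReal (K₀ * (((1 + ‖v‖) ^ (n + 1))⁻¹) ^ 2) * (28 * ∫⁻ x, ‖u x‖ₑ ^ 2) := by
    intro v
    -- For fixed `v` the sum has the form required by almost orthogonality, and the decay in `v`
    -- sits in the coefficient bound.
    have hdy := (isDyadicFamily_schwartzOp u).translate fun j => -((2 : ℝ) ^ j)⁻¹ • v
    refine (lintegral_sum_sq_le (by norm_num) hδ0 hδ1 hdy (hcoef b hb v) F).trans ?_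
    refine mul_le_mul' (ENNReal.ofReal_le_ofReal (le_of_eq ?_)) ?_
    · rw [hK₀]; ring
    · simp only [mul_pow]
      rw [← Finset.mul_sum]
      calc _ ≤ (2 : ℝ≥0∞) ^ 2 * (7 * ∫⁻ x, ‖u x‖ₑ ^ 2) := by gcongr; exact sum_l2Mass_sq_le F u
        _ = _ := by rw [← mul_assoc]; norm_num
  simp only [heq]
  refine (lintegral_enorm_integral_sq_le (h := fun x v => ∑ j ∈ F, shellTerm b u j x v)
    hsum hK₀0 hv).trans_eq ?_
  rw [ENNReal.ofReal_mul (q := 28) (by positivity), ENNReal.ofReal_ofNat, mul_assoc]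

end GlobalBound

/-! ### Summation over scales and the low frequencies -/

section CubeEstimates

open FourierTransform

variable {n : ℕ}

/-- Counting from the smallest index in `F`, where the term is already at most `1`, makes the bound
independent of `t`. -/
lemma sum_rpow_le_of_one_le {ε t : ℝ} (hε : 0 < ε) (F : Finset ℕ)
    (hF : ∀ j ∈ F, 1 ≤ t * 2 ^ j) :
    ∑ j ∈ F, (t * 2 ^ j) ^ (-ε) ≤ (1 - (1 / 2 : ℝ) ^ ε)⁻¹ := by
  have hr0 : (0 : ℝ) ≤ (1 / 2 : ℝ) ^ ε := by positivity
  have hr1 : (1 / 2 : ℝ) ^ ε < 1 := Real.rpow_lt_one (by norm_num) (by norm_num) hε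
  rcases F.eq_empty_or_nonempty with rfl | hne
  · simpa using hr1.le
  set k := F.min' hne with hk
  have hk1 := hF k (F.min'_mem hne)
  have ht : 0 < t := by
    by_contra h
    have : t * 2 ^ k ≤ 0 := mul_nonpos_of_nonpos_of_nonneg (not_lt.1 h) (by positivity)
    linarith
  calc ∑ j ∈ F, (t * 2 ^ j) ^ (-ε) ≤ ∑ j ∈ F, ((1 / 2 : ℝ) ^ ε) ^ (j - k) := by
        refine Finset.sum_le_sum fun j hj => ?_
        obtain ⟨d, hd⟩ := Nat.exists_eq_add_of_le (F.min'_le j hj)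
        rw [← hk] at hd
        rw [hd, Nat.add_sub_cancel_left, pow_add, ← mul_assoc,
          Real.mul_rpow (by positivity) (by positivity)]
        have h1 : (t * 2 ^ k) ^ (-ε) ≤ 1 := Real.rpow_le_one_of_one_le_of_nonpos hk1 (by linarith)
        have h2 : ((2 : ℝ) ^ d) ^ (-ε) = ((1 / 2 : ℝ) ^ ε) ^ d := by
          rw [← Real.rpow_natCast, ← Real.rpow_natCast, ← Real.rpow_mul (by norm_num),
            ← Real.rpow_mul (by norm_num), one_div, Real.inv_rpow (by norm_num),
            ← Real.rpow_neg (by norm_num)]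
          congr 1; ring
        rw [h2]
        exact mul_le_of_le_one_left (by positivity) h1
    _ = ∑ i ∈ F.image fun j => j - k, ((1 / 2 : ℝ) ^ ε) ^ i := by
        rw [Finset.sum_image]
        intro a ha b hb hab
        have h1 := F.min'_le a ha
        have h2 := F.min'_le b hb
        simp only at hab
        omega
    _ ≤ _ := by
        rw [← tsum_geometric_of_lt_one hr0 hr1]
        exact (summable_geometric_of_lt_one hr0 hr1).sum_le_tsum _ fun i _ => by positivity

lemma sum_le_of_le_one {t : ℝ} (F : Finset ℕ) (hF : ∀ j ∈ F, t * 2 ^ j ≤ 1) :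
    ∑ j ∈ F, t * 2 ^ j ≤ 2 := by
  rcases F.eq_empty_or_nonempty with rfl | hne
  · simp
  set k := F.max' hne with hk
  have hk1 := hF k (F.max'_mem hne)
  calc ∑ j ∈ F, t * 2 ^ j ≤ ∑ j ∈ F, (1 / 2 : ℝ) ^ (k - j) := by
        refine Finset.sum_le_sum fun j hj => ?_
        obtain ⟨d, hd⟩ := Nat.exists_eq_add_of_le (F.le_max' j hj)
        rw [← hk] at hd
        rw [hd, pow_add, ← mul_assoc] at hk1
        rw [hd, Nat.add_sub_cancel_left, one_div, inv_pow, ← one_div, le_div_iff₀ (by positivity)]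
        exact hk1
    _ = ∑ i ∈ F.image fun j => k - j, (1 / 2 : ℝ) ^ i := by
        rw [Finset.sum_image]
        intro a ha b hb hab
        have h1 := F.le_max' a ha
        have h2 := F.le_max' b hb
        simp only at hab
        omega
    _ ≤ 2 := by
        exact (summable_geometric_two.sum_le_tsum _ fun i _ => by positivity).trans_eq
          tsum_geometric_two

/-- Passing from mean squares to means on a cube. -/
lemma setLIntegral_cube_enorm_le {f : Rn n → ℂ} (hf : Continuous f) {c : Rn n} {l a : ℝ}
    (hl : 0 < l) (ha : 0 ≤ a) {M : ℝ≥0∞}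
    (h : ∫⁻ x in cube c l, ‖f x‖ₑ ^ 2 ≤ ENNReal.ofReal (a ^ 2 * l ^ n) * M) :
    ∫⁻ x in cube c l, ‖f x‖ₑ ≤ ENNReal.ofReal (a * l ^ n) * M ^ (1 / 2 : ℝ) := by
  refine (ENNReal.pow_le_pow_left_iff two_ne_zero).1 ?_
  have h1 := ennreal_sq_lintegral_mul_le (volume.restrict (cube c l)) (f := fun _ => 1)
    (g := fun x => ‖f x‖ₑ) aemeasurable_const hf.enorm.measurable.aemeasurable
  simp only [one_mul, one_pow, setLIntegral_const, volume_cube c hl.le] at h1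
  calc _ ≤ ENNReal.ofReal (l ^ n) * (ENNReal.ofReal (a ^ 2 * l ^ n) * M) :=
        h1.trans (by gcongr)
    _ = _ := by
        rw [mul_pow, ← ENNReal.rpow_natCast (M ^ _), ← ENNReal.rpow_mul, ← mul_assoc,
          ← ENNReal.ofReal_mul (by positivity), ← ENNReal.ofReal_pow (by positivity)]
        norm_num
        congr 2; ring

lemma setLIntegral_enorm_sum_le {c : Rn n} {l : ℝ} {M : ℝ≥0∞} {f : ℕ → Rn n → ℂ} {a : ℕ → ℝ}
    {F : Finset ℕ} (hl : 0 < l) (hf : ∀ j, Continuous (f j)) (ha : ∀ j ∈ F, 0 ≤ a j)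
    (h : ∀ j ∈ F, ∫⁻ x in cube c l, ‖f j x‖ₑ ^ 2 ≤ ENNReal.ofReal (a j ^ 2 * l ^ n) * M) :
    ∫⁻ x in cube c l, ‖∑ j ∈ F, f j x‖ₑ ≤
      ENNReal.ofReal ((∑ j ∈ F, a j) * l ^ n) * M ^ (1 / 2 : ℝ) := by
  calc _ ≤ ∫⁻ x in cube c l, ∑ j ∈ F, ‖f j x‖ₑ := lintegral_mono fun x => enorm_sum_le _ _
    _ = ∑ j ∈ F, ∫⁻ x in cube c l, ‖f j x‖ₑ :=
        lintegral_finsetSum _ fun j _ => (hf j).enorm.measurable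
    _ ≤ ∑ j ∈ F, ENNReal.ofReal (a j * l ^ n) * M ^ (1 / 2 : ℝ) :=
        Finset.sum_le_sum fun j hj => setLIntegral_cube_enorm_le (hf j) hl (ha j hj) (h j hj)
    _ = _ := by
        rw [← Finset.sum_mul, Finset.sum_mul F a, ENNReal.ofReal_sum_of_nonneg]
        exact fun j hj => mul_nonneg (ha j hj) (by positivity)

/-- The pointwise kernel bound averaged over the cube. At critical order `B² Λⁿ μⁿ` does not decay
in `Λ`, so any summability must come from an extra gain in `B`. -/
lemma exists_lintegral_cube_pieces_le (n : ℕ) : ∃ C : ℝ, 0 ≤ C ∧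
    ∀ (Λ μ B l : ℝ) (c x₀ : Rn n) (M : ℝ≥0∞) (u : 𝓢(Rn n, ℂ)) (g : Rn n → Rn n → ℂ), 0 < Λ → 0 < μ →
      0 < l → x₀ ∈ cube c l → CubeAvgLE (fun y => ‖u y‖ₑ ^ 2) x₀ M →
      (∀ x ∈ cube c l, IsPiece Λ μ B (g x)) →
      ∫⁻ x in cube c l, ‖freqOp (g x) u x‖ₑ ^ 2 ≤
        ENNReal.ofReal (C * (B ^ 2 * Λ ^ n * μ ^ n) * l ^ n) * M := by
  obtain ⟨C, hC, hpt⟩ := exists_enorm_freqOp_sq_le n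
  refine ⟨C * (16 ^ (n + 1) * (n + 1) ^ (2 * n + 2)), by positivity,
    fun Λ μ B l c x₀ M u g hΛ hμ hl hx₀ hM hg => ?_⟩
  calc _ ≤ ∫⁻ x in cube c l, ENNReal.ofReal (C * B ^ 2 * Λ ^ n) *
        ∫⁻ y, ‖u y‖ₑ ^ 2 * decayWeight (2 * n + 2) μ (y - x) :=
        setLIntegral_mono' (measurableSet_cube _ _) fun x hx => hpt Λ μ B (g x) hΛ hμ (hg x hx) u x
    _ = ENNReal.ofReal (C * B ^ 2 * Λ ^ n) * ∫⁻ x in cube c l,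
        ∫⁻ y, ‖u y‖ₑ ^ 2 * decayWeight (2 * n + 2) μ (y - x) :=
        lintegral_const_mul' _ _ ENNReal.ofReal_ne_top
    _ ≤ ENNReal.ofReal (C * B ^ 2 * Λ ^ n) *
        (ENNReal.ofReal (16 ^ (n + 1) * (n + 1) ^ (2 * n + 2) * l ^ n * μ ^ n) * M) := by
        gcongr
        exact lintegral_cube_lintegral_decayWeight_le (u.continuous.enorm.measurable.pow_const 2)
          hM hl hx₀ hμ
    _ = _ := by
        rw [← mul_assoc (ENNReal.ofReal _), ← ENNReal.ofReal_mul (by positivity)]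
        congr 2; ring

/-- The place where the value of the order is used: squared symbol size, volume in frequency and
volume of the kernel's support scale balance exactly. -/
lemma critical_order_identity (n : ℕ) (ρ : ℝ) {Λ : ℝ} (hΛ : 0 < Λ) :
    (Λ ^ (-((n : ℝ) / 2) * (1 - ρ))) ^ 2 * Λ ^ n * (Λ ^ (-ρ)) ^ n = 1 := by
  rw [← Real.rpow_natCast, ← Real.rpow_natCast, ← Real.rpow_natCast, ← Real.rpow_mul hΛ.le,
    ← Real.rpow_mul hΛ.le, ← Real.rpow_add hΛ, ← Real.rpow_add hΛ]
  rw [show -((n : ℝ) / 2) * (1 - ρ) * ((2 : ℕ) : ℝ) + n + -ρ * n = 0 by push_cast; ring,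
    Real.rpow_zero]

lemma continuous_diagonal {X Z : Type*} [TopologicalSpace X] [TopologicalSpace Z] {f : X → X → Z}
    (hf : Continuous fun p : X × X => f p.1 p.2) : Continuous fun x => f x x :=
  hf.comp (continuous_id.prodMk continuous_id)

lemma SymbolBounds.continuous_freqOp_symbolPiece {m ρ δ A C : ℝ} {b : Rn n → Rn n → ℂ}
    (h : SymbolBounds m ρ δ A b) (j : ℕ) (hC : ∀ x ξ, ‖symbolPiece b j x ξ‖ ≤ C) (u : 𝓢(Rn n, ℂ)) :
    Continuous fun x => freqOp (symbolPiece b j x) u x := by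
  have h1 := continuous_freqOp (b := symbolPiece b j) (h.contDiff_symbolPiece j).continuous hC u
  exact continuous_diagonal (f := fun x y => freqOp (symbolPiece b j x) u y) h1

/-- Contribution of the frequencies below the scale of the cube. -/
lemma exists_low_frequency_bound (n : ℕ) (ρ δ A : ℝ) (hρ0 : 0 ≤ ρ) (hρ1 : ρ ≤ 1) (hδ1 : δ ≤ 1)
    (hA : 0 ≤ A) : ∃ K : ℝ, 0 ≤ K ∧ ∀ b : Rn n → Rn n → ℂ,
      SymbolBounds (-((n : ℝ) / 2) * (1 - ρ)) ρ δ A b → ∀ (u : 𝓢(Rn n, ℂ)) (c x₀ : Rn n) (l : ℝ)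
      (M : ℝ≥0∞) (F : Finset ℕ), 0 < l → x₀ ∈ cube c l → CubeAvgLE (fun y => ‖u y‖ₑ ^ 2) x₀ M →
      (∀ j ∈ F, l * 2 ^ j ≤ 1) →
      ∫⁻ x in cube c l, ‖∑ j ∈ F, (freqOp (symbolPiece b j x) u x - freqOp (symbolPiece b j c) u c)‖ₑ ≤
        ENNReal.ofReal (K * l ^ n) * M ^ (1 / 2 : ℝ) := by
  obtain ⟨C, hC, hcube⟩ := exists_lintegral_cube_pieces_le n
  obtain ⟨D, hD, hpc⟩ := exists_symbolPiece_bounds n (-((n : ℝ) / 2) * (1 - ρ)) ρ δ A hρ0 hρ1 hδ1 hA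
  set a : ℝ := Real.sqrt C * (D * n) with ha
  have ha0 : 0 ≤ a := by positivity
  refine ⟨a * 2, by positivity, fun b hb u c x₀ l M F hl hx₀ hM hF => ?_⟩
  have hbd : ∀ j x ξ, ‖symbolPiece b j x ξ‖ ≤ D * ((2 : ℝ) ^ j) ^ (-((n : ℝ) / 2) * (1 - ρ)) :=
    fun j x ξ => ((hpc b hb j).1 x ξ).1
  have hcont : ∀ j x, Continuous (symbolPiece b j x) := fun j x =>
    (hb.contDiff_symbolPiece_right j x).continuous
  have hTc : ∀ j, Continuous fun x =>
      freqOp (symbolPiece b j x) u x - freqOp (symbolPiece b j c) u c := fun j =>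
    (hb.continuous_freqOp_symbolPiece j (hbd j) u).sub continuous_const
  refine (setLIntegral_enorm_sum_le (M := M) (a := fun j => a * (l * 2 ^ j)) (f := fun j x =>
    freqOp (symbolPiece b j x) u x - freqOp (symbolPiece b j c) u c) hl hTc
    (fun j _ => by positivity) fun j hj => ?_).trans ?_
  · have h2 : (0 : ℝ) < 2 ^ j := by positivity
    set e : Rn n → Rn n → ℂ := fun x ξ =>
      Complex.exp (↑(2 * Real.pi * inner ℝ ξ (c - x)) * Complex.I) with he
    have hes : ∀ x, ContDiff ℝ ∞ (e x) := fun x => by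
      have : ContDiff ℝ ∞ fun ξ : Rn n => (2 * Real.pi * inner ℝ ξ (c - x) : ℝ) :=
        contDiff_const.mul (contDiff_id.inner ℝ contDiff_const)
      exact ((Complex.ofRealCLM.contDiff.comp this).mul contDiff_const).cexp
    -- Both values become one operator at `x`, whose symbol is smaller by the factor `‖c - x‖ 2^j ≤
    -- n l 2^j`.
    have heq : ∀ x, freqOp (symbolPiece b j x) u x - freqOp (symbolPiece b j c) u c =
        freqOp (fun ξ => symbolPiece b j x ξ - e x ξ * symbolPiece b j c ξ) u x := by
      intro x
      have hg : Continuous fun ξ => e x ξ * symbolPiece b j c ξ := (hes x).continuous.mul (hcont j c)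
      have hgb : ∀ ξ, ‖e x ξ * symbolPiece b j c ξ‖ ≤
          D * ((2 : ℝ) ^ j) ^ (-((n : ℝ) / 2) * (1 - ρ)) := by
        intro ξ
        rw [norm_mul, Complex.norm_exp_ofReal_mul_I, one_mul]
        exact hbd j c ξ
      rw [freqOp_sub (hcont j x) hg (hbd j x) hgb, freqOp_modulate]
    simp only [heq]
    refine (hcube (2 ^ j) (((2 : ℝ) ^ j) ^ (-ρ))
      (D * (n * l * 2 ^ j) * ((2 : ℝ) ^ j) ^ (-((n : ℝ) / 2) * (1 - ρ))) l c x₀ M u _ h2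
      (by positivity) hl hx₀ hM fun x hx => ?_).trans_eq ?_
    · have hcx : ‖c - x‖ ≤ n * l := norm_sub_le_of_mem_cube hl.le (self_mem_cube c hl.le) hx
      have hcx' : ‖c - x‖ * 2 ^ j ≤ n := by
        calc ‖c - x‖ * 2 ^ j ≤ n * l * 2 ^ j := by gcongr
          _ = n * (l * 2 ^ j) := by ring
          _ ≤ n * 1 := by gcongr; exact hF j hj
          _ = n := mul_one _
      refine isPiece_of_ptBound ((hb.contDiff_symbolPiece_right j x).sub
        ((hes x).mul (hb.contDiff_symbolPiece_right j c))) (fun ξ hξ => ?_) fun ξ =>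
        ((hpc b hb j).2.2 x c ξ hcx').mono (by positivity) le_rfl (by gcongr)
      rw [symbolPiece_eq_zero b j x ξ hξ, symbolPiece_eq_zero b j c ξ hξ]; simp
    · congr 3
      have h3 := critical_order_identity n ρ h2
      have h4 : Real.sqrt C ^ 2 = C := Real.sq_sqrt hC
      calc _ = C * ((D * (n * l * 2 ^ j)) ^ 2 *
            ((((2 : ℝ) ^ j) ^ (-((n : ℝ) / 2) * (1 - ρ))) ^ 2 * (2 ^ j) ^ n *
              (((2 : ℝ) ^ j) ^ (-ρ)) ^ n)) := by ring
        _ = Real.sqrt C ^ 2 * (D * (n * l * 2 ^ j)) ^ 2 := by rw [h3, h4, mul_one]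
        _ = _ := by rw [ha]; ring
  · gcongr
    rw [← Finset.mul_sum]
    gcongr
    exact sum_le_of_le_one F hF

end CubeEstimates

/-! ### High frequencies for `ρ < 1`: choice of the freezing scale -/

section HighFrequencies

open FourierTransform

variable {n : ℕ}

/-- With `R = (n + 1) μ q` and `q = (sΛ)^{1/2}`, the near part is of size `Rⁿ / (sΛμ)ⁿ ~ q^{-n}` and
the tail of size `(μ / R)^{n+2} ~ q^{-(n+2)}`. Since `n ≥ 1`, both are at most a multiple of `q⁻¹`.
-/
lemma freeze_main_le (hn : 0 < n) {D Bm Λ μ s q : ℝ} (hΛ : 0 < Λ) (hμ : 0 < μ)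
    (hs : 0 < s) (hq1 : 1 ≤ q) (hq : q ^ 2 = s * Λ) (hB : Bm ^ 2 * Λ ^ n * μ ^ n = 1) :
    (D * Bm) ^ 2 * ((s ^ n)⁻¹ + Λ ^ n * (μ / ((n + 1) * (μ * q))) ^ (2 * n + 2)) *
      ((n + 1) * (μ * q)) ^ n ≤ D ^ 2 * ((n + 1) ^ n + 1) * q⁻¹ := by
  have hq0 : 0 < q := by linarith
  have hN : (0 : ℝ) < n + 1 := by positivity
  have e1 : μ / ((n + 1) * (μ * q)) = (((n : ℝ) + 1) * q)⁻¹ := by field_simp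
  have e2 : (s ^ n)⁻¹ = Λ ^ n * ((q ^ n)⁻¹ * (q ^ n)⁻¹) := by
    have : s = q ^ 2 / Λ := by rw [hq]; field_simp
    rw [this, div_pow, ← pow_mul, mul_comm 2 n, pow_mul]
    field_simp
  have e3 : (D * Bm) ^ 2 * ((s ^ n)⁻¹ + Λ ^ n * (μ / ((n + 1) * (μ * q))) ^ (2 * n + 2)) *
      ((n + 1) * (μ * q)) ^ n = D ^ 2 * (Bm ^ 2 * Λ ^ n * μ ^ n) *
        ((n + 1) ^ n * (q ^ n)⁻¹ + ((((n : ℝ) + 1) * q) ^ (n + 2))⁻¹) := by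
    have e4 : ((((n : ℝ) + 1) * q)⁻¹) ^ (2 * n + 2) * (((n : ℝ) + 1) * q) ^ n =
        ((((n : ℝ) + 1) * q) ^ (n + 2))⁻¹ := by
      rw [inv_pow, show 2 * n + 2 = (n + 2) + n by ring, pow_add, mul_inv]
      field_simp
    have e5 : (((n : ℝ) + 1) * (μ * q)) ^ n = μ ^ n * (((n : ℝ) + 1) * q) ^ n := by
      rw [← mul_pow]; congr 1; ring
    rw [e1, e2, e5, ← e4, mul_pow (_ + 1 : ℝ) q n]
    have : q ^ n ≠ 0 := by positivity
    field_simp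
  have h1 : (q ^ n)⁻¹ ≤ q⁻¹ := by
    gcongr
    exact le_self_pow₀ hq1 hn.ne'
  have h2 : ((((n : ℝ) + 1) * q) ^ (n + 2))⁻¹ ≤ q⁻¹ := by
    gcongr
    have h3 : q ≤ ((n : ℝ) + 1) * q := le_mul_of_one_le_left hq0.le (by linarith [n.cast_nonneg (α := ℝ)])
    exact h3.trans (le_self_pow₀ (hq1.trans h3) (by omega))
  rw [e3, hB, mul_one]
  calc _ ≤ D ^ 2 * ((n + 1) ^ n * q⁻¹ + q⁻¹) := by gcongr
    _ = _ := by ring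

lemma mul_sq_add_sq_le {K P S : ℝ} (hK : 0 ≤ K) (hP : 0 < P) (hS : 0 < S) :
    K * (P ^ 2 + S ^ 2) ≤ (2 * Real.sqrt K * (P + S)) ^ 2 := by
  rw [mul_pow, mul_pow, Real.sq_sqrt hK]
  have h1 : P ^ 2 + S ^ 2 ≤ (P + S) ^ 2 := by nlinarith [mul_pos hP hS]
  nlinarith [mul_le_mul_of_nonneg_left h1 hK, mul_nonneg hK (sq_nonneg (P + S))]

set_option maxHeartbeats 1000000 in
/-- Mean square bound for a single high-frequency piece when `ρ ≤ δ < 1`. -/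
lemma exists_high_piece_bound (hn : 0 < n) (ρ δ A : ℝ) (hρ0 : 0 ≤ ρ) (hρδ : ρ ≤ δ) (hδ1 : δ < 1)
    (hA : 0 ≤ A) : ∃ K : ℝ, 0 ≤ K ∧ ∀ b : Rn n → Rn n → ℂ,
      SymbolBounds (-((n : ℝ) / 2) * (1 - ρ)) ρ δ A b → ∀ (u : 𝓢(Rn n, ℂ)) (c x₀ : Rn n) (l : ℝ)
      (M : ℝ≥0∞) (j : ℕ), 0 < l → x₀ ∈ cube c l → CubeAvgLE (fun y => ‖u y‖ₑ ^ 2) x₀ M →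
      1 ≤ l * 2 ^ j → ∫⁻ x in cube c l, ‖freqOp (symbolPiece b j x) u x‖ₑ ^ 2 ≤
        ENNReal.ofReal ((K * ((l * 2 ^ j) ^ (-(1 / 4 : ℝ)) +
          ((1 : ℝ) * 2 ^ j) ^ (-((1 - δ) / 8)))) ^ 2 * l ^ n) * M := by
  obtain ⟨C, hC, hfr⟩ := exists_lintegral_freeze_le n
  obtain ⟨D, hD, hpc⟩ := exists_symbolPiece_bounds n (-((n : ℝ) / 2) * (1 - ρ)) ρ δ A hρ0
    (by linarith) hδ1.le hA
  set K₂ : ℝ := C * (D ^ 2 * ((n + 1) ^ n + 1 + n ^ 2)) with hK₂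
  have hK₂0 : 0 ≤ K₂ := by positivity
  refine ⟨2 * Real.sqrt K₂, by positivity, fun b hb u c x₀ l M j hl hx₀ hM hlj => ?_⟩
  set Λ : ℝ := 2 ^ j with hΛ
  have hΛ1 : 1 ≤ Λ := one_le_pow₀ one_le_two
  have hΛ0 : 0 < Λ := by linarith
  -- An exponent strictly between `δ` and `1`: above `δ` so that the freezing error `s Λ^δ` decays,
  -- below `1` so that `sΛ` still grows unless `s = l`.
  set δ' : ℝ := (1 + δ) / 2 with hδ'
  set s : ℝ := min l (Λ ^ (-δ')) with hs
  have hs0 : 0 < s := lt_min hl (by positivity)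
  have hsl : s ≤ l := min_le_left _ _
  have hsΛ' : s ≤ Λ ^ (-δ') := min_le_right _ _
  have hΛe : Λ ^ (-δ') * Λ = Λ ^ ((1 - δ) / 2) := by
    conv_lhs => rw [← Real.rpow_one Λ, ← Real.rpow_mul hΛ0.le, one_mul, ← Real.rpow_add hΛ0]
    congr 1; rw [hδ']; ring
  have hsΛ1 : 1 ≤ s * Λ := by
    rw [hs, min_mul_of_nonneg _ _ hΛ0.le, hΛe]
    exact le_min hlj (Real.one_le_rpow hΛ1 (by linarith))
  set q : ℝ := Real.sqrt (s * Λ) with hq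
  have hq1 : 1 ≤ q := Real.one_le_sqrt.2 hsΛ1
  have hq2 : q ^ 2 = s * Λ := Real.sq_sqrt (by positivity)
  set μ : ℝ := Λ ^ (-ρ) with hμ
  have hμ0 : 0 < μ := by positivity
  set Bm : ℝ := Λ ^ (-((n : ℝ) / 2) * (1 - ρ)) with hBm
  have hBm0 : 0 < Bm := by positivity
  have hcrit : Bm ^ 2 * Λ ^ n * μ ^ n = 1 := critical_order_identity n ρ hΛ0
  -- Here `ρ ≤ δ` enters, through `ρ ≤ δ'`: the freezing cubes are no larger than the kernel scale,
  -- hence fit into the localisation radius.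
  have hsμ : s ≤ μ := hsΛ'.trans (Real.rpow_le_rpow_of_exponent_le hΛ1 (by rw [hδ']; linarith))
  have hsR : n * s ≤ (n + 1) * (μ * q) := by
    have : s ≤ μ * q := hsμ.trans (le_mul_of_one_le_right hμ0.le hq1)
    have h0 : 0 ≤ μ * q := by positivity
    nlinarith [n.cast_nonneg (α := ℝ)]
  have hR : 0 < ((n : ℝ) + 1) * (μ * q) := by positivity
  have key := hfr Λ μ (D * Bm) (D * (n * s) * Λ ^ (-((n : ℝ) / 2) * (1 - ρ) + δ)) s l
    ((n + 1) * (μ * q)) (symbolPiece b j) hΛ0 hμ0 hs0 hsl hR hsR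
    (hb.contDiff_symbolPiece j).continuous
    (fun z => isPiece_of_ptBound (hb.contDiff_symbolPiece_right j z) (symbolPiece_eq_zero b j z)
      ((hpc b hb j).1 z))
    (fun x z hxz => isPiece_of_ptBound ((hb.contDiff_symbolPiece_right j x).sub
      (hb.contDiff_symbolPiece_right j z)) (fun ξ hξ => by
        rw [symbolPiece_eq_zero b j x ξ hξ, symbolPiece_eq_zero b j z ξ hξ, sub_zero])
      fun ξ => ((hpc b hb j).2.1 x z ξ).mono hμ0.le le_rfl (by gcongr))
    u c x₀ M hx₀ hM
  refine key.trans ?_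
  have hE : ∀ t : ℝ, (Λ ^ t) ^ 2 = Λ ^ (2 * t) := fun t => by
    rw [← Real.rpow_natCast, ← Real.rpow_mul hΛ0.le]; congr 1; push_cast; ring
  have hmain := freeze_main_le hn (D := D) hΛ0 hμ0 hs0 hq1 hq2 hcrit
  set P : ℝ := (l * Λ) ^ (-(1 / 4 : ℝ)) with hP
  set S : ℝ := (1 * Λ) ^ (-((1 - δ) / 8)) with hS
  have hP0 : 0 < P := by positivity
  have hS0 : 0 < S := by positivity
  have hS1 : S ≤ 1 := Real.rpow_le_one_of_one_le_of_nonpos (by linarith) (by linarith)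
  have hP2 : P ^ 2 = (l * Λ) ^ (-(1 / 2 : ℝ)) := by
    rw [hP, ← Real.rpow_natCast, ← Real.rpow_mul (by positivity)]; norm_num
  have hS2 : S ^ 2 = Λ ^ (-((1 - δ) / 4)) := by
    rw [hS, one_mul, hE]; congr 1; ring
  -- `q⁻¹ = (sΛ)^{-1/2}` equals `(lΛ)^{-1/2}` or `Λ^{-(1-δ)/4}` according to which entry of the
  -- minimum is `s`. The exponents `1/4` and `(1-δ)/8` of `P` and `S` are half of these, as mean
  -- squares are being estimated.
  have hqinv : q⁻¹ ≤ P ^ 2 + S ^ 2 := by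
    have e1 : q⁻¹ = (s * Λ) ^ (-(1 / 2 : ℝ)) := by
      rw [hq, Real.sqrt_eq_rpow, ← Real.rpow_neg (by positivity)]
    have e2 : (Λ ^ (-δ') * Λ) ^ (-(1 / 2 : ℝ)) = S ^ 2 := by
      rw [hΛe, ← Real.rpow_mul hΛ0.le, hS2]; congr 1; ring
    rw [e1, hP2]
    rcases min_choice l (Λ ^ (-δ')) with h | h
    · rw [hs, h]; linarith [sq_nonneg S]
    · rw [hs, h, e2]
      have : 0 < (l * Λ) ^ (-(1 / 2 : ℝ)) := by positivity
      linarith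
  have herr : (D * (n * s) * Λ ^ (-((n : ℝ) / 2) * (1 - ρ) + δ)) ^ 2 * Λ ^ n * μ ^ n ≤
      D ^ 2 * n ^ 2 * S ^ 2 := by
    have e1 : (D * (n * s) * Λ ^ (-((n : ℝ) / 2) * (1 - ρ) + δ)) ^ 2 * Λ ^ n * μ ^ n =
        D ^ 2 * n ^ 2 * (s * Λ ^ δ) ^ 2 * (Bm ^ 2 * Λ ^ n * μ ^ n) := by
      rw [Real.rpow_add hΛ0]; ring
    rw [e1, hcrit, mul_one]
    gcongr
    calc s * Λ ^ δ ≤ Λ ^ (-δ') * Λ ^ δ := by gcongr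
      _ = Λ ^ (-δ' + δ) := (Real.rpow_add hΛ0 _ _).symm
      _ ≤ S := by
        rw [hS, one_mul]
        exact Real.rpow_le_rpow_of_exponent_le hΛ1 (by rw [hδ']; linarith)
  refine mul_le_mul_left (ENNReal.ofReal_le_ofReal ?_) _
  refine mul_le_mul_of_nonneg_right ?_ (by positivity)
  calc _ ≤ C * (D ^ 2 * ((n + 1) ^ n + 1) * q⁻¹ + D ^ 2 * n ^ 2 * S ^ 2) := by gcongr
    _ ≤ C * (D ^ 2 * ((n + 1) ^ n + 1) * (P ^ 2 + S ^ 2) + D ^ 2 * n ^ 2 * (P ^ 2 + S ^ 2)) := by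
        gcongr
        linarith [sq_nonneg P]
    _ = K₂ * (P ^ 2 + S ^ 2) := by rw [hK₂]; ring
    _ ≤ _ := mul_sq_add_sq_le hK₂0 hP0 hS0

/-- Contribution of the frequencies above the scale of the cube, for `ρ ≤ δ`. -/
lemma exists_high_frequency_bound (hn : 0 < n) (ρ δ A : ℝ) (hρ0 : 0 ≤ ρ) (hρδ : ρ ≤ δ) (hδ1 : δ < 1)
    (hA : 0 ≤ A) : ∃ K : ℝ, 0 ≤ K ∧ ∀ b : Rn n → Rn n → ℂ,
      SymbolBounds (-((n : ℝ) / 2) * (1 - ρ)) ρ δ A b → ∀ (u : 𝓢(Rn n, ℂ)) (c x₀ : Rn n) (l : ℝ)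
      (M : ℝ≥0∞) (F : Finset ℕ), 0 < l → x₀ ∈ cube c l → CubeAvgLE (fun y => ‖u y‖ₑ ^ 2) x₀ M →
      (∀ j ∈ F, 1 ≤ l * 2 ^ j) →
      ∫⁻ x in cube c l, ‖∑ j ∈ F, freqOp (symbolPiece b j x) u x‖ₑ ≤
        ENNReal.ofReal (K * l ^ n) * M ^ (1 / 2 : ℝ) := by
  obtain ⟨K, hK, hpiece⟩ := exists_high_piece_bound hn ρ δ A hρ0 hρδ hδ1 hA
  obtain ⟨D, hD, hpc⟩ := exists_symbolPiece_bounds n (-((n : ℝ) / 2) * (1 - ρ)) ρ δ A hρ0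
    (by linarith) hδ1.le hA
  set G : ℝ := (1 - (1 / 2 : ℝ) ^ (1 / 4 : ℝ))⁻¹ + (1 - (1 / 2 : ℝ) ^ ((1 - δ) / 8))⁻¹ with hG
  have hG0 : 0 ≤ G := by
    have h1 : (1 / 2 : ℝ) ^ (1 / 4 : ℝ) < 1 :=
      Real.rpow_lt_one (by norm_num) (by norm_num) (by norm_num)
    have h2 : (1 / 2 : ℝ) ^ ((1 - δ) / 8) < 1 :=
      Real.rpow_lt_one (by norm_num) (by norm_num) (by linarith)
    exact add_nonneg (inv_nonneg.2 (by linarith)) (inv_nonneg.2 (by linarith))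
  refine ⟨K * G, by positivity, fun b hb u c x₀ l M F hl hx₀ hM hF => ?_⟩
  have hTc : ∀ j, Continuous fun x => freqOp (symbolPiece b j x) u x := fun j =>
    hb.continuous_freqOp_symbolPiece j (fun x ξ => ((hpc b hb j).1 x ξ).1) u
  refine (setLIntegral_enorm_sum_le (M := M) (f := fun j x => freqOp (symbolPiece b j x) u x)
    (a := fun j => K * ((l * 2 ^ j) ^ (-(1 / 4 : ℝ)) + ((1 : ℝ) * 2 ^ j) ^ (-((1 - δ) / 8))))
    hl hTc (fun j _ => by positivity)
    fun j hj => hpiece b hb u c x₀ l M j hl hx₀ hM (hF j hj)).trans ?_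
  gcongr
  rw [← Finset.mul_sum, Finset.sum_add_distrib]
  gcongr
  -- The second sum is the case `t = 1`, which is why its terms carry a factor `1`.
  exact add_le_add (sum_rpow_le_of_one_le (by norm_num) F hF)
    (sum_rpow_le_of_one_le (by linarith) F fun j _ => by
      rw [one_mul]; exact one_le_pow₀ one_le_two)

lemma locSq_le_of_cubeAvgLE (u : 𝓢(Rn n, ℂ)) {c x₀ : Rn n} {R : ℝ} {M : ℝ≥0∞} (hR : 0 < R)
    (hM : CubeAvgLE (fun y => ‖u y‖ₑ ^ 2) x₀ M) (hc : ‖x₀ - c‖ ≤ R) :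
    locSq u R c ≤ ENNReal.ofReal (2 ^ (2 * n + 2) * 4 ^ (n + 1) * R ^ n) * M := by
  have hpt : ∀ y, ‖u y‖ₑ ^ 2 * decayWeight (2 * n + 2) R (y - c) ≤
      ENNReal.ofReal (2 ^ (2 * n + 2)) * (‖u y‖ₑ ^ 2 * decayWeight (n + 1) R (y - x₀)) := by
    intro y
    have h1 : decayWeight (2 * n + 2) R (y - c) ≤
        ENNReal.ofReal (2 ^ (2 * n + 2)) * decayWeight (2 * n + 2) R (y - x₀) := by
      refine decayWeight_le_of_le hR hR ?_
      have h2 : ‖y - x₀‖ ≤ ‖y - c‖ + R := by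
        calc ‖y - x₀‖ = ‖(y - c) - (x₀ - c)‖ := by congr 1; abel
          _ ≤ ‖y - c‖ + ‖x₀ - c‖ := norm_sub_le _ _
          _ ≤ _ := by gcongr
      have h3 : ‖y - x₀‖ / R ≤ ‖y - c‖ / R + 1 := by
        rw [div_add_one hR.ne']; gcongr
      have : 0 ≤ ‖y - c‖ / R := by positivity
      linarith
    have h4 : decayWeight (2 * n + 2) R (y - x₀) ≤ decayWeight (n + 1) R (y - x₀) := by
      rw [show 2 * n + 2 = (n + 1) + (n + 1) by ring, decayWeight_add _ _ hR]
      exact mul_le_of_le_one_right' (decayWeight_le_one _ hR _)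
    calc _ ≤ ‖u y‖ₑ ^ 2 * (ENNReal.ofReal (2 ^ (2 * n + 2)) * decayWeight (n + 1) R (y - x₀)) := by
          gcongr
          exact h1.trans (by gcongr)
      _ = _ := by ring
  rw [locSq]
  refine (lintegral_mono hpt).trans ?_
  rw [lintegral_const_mul' _ _ ENNReal.ofReal_ne_top]
  refine (mul_le_mul_right (lintegral_mul_decayWeight_le
    (u.continuous.enorm.measurable.pow_const 2) hM hR) _).trans_eq ?_
  rw [← mul_assoc (ENNReal.ofReal _), ← ENNReal.ofReal_mul (by positivity)]
  congr 2; ring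

end HighFrequencies

/-! ### High frequencies for `ρ = 1`, passage to the limit, and the theorem -/

section Conclusion

open FourierTransform Filter

variable {n : ℕ}

/-- For `μ = Λ⁻¹` and `R = (n + 1) l` the powers combine to `(RΛ)^{-(n+2)} ≤ (lΛ)^{-2}`. The square
is displayed for the passage from mean squares to means. -/
lemma far_piece_constant_le {C D L l Λ : ℝ} (hC : 0 ≤ C) (hL : 0 ≤ L) (hl : 0 < l)
    (hΛ : 0 < Λ) (hlΛ : 1 ≤ l * Λ) :
    C * D ^ 2 * Λ ^ n * (4 * (Λ⁻¹ / ((n + 1) * l))) ^ (2 * n + 2) * (L * ((n + 1) * l) ^ n) ≤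
      (Real.sqrt (C * D ^ 2 * 4 ^ (2 * n + 2) * L) * (l * Λ) ^ (-(1 : ℝ))) ^ 2 := by
  set R : ℝ := (n + 1) * l with hR
  have hR0 : 0 < R := by positivity
  have hlR : l * Λ ≤ R * Λ := by
    rw [hR]
    gcongr
    exact le_mul_of_one_le_left hl.le (by linarith [n.cast_nonneg (α := ℝ)])
  have e1 : C * D ^ 2 * Λ ^ n * (4 * (Λ⁻¹ / R)) ^ (2 * n + 2) * (L * R ^ n) =
      C * D ^ 2 * 4 ^ (2 * n + 2) * L * ((R * Λ) ^ (n + 2))⁻¹ := by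
    have h1 : Λ⁻¹ / R = (R * Λ)⁻¹ := by field_simp
    have h2 : ((R * Λ)⁻¹) ^ (2 * n + 2) * (R * Λ) ^ n = ((R * Λ) ^ (n + 2))⁻¹ := by
      rw [inv_pow, show 2 * n + 2 = (n + 2) + n by ring, pow_add, mul_inv]
      field_simp
    rw [h1, ← h2, mul_pow, mul_pow R Λ n]
    ring
  rw [e1, mul_pow (Real.sqrt _), Real.sq_sqrt (by positivity), Real.rpow_neg_one, inv_pow]
  gcongr
  calc (l * Λ) ^ 2 ≤ (R * Λ) ^ 2 := by gcongr
    _ ≤ (R * Λ) ^ (n + 2) := pow_le_pow_right₀ (hlΛ.trans hlR) (by omega)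

/-- Contribution of the frequencies above the scale of the cube, for `ρ = 1`. -/
lemma exists_high_frequency_bound_one (n : ℕ) (δ A : ℝ) (hδ0 : 0 ≤ δ) (hδ1 : δ < 1) (hA : 0 ≤ A) :
    ∃ K : ℝ, 0 ≤ K ∧ ∀ b : Rn n → Rn n → ℂ,
      SymbolBounds 0 1 δ A b → ∀ (u : 𝓢(Rn n, ℂ)) (c x₀ : Rn n) (l : ℝ)
      (M : ℝ≥0∞) (F : Finset ℕ), 0 < l → x₀ ∈ cube c l → CubeAvgLE (fun y => ‖u y‖ₑ ^ 2) x₀ M →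
      (∀ j ∈ F, 1 ≤ l * 2 ^ j) →
      ∫⁻ x in cube c l, ‖∑ j ∈ F, freqOp (symbolPiece b j x) u x‖ₑ ≤
        ENNReal.ofReal (K * l ^ n) * M ^ (1 / 2 : ℝ) := by
  obtain ⟨C₁, hC₁, hglob⟩ := exists_lintegral_sum_freqOp_le n δ A hδ0 hδ1 hA
  obtain ⟨C, hC, hpt⟩ := exists_enorm_freqOp_sq_le n
  obtain ⟨D, hD, hpc⟩ := exists_symbolPiece_bounds n 0 1 δ A zero_le_one le_rfl hδ1.le hA
  set L : ℝ := 2 ^ (2 * n + 2) * 4 ^ (n + 1) with hL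
  have hL0 : 0 ≤ L := by positivity
  set a : ℝ := Real.sqrt (C₁ * 5 ^ (2 * n + 2) * L * (n + 1) ^ n) with ha
  set E : ℝ := Real.sqrt (C * D ^ 2 * 4 ^ (2 * n + 2) * L) with hE
  set G : ℝ := (1 - (1 / 2 : ℝ) ^ (1 : ℝ))⁻¹ with hG
  have hG0 : 0 ≤ G := by rw [hG]; norm_num
  refine ⟨a + E * G, by positivity, fun b hb u c x₀ l M F hl hx₀ hM hF => ?_⟩
  set R : ℝ := (n + 1) * l with hR
  have hR0 : 0 < R := by positivity
  obtain ⟨u₁, u₂, hu, hu₁, hu₂, hz₁, hz₂⟩ := exists_cutoff u c hR0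
  have hbd : ∀ j x ξ, ‖symbolPiece b j x ξ‖ ≤ D * ((2 : ℝ) ^ j) ^ (0 : ℝ) :=
    fun j x ξ => ((hpc b hb j).1 x ξ).1
  have hTc : ∀ (w : 𝓢(Rn n, ℂ)) j, Continuous fun x => freqOp (symbolPiece b j x) w x := fun w j =>
    hb.continuous_freqOp_symbolPiece j (hbd j) w
  have hnl : ∀ x ∈ cube c l, ‖x - c‖ ≤ R := fun x hx => by
    refine (norm_sub_le_of_mem_cube hl.le hx (self_mem_cube c hl.le)).trans ?_
    rw [hR]; gcongr; linarith
  have hloc : locSq u R c ≤ ENNReal.ofReal (L * R ^ n) * M :=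
    locSq_le_of_cubeAvgLE u hR0 hM (hnl x₀ hx₀)
  -- Near the cube the pieces have no individual gain, so the global `L²` bound is applied to the
  -- whole sum.
  have hnear : ∫⁻ x in cube c l, ‖∑ j ∈ F, freqOp (symbolPiece b j x) u₁ x‖ₑ ≤
      ENNReal.ofReal (a * l ^ n) * M ^ (1 / 2 : ℝ) := by
    refine setLIntegral_cube_enorm_le (continuous_finsetSum _ fun j _ => hTc u₁ j) hl
      (Real.sqrt_nonneg _) ?_
    calc _ ≤ ∫⁻ x, ‖∑ j ∈ F, freqOp (symbolPiece b j x) u₁ x‖ₑ ^ 2 := setLIntegral_le_lintegral _ _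
      _ ≤ ENNReal.ofReal C₁ * ∫⁻ x, ‖u₁ x‖ₑ ^ 2 := hglob b hb F u₁
      _ ≤ ENNReal.ofReal C₁ * (ENNReal.ofReal (5 ^ (2 * n + 2)) *
          (ENNReal.ofReal (L * R ^ n) * M)) := by
          gcongr
          exact (lintegral_enorm_sq_le_locSq hR0 hu₁ hz₁).trans (by gcongr)
      _ = _ := by
          rw [← mul_assoc (ENNReal.ofReal (5 ^ _)), ← ENNReal.ofReal_mul (by positivity),
            ← mul_assoc, ← ENNReal.ofReal_mul hC₁, Real.sq_sqrt (by positivity), hR, mul_pow]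
          congr 2; ring
  -- Away from the cube each kernel has decayed by `(l 2^j)^{-1}`, and the pieces are summed one by
  -- one.
  have hfar : ∫⁻ x in cube c l, ‖∑ j ∈ F, freqOp (symbolPiece b j x) u₂ x‖ₑ ≤
      ENNReal.ofReal ((∑ j ∈ F, E * (l * 2 ^ j) ^ (-(1 : ℝ))) * l ^ n) * M ^ (1 / 2 : ℝ) := by
    refine setLIntegral_enorm_sum_le (M := M) (f := fun j x => freqOp (symbolPiece b j x) u₂ x)
      (a := fun j => E * (l * 2 ^ j) ^ (-(1 : ℝ))) hl (hTc u₂)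
      (fun j _ => by positivity) fun j hj => ?_
    have h2 : (0 : ℝ) < 2 ^ j := by positivity
    have hpiece : ∀ x, IsPiece (2 ^ j) ((2 : ℝ) ^ j)⁻¹ D (symbolPiece b j x) := by
      intro x
      have := isPiece_of_ptBound (hb.contDiff_symbolPiece_right j x) (symbolPiece_eq_zero b j x)
        ((hpc b hb j).1 x)
      rw [Real.rpow_neg_one, Real.rpow_zero, mul_one] at this
      exact this
    calc ∫⁻ x in cube c l, ‖freqOp (symbolPiece b j x) u₂ x‖ₑ ^ 2
        ≤ ∫⁻ _x in cube c l, ENNReal.ofReal (C * D ^ 2 * (2 ^ j) ^ n) *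
          (ENNReal.ofReal ((4 * (((2 : ℝ) ^ j)⁻¹ / R)) ^ (2 * n + 2)) *
            (ENNReal.ofReal (L * R ^ n) * M)) := by
          refine setLIntegral_mono' (measurableSet_cube _ _) fun x hx => ?_
          refine (hpt _ _ _ _ h2 (inv_pos.2 h2) (hpiece x) u₂ x).trans ?_
          gcongr
          exact (locSq_le_of_eq_zero (inv_pos.2 h2) hR0 (hnl x hx) hu₂ hz₂).trans (by gcongr)
      _ = ENNReal.ofReal (C * D ^ 2 * (2 ^ j) ^ n * (4 * (((2 : ℝ) ^ j)⁻¹ / R)) ^ (2 * n + 2) *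
            (L * R ^ n) * l ^ n) * M := by
          rw [setLIntegral_const, volume_cube c hl.le, ENNReal.ofReal_mul (q := l ^ n) (by positivity),
            ENNReal.ofReal_mul (q := L * R ^ n) (by positivity),
            ENNReal.ofReal_mul (q := (4 * (((2 : ℝ) ^ j)⁻¹ / R)) ^ (2 * n + 2)) (by positivity)]
          ring
      _ ≤ _ := by
          refine mul_le_mul_left (ENNReal.ofReal_le_ofReal ?_) _
          refine mul_le_mul_of_nonneg_right ?_ (by positivity)
          exact far_piece_constant_le hC hL0 hl h2 (hF j hj)
  have hsplit : ∀ x, ∑ j ∈ F, freqOp (symbolPiece b j x) u x =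
      ∑ j ∈ F, freqOp (symbolPiece b j x) u₁ x + ∑ j ∈ F, freqOp (symbolPiece b j x) u₂ x := by
    intro x
    rw [← Finset.sum_add_distrib]
    refine Finset.sum_congr rfl fun j _ => ?_
    rw [hu, freqOp_add_right (hb.contDiff_symbolPiece_right j x).continuous (hbd j x)]
  have hm₁ : Measurable fun x => ‖∑ j ∈ F, freqOp (symbolPiece b j x) u₁ x‖ₑ :=
    (continuous_finsetSum _ fun j _ => hTc u₁ j).enorm.measurable
  calc _ ≤ ∫⁻ x in cube c l, (‖∑ j ∈ F, freqOp (symbolPiece b j x) u₁ x‖ₑ +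
        ‖∑ j ∈ F, freqOp (symbolPiece b j x) u₂ x‖ₑ) := by
        refine lintegral_mono fun x => ?_
        simp only [hsplit]
        exact enorm_add_le _ _
    _ ≤ ENNReal.ofReal (a * l ^ n) * M ^ (1 / 2 : ℝ) +
        ENNReal.ofReal (E * G * l ^ n) * M ^ (1 / 2 : ℝ) := by
        rw [lintegral_add_left hm₁]
        refine add_le_add hnear (hfar.trans ?_)
        gcongr
        rw [← Finset.mul_sum]
        gcongr
        exact sum_rpow_le_of_one_le one_pos F hF
    _ = _ := by
        rw [← add_mul, ← ENNReal.ofReal_add (by positivity) (by positivity), add_mul]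

lemma sum_freqOp_symbolPiece {b : Rn n → Rn n → ℂ} {A : ℝ} (u : 𝓢(Rn n, ℂ)) (x : Rn n)
    (hb : Continuous (b x)) (hA : ∀ ξ, ‖b x ξ‖ ≤ A) (J : ℕ) :
    ∑ j ∈ Finset.range (J + 1), freqOp (symbolPiece b j x) u x =
      freqOp (fun ξ => lowCut J ξ * b x ξ) u x := by
  have hbd : ∀ j ξ, ‖symbolPiece b j x ξ‖ ≤ 2 * A := by
    intro j ξ
    have hd : ‖(dyadicCut j ξ : ℂ)‖ ≤ 2 := by
      cases j with
      | zero => exact (norm_lowCut_le 0 ξ).trans one_le_two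
      | succ j =>
        refine (norm_sub_le _ _).trans ?_
        linarith [norm_lowCut_le (j + 1) ξ, norm_lowCut_le j ξ]
    rw [symbolPiece, norm_mul]
    exact mul_le_mul hd (hA ξ) (norm_nonneg _) zero_le_two
  have hc : ∀ j, Continuous (symbolPiece b j x) := fun j => (contDiff_dyadicCut j).continuous.mul hb
  simp only [freqOp_eq_integral]
  rw [← integral_finsetSum _ fun j _ => integrable_freqOp (hc j) (hbd j) u x]
  refine integral_congr_ae (Eventually.of_forall fun ξ => ?_)
  simp only [symbolPiece]
  rw [← sum_dyadicCut, Finset.sum_mul, Finset.sum_mul, Finset.mul_sum]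

lemma tendsto_freqOp_lowCut {f : Rn n → ℂ} {A : ℝ} (u : 𝓢(Rn n, ℂ)) (x : Rn n)
    (hf : Continuous f) (hA : ∀ ξ, ‖f ξ‖ ≤ A) :
    Tendsto (fun J : ℕ => freqOp (fun ξ => lowCut J ξ * f ξ) u x) atTop (nhds (freqOp f u x)) := by
  simp only [freqOp_eq_integral]
  have hu : Continuous (𝓕 (u : Rn n → ℂ)) := (𝓕 u).continuous
  refine tendsto_integral_of_dominated_convergence (fun ξ => A * ‖𝓕 (u : Rn n → ℂ) ξ‖)
    (fun J => ?_) ((𝓕 u).integrable.norm.const_mul A) (fun J => Eventually.of_forall fun ξ => ?_)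
    (Eventually.of_forall fun ξ => ?_)
  · have hc : Continuous (lowCut J : Rn n → ℂ) := (contDiff_lowCut J).continuous
    exact Continuous.aestronglyMeasurable (by fun_prop)
  · rw [norm_mul, Complex.norm_exp_ofReal_mul_I, one_mul, norm_mul, norm_mul]
    gcongr
    calc ‖lowCut J ξ‖ * ‖f ξ‖ ≤ 1 * A :=
          mul_le_mul (norm_lowCut_le J ξ) (hA ξ) (norm_nonneg _) zero_le_one
      _ = A := one_mul A
  · refine tendsto_const_nhds.congr' ?_
    have h := tendsto_pow_atTop_atTop_of_one_lt (one_lt_two (α := ℝ))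
    filter_upwards [h.eventually_ge_atTop ‖ξ‖] with J hJ
    rw [lowCut_eq_one hJ, one_mul]

/-- Oscillation over a cube, from the bounds for low and high frequencies. -/
lemma exists_setLIntegral_sub_le {b : Rn n → Rn n → ℂ} {A : ℝ} (u : 𝓢(Rn n, ℂ)) {c : Rn n} {l : ℝ}
    (hl : 0 < l) (hb : Continuous fun p : Rn n × Rn n => b p.1 p.2) (hA : ∀ x ξ, ‖b x ξ‖ ≤ A)
    (hTc : ∀ j, Continuous fun x => freqOp (symbolPiece b j x) u x) {E₁ E₂ : ℝ≥0∞}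
    (hlow : ∀ F : Finset ℕ, (∀ j ∈ F, l * 2 ^ j ≤ 1) → ∫⁻ x in cube c l,
      ‖∑ j ∈ F, (freqOp (symbolPiece b j x) u x - freqOp (symbolPiece b j c) u c)‖ₑ ≤ E₁)
    (hhigh : ∀ F : Finset ℕ, (∀ j ∈ F, 1 ≤ l * 2 ^ j) →
      ∫⁻ x in cube c l, ‖∑ j ∈ F, freqOp (symbolPiece b j x) u x‖ₑ ≤ E₂) :
    ∃ c₀ : ℂ, ∫⁻ x in cube c l, ‖freqOp (b x) u x - c₀‖ₑ ≤ E₁ + E₂ := by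
  classical
  -- All indices from `N` on are high, so the set of low indices, and with it the constant `c₀`,
  -- does not depend on the partial sum.
  obtain ⟨N, hN⟩ : ∃ N : ℕ, 1 < l * 2 ^ N := by
    obtain ⟨N, hN⟩ := pow_unbounded_of_one_lt l⁻¹ (one_lt_two (α := ℝ))
    exact ⟨N, by rwa [inv_lt_iff_one_lt_mul₀' hl] at hN⟩
  set L : Finset ℕ := (Finset.range N).filter fun j => l * 2 ^ j ≤ 1 with hL
  set c₀ : ℂ := ∑ j ∈ L, freqOp (symbolPiece b j c) u c with hc₀
  have hbx : ∀ x, Continuous (b x) := fun x => continuous_section hb x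
  set T : ℕ → Rn n → ℂ := fun j x => freqOp (symbolPiece b j x) u x with hT
  set S : ℕ → Rn n → ℂ := fun J x => ∑ j ∈ Finset.range (J + N + 1), T j x with hS
  have hlim : ∀ x, Tendsto (fun J => ‖S J x - c₀‖ₑ) atTop (nhds ‖freqOp (b x) u x - c₀‖ₑ) := by
    intro x
    have h1 := (tendsto_freqOp_lowCut u x (hbx x) (hA x)).comp (tendsto_add_atTop_nat N)
    have h2 : (fun J => S J x) = (fun J : ℕ => freqOp (fun ξ => lowCut J ξ * b x ξ) u x) ∘
        fun J => J + N := by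
      ext J
      exact sum_freqOp_symbolPiece u x (hbx x) (hA x) (J + N)
    rw [← h2] at h1
    exact (h1.sub_const c₀).enorm
  have hSc : ∀ J, Continuous (S J) := fun J => continuous_finsetSum _ fun j _ => hTc j
  have hbound : ∀ J, ∫⁻ x in cube c l, ‖S J x - c₀‖ₑ ≤ E₁ + E₂ := by
    intro J
    have hsub : L ⊆ Finset.range (J + N + 1) := fun j hj => by
      rw [hL, Finset.mem_filter, Finset.mem_range] at hj
      rw [Finset.mem_range]; omega
    have hdec : ∀ x, S J x - c₀ = ∑ j ∈ L, (T j x - T j c) +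
        ∑ j ∈ Finset.range (J + N + 1) \ L, T j x := by
      intro x
      rw [hS, hc₀]
      simp only
      rw [← Finset.sum_sdiff hsub, Finset.sum_sub_distrib]
      ring
    have hm : Measurable fun x => ‖∑ j ∈ L, (T j x - T j c)‖ₑ :=
      (continuous_finsetSum _ fun j _ => (hTc j).sub continuous_const).enorm.measurable
    calc _ ≤ ∫⁻ x in cube c l, (‖∑ j ∈ L, (T j x - T j c)‖ₑ +
          ‖∑ j ∈ Finset.range (J + N + 1) \ L, T j x‖ₑ) := by
          refine lintegral_mono fun x => ?_
          rw [hdec]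
          exact enorm_add_le _ _
      _ ≤ _ := by
          rw [lintegral_add_left hm]
          refine add_le_add (hlow L fun j hj => (Finset.mem_filter.1 hj).2) (hhigh _ fun j hj => ?_)
          rw [Finset.mem_sdiff, hL, Finset.mem_filter, Finset.mem_range, not_and, not_le] at hj
          by_cases hjN : j < N
          · exact (hj.2 (Finset.mem_range.2 hjN)).le
          · refine hN.le.trans ?_
            gcongr
            · norm_num
            · omega
  refine ⟨c₀, ?_⟩
  -- Fatou's lemma, along the pointwise convergence of the partial sums.
  calc ∫⁻ x in cube c l, ‖freqOp (b x) u x - c₀‖ₑ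
      = ∫⁻ x in cube c l, liminf (fun J => ‖S J x - c₀‖ₑ) atTop :=
        lintegral_congr fun x => (hlim x).liminf_eq.symm
    _ ≤ liminf (fun J => ∫⁻ x in cube c l, ‖S J x - c₀‖ₑ) atTop :=
        lintegral_liminf_le fun J => ((hSc J).sub continuous_const).enorm.measurable
    _ ≤ E₁ + E₂ := liminf_le_of_frequently_le' (Frequently.of_forall hbound)

/-- Oscillation of a pseudo-differential operator of critical order over a cube. -/
lemma exists_oscillation_bound (hn : 0 < n) (ρ δ A : ℝ) (hρ0 : 0 ≤ ρ) (hρ1 : ρ ≤ 1) (hδ0 : 0 ≤ δ)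
    (hδ1 : δ < 1) (hA : 0 ≤ A) : ∃ K : ℝ, 0 ≤ K ∧ ∀ b : Rn n → Rn n → ℂ,
      SymbolBounds (-((n : ℝ) / 2) * (1 - ρ)) ρ δ A b → ∀ (u : 𝓢(Rn n, ℂ)) (c x₀ : Rn n) (l : ℝ)
      (M : ℝ≥0∞), 0 < l → x₀ ∈ cube c l → CubeAvgLE (fun y => ‖u y‖ₑ ^ 2) x₀ M →
      ∃ c₀ : ℂ, ∫⁻ x in cube c l, ‖freqOp (b x) u x - c₀‖ₑ ≤
        ENNReal.ofReal (K * l ^ n) * M ^ (1 / 2 : ℝ) := by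
  obtain ⟨D, hD, hpc⟩ := exists_symbolPiece_bounds n (-((n : ℝ) / 2) * (1 - ρ)) ρ δ A hρ0 hρ1 hδ1.le hA
  obtain ⟨K₁, hK₁, hlow⟩ := exists_low_frequency_bound n ρ δ A hρ0 hρ1 hδ1.le hA
  obtain ⟨K₂, hK₂, hhigh⟩ : ∃ K : ℝ, 0 ≤ K ∧ ∀ b : Rn n → Rn n → ℂ,
      SymbolBounds (-((n : ℝ) / 2) * (1 - ρ)) ρ δ A b → ∀ (u : 𝓢(Rn n, ℂ)) (c x₀ : Rn n) (l : ℝ)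
      (M : ℝ≥0∞) (F : Finset ℕ), 0 < l → x₀ ∈ cube c l → CubeAvgLE (fun y => ‖u y‖ₑ ^ 2) x₀ M →
      (∀ j ∈ F, 1 ≤ l * 2 ^ j) →
      ∫⁻ x in cube c l, ‖∑ j ∈ F, freqOp (symbolPiece b j x) u x‖ₑ ≤
        ENNReal.ofReal (K * l ^ n) * M ^ (1 / 2 : ℝ) := by
    -- For `ρ < 1` the class only grows when `δ` is replaced by `max ρ δ`, still below `1`. For `ρ =
    -- 1` the critical order is `0`.
    rcases hρ1.lt_or_eq with h | rfl
    · obtain ⟨K, hK, hhigh⟩ := exists_high_frequency_bound hn ρ (max ρ δ) A hρ0 (le_max_left _ _)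
        (max_lt h hδ1) hA
      exact ⟨K, hK, fun b hb => hhigh b (hb.mono (le_max_right _ _))⟩
    · simp only [sub_self, mul_zero]
      exact exists_high_frequency_bound_one n δ A hδ0 hδ1 hA
  refine ⟨K₁ + K₂, by positivity, fun b hb u c x₀ l M hl hx₀ hM => ?_⟩
  have hbd : ∀ x ξ, ‖b x ξ‖ ≤ A := fun x ξ => by
    refine (hb.bound x ξ).1.trans (mul_le_of_le_one_right hA ?_)
    refine Real.rpow_le_one_of_one_le_of_nonpos (by linarith [norm_nonneg ξ]) ?_
    have : 0 ≤ (n : ℝ) / 2 * (1 - ρ) := mul_nonneg (by positivity) (by linarith)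
    linarith
  obtain ⟨c₀, hc₀⟩ := exists_setLIntegral_sub_le u hl hb.smooth.continuous hbd
    (fun j => hb.continuous_freqOp_symbolPiece j (fun x ξ => ((hpc b hb j).1 x ξ).1) u)
    (fun F hF => hlow b hb u c x₀ l M F hl hx₀ hM hF)
    (fun F hF => hhigh b hb u c x₀ l M F hl hx₀ hM hF)
  refine ⟨c₀, hc₀.trans_eq ?_⟩
  rw [← add_mul, ← ENNReal.ofReal_add (by positivity) (by positivity), add_mul]

lemma cubeAvgLE_maximalFun (u : 𝓢(Rn n, ℂ)) (x : Rn n) :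
    CubeAvgLE (fun y => ‖u y‖ₑ ^ 2) x (maximalFun (fun y => ‖u y‖ ^ 2) x) := by
  intro z l hl hx
  have h : avg (cube z l) (fun y => ‖‖u y‖ ^ 2‖ₑ) ≤ maximalFun (fun y => ‖u y‖ ^ 2) x :=
    le_iSup_of_le z (le_iSup_of_le l (le_iSup_of_le hl (le_iSup_of_le hx le_rfl)))
  rw [avg, volume_cube z hl.le, ENNReal.inv_mul_le_iff (by simp; positivity) ENNReal.ofReal_ne_top] at h
  simpa only [enorm_pow, enorm_norm] using h

lemma sharpFun_of_subsingleton [Subsingleton (Rn n)] (f : Rn n → ℂ) (x : Rn n) : sharpFun f x = 0 := by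
  refine le_antisymm (iSup_le fun z => iSup_le fun l => iSup_le fun hl => iSup_le fun hx => ?_) zero_le
  refine iInf_le_of_le (f x) (le_of_eq ?_)
  have : ∀ y, f y = f x := fun y => congrArg f (Subsingleton.elim _ _)
  simp [avg, this]

end Conclusion

theorem theorem1p1 (n : ℕ) (ρ δ : ℝ) (hρ0 : 0 ≤ ρ) (hρ1 : ρ ≤ 1) (hδ0 : 0 ≤ δ) (hδ1 : δ < 1)
    (A : (Fin n → ℕ) → (Fin n → ℕ) → ℝ) :
    ∃ C : ℝ≥0, ∀ a : Rn n × Rn n → ℂ, IsSymbol (-((n : ℝ) / 2) * (1 - ρ)) ρ δ A a →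
      ∀ (u : 𝓢(Rn n, ℂ)) (x : Rn n),
        sharpFun (pseudoDiff a u) x ≤
          (C : ℝ≥0∞) * maximalFun (fun y => ‖u y‖ ^ 2) x ^ ((1 : ℝ) / 2) := by
  -- For `n = 0` the space is a point and the oscillation vanishes.
  rcases Nat.eq_zero_or_pos n with rfl | hn
  · exact ⟨0, fun a _ u x => by rw [sharpFun_of_subsingleton]; exact zero_le⟩
  obtain ⟨A', hA', hsym⟩ :=
    exists_symbolBounds hn (-((n : ℝ) / 2) * (1 - ρ)) ρ δ hρ0 hρ1 hδ0 hδ1 A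
  obtain ⟨K, hK, hosc⟩ := exists_oscillation_bound hn ρ δ A' hρ0 hρ1 hδ0 hδ1 hA'
  refine ⟨K.toNNReal, fun a ha u x => ?_⟩
  refine iSup_le fun z => iSup_le fun l => iSup_le fun hl => iSup_le fun hx => ?_
  obtain ⟨c₀, hc₀⟩ := hosc _ (hsym a ha) u z x l _ hl hx (cubeAvgLE_maximalFun u x)
  refine iInf_le_of_le c₀ ?_
  rw [avg, volume_cube z hl.le, ENNReal.inv_mul_le_iff (by simp; positivity) ENNReal.ofReal_ne_top]
  simp only [pseudoDiff_eq_freqOp]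
  refine hc₀.trans_eq ?_
  rw [mul_comm K, ENNReal.ofReal_mul (by positivity), mul_assoc]
  rfl
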